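/- Let $V$ be a finite-dimensional real vector space, let $Z=p+\sum_{i=1}^n[0,1]v_i\subseteq V$ be a zonotope of dimension $r$, and let $\pi\in V^*$ be generic, i.e. $\pi(v_i)\neq 0$ whenever $v_i\ne 0$. A \emph{cellular string} of $(Z,\pi)$ is a sequence $(F_1,\dots,F_l)$, $l\ge 1$, of faces of $Z$, none of them a single point (except that the trivial string $(Z)$ is always allowed), such that $F_1$ contains a point where $\pi$ is minimal on $Z$, $F_l$ contains a point where $\pi$ is maximal on $Z$, and consecutive faces $F_i,F_{i+1}$ meet in exactly a vertex $w_i$ with $\pi(x)\le\pi(w_i)\le\pi(y)$ for all $x\in F_i$, $y\in F_{i+1}$. It is \emph{proper} if it is not the trivial string $(Z)$. It is \emph{coherent} if there is $\psi\in V^*$ such that for every $i$ and every $q\in\pi(F_i)$ the set of minimizers of $\psi$ on $Z\cap\pi^{-1}(q)$ is $F_i\cap\pi^{-1}(q)$. The pair $(Z,\pi)$ is \emph{all-coherent} if all its cellular strings are coherent. The covectors of the oriented matroid of a point set $X$ in a real affine space are the sign vectors $(\operatorname{sign} f(x))_{x\in X}$ of the affine functions $f$; two point sets have the same oriented matroid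 if some bijection between them identifies their sets of covectors. An \emph{affine model} for $(Z,\pi)$ is a set of points in some $\mathbb R^d$ with the same oriented matroid as $\bigcup_i(\mathbb R v_i\cap\{\pi=1\})$. A \emph{coloop} of $X$ is a point $x\in X$ not in the affine span of $X\setminus\{x\}$. The following are equivalent. \begin{enumerate} \item $(Z,\pi)$ is all-coherent. \item There is no proper cellular string $(F_1,\dots,F_l)$ of $(Z,\pi)$ with $\sum_{i=1}^l(\dim F_i-1)\ge r-1$. \item $(Z,\pi)$ has an affine model of the form $E\cup L$, where $L$ is a (possibly empty) set of coloops of $E\cup L$, and $E$ is one of the following: \begin{itemize} \item $\emptyset$; \item $U_{2,n}$ for some $n\ge 2$: $n$ distinct points on a line; \item $E_{s,m}$ for some $s\ge 3$, $m\ge 1$: the vertices $e_1,\dots,e_s$ of an $(s-1)$-dimensional simplex together with $m$ distinct points $a_1,\dots,a_m$ in the interior of the simplex such that $a_1,\dots,a_m,e_s$ are collinear; \item $\tilde E_{s,m}$ for some $s\ge 3$, $m\ge 1$: defined as $E_{s,m}$, except that $a_1$ is a non-vertex point on the boundary of the simplex; \item $R_3$: the three vertices $A,B,C$ of a triangle together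 with the three pairwise intersection points of segments $AA',BB',CC'$ that have no common point, where $A',B',C'$ are relative interior points of the sides opposite to $A,B,C$. \end{itemize} \end{enumerate} -/

import Mathlib

namespace Zono

section Zonotopes

variable {V : Type*} [AddCommGroup V] [Module ℝ V]

/-- The zonotope generated by the vectors `v i`, translated by `p`. -/
def zonotope {ι : Type*} [Fintype ι] (p : V) (v : ι → V) : Set V :=
  {x | ∃ t : ι → ℝ, (∀ i, 0 ≤ t i ∧ t i ≤ 1) ∧ x = p + ∑ i, t i • v i}

/-- `π` is generic for the zonotope generated by `v`: it vanishes on no nonzero generator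
(equivalently, it lies on no hyperplane of the arrangement dual to the zonotope). -/
def IsGeneric {ι : Type*} (v : ι → V) (π : Module.Dual ℝ V) : Prop :=
  ∀ i, v i ≠ 0 → π (v i) ≠ 0

/-- The dimension of a subset of `V`: the dimension of its affine hull. -/
noncomputable def dim (S : Set V) : ℕ := Module.finrank ℝ (vectorSpan ℝ S)

/-- The set of points of `P` at which `ψ` is minimized over `P`. -/
def minFace (P : Set V) (ψ : Module.Dual ℝ V) : Set V :=
  {x ∈ P | ∀ y ∈ P, ψ x ≤ ψ y}

/-- `F` is a (nonempty) face of the polytope `P`. -/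
def IsFace (P F : Set V) : Prop :=
  F.Nonempty ∧ ∃ ψ : Module.Dual ℝ V, F = minFace P ψ

/-- `(F 0, …, F l)` is a cellular string of the polytope `Z` with respect to `π`: a sequence of
faces, the first containing a point of `Z` where `π` is minimal, the last one where `π` is maximal,
such that consecutive faces meet in a vertex `w`, with `π ≤ π w` on the first of them and `π w ≤ π`
on the second. Cells are not allowed to be single points, except in the trivial string `(Z)` when
`Z` is itself a point. -/
structure IsCellularString (Z : Set V) (π : Module.Dual ℝ V) {l : ℕ}
    (F : Fin (l + 1) → Set V) : Prop where
  isFace : ∀ i, IsFace Z (F i)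
  nontrivial : (l = 0 ∧ ∀ i, F i = Z) ∨ ∀ i, (F i).Nontrivial
  bottom : ∃ b ∈ F 0, ∀ z ∈ Z, π b ≤ π z
  top : ∃ t ∈ F (Fin.last l), ∀ z ∈ Z, π z ≤ π t
  meet : ∀ i : Fin l, ∃ w : V, IsFace Z {w} ∧ F i.castSucc ∩ F i.succ = {w} ∧
    (∀ x ∈ F i.castSucc, π x ≤ π w) ∧ ∀ y ∈ F i.succ, π w ≤ π y

/-- The string is proper, that is, different from the trivial string `(Z)`. -/
def IsProper (Z : Set V) {l : ℕ} (F : Fin (l + 1) → Set V) : Prop :=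
  ¬ (l = 0 ∧ ∀ i, F i = Z)

/-- Coherence: some linear functional `ψ` selects the string in every fiber of `π`, that is,
`(Z ∩ π⁻¹(q))^ψ = F i ∩ π⁻¹(q)` whenever `q ∈ π(F i)`. -/
def IsCoherent (Z : Set V) (π : Module.Dual ℝ V) {l : ℕ} (F : Fin (l + 1) → Set V) : Prop :=
  ∃ ψ : Module.Dual ℝ V, ∀ i, ∀ q ∈ π '' F i, minFace (Z ∩ π ⁻¹' {q}) ψ = F i ∩ π ⁻¹' {q}

/-- `(Z, π)` is all-coherent: every cellular string is coherent. -/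
def AllCoherent (Z : Set V) (π : Module.Dual ℝ V) : Prop :=
  ∀ (l : ℕ) (F : Fin (l + 1) → Set V), IsCellularString Z π F → IsCoherent Z π F

/-- The points in which the lines spanned by the generators meet the hyperplane `π = 1`. -/
def pointConfig {ι : Type*} (v : ι → V) (π : Module.Dual ℝ V) : Set V :=
  ⋃ i, {x | (∃ t : ℝ, x = t • v i) ∧ π x = 1}

end Zonotopes

section PointConfigurations

variable {V : Type*} [AddCommGroup V] [Module ℝ V] {W : Type*} [AddCommGroup W] [Module ℝ W]

/-- The covectors of the oriented matroid of the affine point set `X`: the sign vectors on `X` of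
the affine functions. -/
def covectors (X : Set W) : Set (X → SignType) :=
  {s | ∃ f : W →ᵃ[ℝ] ℝ, ∀ x : X, s x = SignType.sign (f x)}

/-- Two point sets have the same oriented matroid: a bijection between them identifies their sets
of covectors. -/
def SameOrientedMatroid (X : Set V) (Y : Set W) : Prop :=
  ∃ e : X ≃ Y, ∀ s : Y → SignType, s ∈ covectors Y ↔ (fun x => s (e x)) ∈ covectors X

/-- The point set `X` is an affine model for the zonotope generated by `v` with functional `π`. -/
def IsAffineModel {ι : Type*} (v : ι → V) (π : Module.Dual ℝ V) (X : Set W) : Prop :=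
  SameOrientedMatroid (pointConfig v π) X

/-- `x` is a coloop of the affine point set `X`. -/
def IsColoop (X : Set W) (x : W) : Prop :=
  x ∈ X ∧ x ∉ affineSpan ℝ (X \ {x})

/-- `U_{2,n}`: `n` distinct points on a line. -/
def IsU (n : ℕ) (E : Set W) : Prop :=
  2 ≤ n ∧ E.ncard = n ∧ Collinear ℝ E

/-- `E_{k+1,m}`: the vertices of a `k`-dimensional simplex (`k + 1 ≥ 3`) and `m` distinct points
`a i` in its interior lying on a common line with the last vertex. -/
def IsE (k m : ℕ) (E : Set W) : Prop :=
  2 ≤ k ∧ 1 ≤ m ∧ ∃ (s : Affine.Simplex ℝ W k) (a : Fin m → W),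
    Function.Injective a ∧ (∀ i, a i ∈ s.interior) ∧
    Collinear ℝ (insert (s.points (Fin.last k)) (Set.range a)) ∧
    E = Set.range s.points ∪ Set.range a

/-- `Ẽ_{k+1,m}`: as `E_{k+1,m}`, except that the first of the points `a i` (which is still not a
vertex) lies on the boundary of the simplex. -/
def IsETilde (k m : ℕ) (E : Set W) : Prop :=
  2 ≤ k ∧ 1 ≤ m ∧ ∃ (s : Affine.Simplex ℝ W k) (a : Fin m → W),
    Function.Injective a ∧
    (∀ i : Fin m, (i : ℕ) = 0 →
      a i ∈ s.closedInterior ∧ a i ∉ s.interior ∧ a i ∉ Set.range s.points) ∧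
    (∀ i : Fin m, (i : ℕ) ≠ 0 → a i ∈ s.interior) ∧
    Collinear ℝ (insert (s.points (Fin.last k)) (Set.range a)) ∧
    E = Set.range s.points ∪ Set.range a

/-- `R_3`: the vertices `A, B, C` of a triangle and the three pairwise intersection points
`D, G, H` of three non-concurrent segments `AA', BB', CC'`, where `A', B', C'` are relative
interior points of the opposite sides. -/
def IsR3 (E : Set W) : Prop :=
  ∃ A B C A' B' C' D G H : W, AffineIndependent ℝ ![A, B, C] ∧
    A' ∈ openSegment ℝ B C ∧ B' ∈ openSegment ℝ C A ∧ C' ∈ openSegment ℝ A B ∧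
    D ∈ openSegment ℝ A A' ∩ openSegment ℝ B B' ∧
    G ∈ openSegment ℝ B B' ∩ openSegment ℝ C C' ∧
    H ∈ openSegment ℝ C C' ∩ openSegment ℝ A A' ∧
    D ≠ G ∧ E = {A, B, C, D, G, H}

/-- The point set `X` has the form `E ∪ L` with `E` of one of the listed forms and `L` a set of
coloops of `E ∪ L`. -/
def IsListed (X : Set W) : Prop :=
  ∃ E L : Set W, X = E ∪ L ∧ (∀ x ∈ L, IsColoop (E ∪ L) x) ∧
    (E = ∅ ∨ (∃ n, IsU n E) ∨ (∃ k m, IsE k m E) ∨ (∃ k m, IsETilde k m E) ∨ IsR3 E)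

end PointConfigurations

end Zono

/-! Scale the generators to the hyperplane `π = 1` and let `X` be the resulting point set. Each
generator is parallel to exactly one cell of a nontrivial cellular string, so the string amounts to
a weak order on `X`, given by a function `b`, in which every level is cut out by a functional that
is negative on lower and positive on higher levels: an `IsStringOrder`. The string is coherent iff
one functional induces the whole order. The dimension of a cell is the rank of its level, so
condition 2 says that `X` is lean. The core of the proof is a cycle for finite `X` (`isLean_tfae`).

All orders induced implies lean. If `g` induces `b`, the directions of all levels lie in the kernel
of `g` inside the direction space of `X`. If the level dimensions add up to too much, these
directions satisfy a linear relation. Splitting each level according to the signs of the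
coefficients gives a string order that no functional can induce, since it would make the relation
strictly positive.

Lean implies aligned (`IsLean.isAligned`). Big string orders come from sweeping a functional from a
lower face through a chosen hyperplane to an upper face. Sweeping away from a facet shows that only
one exposed point can lie off it, so `X` lies in a simplex spanned by points of `X`. Sweeping from
one face of the simplex to the complementary face through two non-vertices shows that the line of
any two non-vertices contains a vertex.

Aligned implies all orders induced. By `IsAligned.cases`, either all non-vertices lie on one line
through a vertex, or exactly three of them form a cyclic triangle. A functional may be prescribed
freely at the vertices of the simplex. In both cases the values can be chosen as a strictly
increasing function of `b` that the few remaining points also respect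
(`exists_inducesOrder_of_line`, `exists_inducesOrder_of_triangle`).

The same classification, with the irrelevant vertices split off as coloops, gives the list in
condition 3. Alignment is formulated by signs of affine functions only, so it passes between `X` and
any affine model. -/

namespace Zono

open Module Filter Topology

/-! ### String orders, sweeps, and facets of lean sets -/

section Aligned

variable {W : Type*} [AddCommGroup W] [Module ℝ W]

/-- `X` lies in the simplex with vertex set `T ⊆ X`, and any two points of `X` other than vertices
are collinear with a vertex. All conditions are expressed by signs of affine functions. -/
structure IsAligned (X T : Set W) : Prop where
  subset : T ⊆ X
  dual : ∀ e ∈ T, ∃ f : W →ᵃ[ℝ] ℝ, 0 < f e ∧ ∀ x ∈ T, x ≠ e → f x = 0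
  pos : ∀ f : W →ᵃ[ℝ] ℝ, (∀ e ∈ T, 0 < f e) → ∀ x ∈ X, 0 < f x
  line : ∀ x ∈ X, x ∉ T → ∀ y ∈ X, y ∉ T → x ≠ y →
    ∃ e ∈ T, ∀ f : W →ᵃ[ℝ] ℝ, f x = 0 → f y = 0 → f e = 0

/-- The function `b` on `X` is weakly ordered like the positions of the points of `X` in the blocks
of a cellular string: each level is cut out by a functional separating lower and higher levels. -/
def IsStringOrder (X : Set W) (b : W → ℝ) : Prop :=
  ∀ x₀ ∈ X, ∃ f : Dual ℝ W, ∀ x ∈ X, SignType.sign (f x) = SignType.sign (b x - b x₀)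

/-- The linear functional `g` induces on `X` the same weak order as `b`. -/
def InducesOrder (X : Set W) (b : W → ℝ) (g : Dual ℝ W) : Prop :=
  ∀ x ∈ X, ∀ y ∈ X, (b x < b y → g x < g y) ∧ (b x = b y → g x = g y)

/-- In every string order with at least two levels, the affine dimensions of the levels add up to
less than the affine dimension of `X`. -/
def IsLean (X : Set W) : Prop :=
  ∀ b : W → ℝ, IsStringOrder X b → ∀ C : Finset ℝ, 2 ≤ C.card → (∀ c ∈ C, ∃ x ∈ X, b x = c) →
    ∑ c ∈ C, ((finrank ℝ (Submodule.span ℝ {x ∈ X | b x = c}) : ℤ) - 1)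
      < (finrank ℝ (Submodule.span ℝ X) : ℤ) - 1

lemma eventually_pos_add_mul {a b : ℝ} (h : 0 < a ∨ a = 0 ∧ 0 < b) :
    ∀ᶠ ε in 𝓝[>] (0 : ℝ), 0 < a + ε * b := by
  rcases h with h | ⟨rfl, h⟩
  · have : Tendsto (fun ε : ℝ => a + ε * b) (𝓝[>] 0) (𝓝 (a + 0 * b)) := by
      apply Tendsto.mono_left _ nhdsWithin_le_nhds
      exact Continuous.tendsto (by fun_prop) 0
    exact this.eventually (lt_mem_nhds (by simpa using h))
  · filter_upwards [self_mem_nhdsWithin] with ε hε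
    have : 0 < ε := hε
    simpa using mul_pos this h

/-- Three successive functionals, of which the first is a lower and the last an upper face, are
interpolated by a string order having their zero sets among its levels. -/
lemma exists_stringOrder_of_sweep {X : Set W} {f₁ f₂ f₃ : Dual ℝ W}
    (h₁ : ∀ x ∈ X, 0 ≤ f₁ x) (h₁₂ : ∀ x ∈ X, f₁ x = 0 → f₂ x < 0)
    (h₃ : ∀ x ∈ X, f₃ x ≤ 0) (h₃₂ : ∀ x ∈ X, f₃ x = 0 → 0 < f₂ x) :
    ∃ b : W → ℝ, IsStringOrder X b ∧ (∀ x ∈ X, f₁ x = 0 → b x = 0) ∧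
      (∀ x ∈ X, f₂ x = 0 → b x = 1) ∧ (∀ x ∈ X, f₃ x = 0 → b x = 2) := by
  classical
  have key1 : ∀ x ∈ X, f₂ x < 0 → 0 < f₁ x - f₂ x := fun x hx h => by linarith [h₁ x hx]
  have key2 : ∀ x ∈ X, 0 ≤ f₂ x → 0 < f₂ x - f₃ x := fun x hx h => by
    rcases h.eq_or_lt with h' | h'
    · rcases (h₃ x hx).eq_or_lt with h'' | h''
      · linarith [h₃₂ x hx h'']
      · linarith
    · linarith [h₃ x hx]
  have key0 : ∀ x ∈ X, 0 ≤ f₂ x → 0 < f₁ x := fun x hx h => by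
    rcases (h₁ x hx).eq_or_lt with h' | h'
    · linarith [h₁₂ x hx h'.symm]
    · exact h'
  have key3 : ∀ x ∈ X, f₂ x ≤ 0 → f₃ x < 0 := fun x hx h => by
    rcases (h₃ x hx).eq_or_lt with h' | h'
    · linarith [h₃₂ x hx h']
    · exact h'
  -- Along the broken line from `f₁` (time 0) through `f₂` (time 1) to `f₃` (time 2), `b x` is the
  -- time at which the value at `x` vanishes. The functional at time `b x₀` then cuts out the level
  -- of `x₀`.
  let b : W → ℝ := fun x => if f₂ x < 0 then f₁ x / (f₁ x - f₂ x) else 1 + f₂ x / (f₂ x - f₃ x)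
  have b1 : ∀ x, f₂ x < 0 → b x = f₁ x / (f₁ x - f₂ x) := fun x h => if_pos h
  have b2 : ∀ x, 0 ≤ f₂ x → b x = 1 + f₂ x / (f₂ x - f₃ x) := fun x h => if_neg (not_lt.2 h)
  have bl : ∀ x ∈ X, f₂ x < 0 → b x < 1 := fun x hx h => by
    rw [b1 x h, div_lt_one (key1 x hx h)]; linarith
  have bg : ∀ x ∈ X, 0 ≤ f₂ x → 1 ≤ b x := fun x hx h => by
    rw [b2 x h]; have := div_nonneg h (key2 x hx h).le; linarith
  refine ⟨b, fun x₀ hx₀ => ?_, fun x hx h => ?_, fun x hx h => ?_, fun x hx h => ?_⟩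
  · rcases lt_or_ge (f₂ x₀) 0 with h0 | h0
    · refine ⟨(1 - b x₀) • f₁ + b x₀ • f₂, fun x hx => ?_⟩
      have hb0 : 0 ≤ b x₀ := by rw [b1 _ h0]; exact div_nonneg (h₁ _ hx₀) (key1 _ hx₀ h0).le
      rcases lt_or_ge (f₂ x) 0 with h | h
      · have : ((1 - b x₀) • f₁ + b x₀ • f₂) x = (f₁ x - f₂ x) * (b x - b x₀) := by
          rw [b1 x h]
          have := (key1 x hx h).ne'
          simp only [LinearMap.add_apply, LinearMap.smul_apply, smul_eq_mul]
          field_simp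
          ring
        rw [this, sign_mul, sign_pos (key1 x hx h), one_mul]
      · rw [sign_pos (by linarith [bl _ hx₀ h0, bg _ hx h] : 0 < b x - b x₀), sign_pos]
        have := mul_pos (sub_pos.2 (bl _ hx₀ h0)) (key0 x hx h)
        have := mul_nonneg hb0 h
        simp only [LinearMap.add_apply, LinearMap.smul_apply, smul_eq_mul]
        linarith
    · set c := b x₀ - 1 with hc
      have hc' : b x₀ = c + 1 := by ring
      have hc0 : 0 ≤ c := by linarith [bg _ hx₀ h0]
      have hc1 : c ≤ 1 := by
        rw [hc, b2 _ h0, add_sub_cancel_left, div_le_one (key2 _ hx₀ h0)]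
        linarith [h₃ _ hx₀]
      refine ⟨(1 - c) • f₂ + c • f₃, fun x hx => ?_⟩
      rcases lt_or_ge (f₂ x) 0 with h | h
      · rw [sign_neg (by linarith [bg _ hx₀ h0, bl _ hx h] : b x - b x₀ < 0), sign_neg]
        simp only [LinearMap.add_apply, LinearMap.smul_apply, smul_eq_mul]
        have h3 := key3 x hx h.le
        rcases hc0.eq_or_lt with h' | h'
        · rw [← h']; linarith
        · nlinarith [mul_neg_of_pos_of_neg h' h3]
      · have : ((1 - c) • f₂ + c • f₃) x = (f₂ x - f₃ x) * (b x - b x₀) := by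
          rw [b2 x h, hc']
          have := (key2 x hx h).ne'
          simp only [LinearMap.add_apply, LinearMap.smul_apply, smul_eq_mul]
          field_simp
          ring
        rw [this, sign_mul, sign_pos (key2 x hx h), one_mul]
  · rw [b1 x (h₁₂ x hx h), h, zero_div]
  · rw [b2 x h.ge, h, zero_div, add_zero]
  · have h2 := h₃₂ x hx h
    rw [b2 x h2.le, h, sub_zero, div_self h2.ne']; norm_num

lemma exists_dual_injOn {X : Set W} (hX : X.Finite) : ∃ g : Dual ℝ W, Set.InjOn g X := by
  classical
  have : Finite X := hX
  let I := {p : X × X // p.1 ≠ p.2}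
  obtain ⟨g, hg⟩ := Module.exists_dual_forall_apply_ne_zero (K := ℝ) (M := W)
    (fun p : I => (p.1.1 : W) - p.1.2) (fun p => sub_ne_zero.2 fun h => p.2 (Subtype.ext h))
  refine ⟨g, fun x hx y hy hxy => ?_⟩
  by_contra hne
  exact hg ⟨(⟨x, hx⟩, ⟨y, hy⟩), fun h => hne (congrArg Subtype.val h)⟩ (by simp [hxy])

/-- The points of `X` at which a linear functional has a strict minimum over `X`, normalized to be
zero. -/
def exposed (X : Set W) : Set W :=
  {e ∈ X | ∃ h : Dual ℝ W, h e = 0 ∧ ∀ x ∈ X, x ≠ e → 0 < h x}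

/-- A small multiple of a functional injective on `X` breaks ties among the minimizers of `f`. Since
`π` is constant on `X`, subtracting a multiple of it makes the minimum zero. -/
lemma exists_exposed_min {X : Set W} (hX : X.Finite) (hne : X.Nonempty) {π : Dual ℝ W}
    (hπ : ∀ x ∈ X, π x = 1) (f : Dual ℝ W) : ∃ e ∈ exposed X, ∀ x ∈ X, f e ≤ f x := by
  obtain ⟨g, hg⟩ := exists_dual_injOn hX
  obtain ⟨e0, he0, hmin0⟩ := Set.exists_min_image X f hX hne
  obtain ⟨e, ⟨he, hfe⟩, hmin⟩ := Set.exists_min_image {x ∈ X | f x = f e0} g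
    (hX.subset fun x hx => hx.1) ⟨e0, he0, rfl⟩
  have hev : ∀ᶠ ε in 𝓝[>] (0 : ℝ), ∀ x ∈ X, x ≠ e → 0 < (f x - f e) + ε * (g x - g e) := by
    rw [hX.eventually_all]
    intro x hx
    by_cases hxe : x = e
    · simp [hxe]
    · have := eventually_pos_add_mul (a := f x - f e) (b := g x - g e) (by
        rcases (hmin0 x hx).eq_or_lt with h | h
        · right
          refine ⟨by rw [hfe, h, sub_self], sub_pos.2 (lt_of_le_of_ne (hmin x ⟨hx, h.symm⟩) ?_)⟩
          exact fun h' => hxe (hg hx he h'.symm)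
        · left; rw [hfe]; linarith)
      filter_upwards [this] with ε hε _ using hε
  obtain ⟨ε, hε⟩ := hev.exists
  refine ⟨e, ⟨he, f + ε • g - (f e + ε * g e) • π, ?_, fun x hx hxe => ?_⟩,
    fun x hx => hfe ▸ hmin0 x hx⟩
  · simp [hπ e he]
  · have := hε x hx hxe
    simp only [LinearMap.sub_apply, LinearMap.add_apply, LinearMap.smul_apply, smul_eq_mul, hπ x hx]
    linarith

variable [FiniteDimensional ℝ W]

lemma one_le_finrank_span {S : Set W} {x : W} (hx : x ∈ S) (h0 : x ≠ 0) :
    1 ≤ finrank ℝ (Submodule.span ℝ S) := by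
  rw [Nat.one_le_iff_ne_zero]
  intro h
  rw [Submodule.finrank_eq_zero] at h
  exact h0 (by simpa [h] using Submodule.subset_span (R := ℝ) hx)

lemma two_le_finrank_span {π : Dual ℝ W} {S : Set W} {x y : W} (hx : x ∈ S) (hy : y ∈ S)
    (hπx : π x = 1) (hπy : π y = 1) (hxy : x ≠ y) : 2 ≤ finrank ℝ (Submodule.span ℝ S) := by
  have hli : LinearIndependent ℝ ![x, y] := by
    rw [LinearIndependent.pair_iff]
    intro s t h
    have h1 : s + t = 0 := by simpa [hπx, hπy] using congrArg π h
    have h2 : t = -s := by linarith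
    rw [h2, neg_smul, ← sub_eq_add_neg, ← smul_sub, smul_eq_zero, sub_eq_zero] at h
    rcases h with h | h
    · exact ⟨h, by simp [h2, h]⟩
    · exact absurd h hxy
  have := finrank_span_eq_card hli
  rw [Fintype.card_fin] at this
  refine this.symm.le.trans (Submodule.finrank_mono ?_)
  apply Submodule.span_mono
  rintro _ ⟨i, rfl⟩
  fin_cases i <;> assumption

/-- A facet of the cone over `X` avoiding `e`. Among nonnegative functionals positive at `e`, take
one whose zero set has maximal rank. If the corank were at least two, the functional could be
rotated about its zero set until it meets a further point, staying positive at `e`. -/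
lemma exists_lower_face_of_finite {X : Set W} (hX : X.Finite) {π : Dual ℝ W}
    (hπ : ∀ x ∈ X, π x = 1) {e : W} (he : e ∈ X) :
    ∃ f : Dual ℝ W, (∀ x ∈ X, 0 ≤ f x) ∧ 0 < f e ∧
      finrank ℝ (Submodule.span ℝ X) ≤ finrank ℝ (Submodule.span ℝ {x ∈ X | f x = 0}) + 1 := by
  classical
  let P : ℕ → Prop := fun n => ∃ f : Dual ℝ W, (∀ x ∈ X, 0 ≤ f x) ∧ 0 < f e ∧
    finrank ℝ (Submodule.span ℝ {x ∈ X | f x = 0}) = n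
  have hP : ∃ n, P n := ⟨_, π, fun x hx => by simp [hπ x hx], by simp [hπ e he], rfl⟩
  have hbd : ∀ n, P n → n ≤ finrank ℝ W := by
    rintro n ⟨f, -, -, rfl⟩; exact Submodule.finrank_le _
  obtain ⟨n0, hn0⟩ := hP
  obtain ⟨f, hf, hfe, hfn⟩ := Nat.findGreatest_spec (hbd n0 hn0) hn0
  refine ⟨f, hf, hfe, ?_⟩
  by_contra! hlt
  set Z := {x ∈ X | f x = 0} with hZ
  have hex : ∃ x1 ∈ X, x1 ∉ Submodule.span ℝ (insert e Z) := by
    by_contra! hall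
    have h1 : Submodule.span ℝ X ≤ Submodule.span ℝ (insert e Z) := Submodule.span_le.2 hall
    have h2 := Submodule.finrank_mono h1
    rw [Submodule.span_insert] at h2
    have h3 := Submodule.finrank_add_le_finrank_add_finrank (Submodule.span ℝ {e})
      (Submodule.span ℝ Z)
    have h4 := finrank_span_le_card (R := ℝ) ({e} : Set W)
    simp only [Set.toFinset_singleton, Finset.card_singleton] at h4
    omega
  obtain ⟨x1, hx1, hx1'⟩ := hex
  obtain ⟨g0, hg0, hg0'⟩ := Submodule.exists_le_ker_of_notMem hx1'
  obtain ⟨g, hg1, hgk⟩ : ∃ g : Dual ℝ W, g x1 < 0 ∧ ∀ z ∈ insert e Z, g z = 0 := by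
    have hz : ∀ z ∈ insert e Z, g0 z = 0 := fun z hz => hg0' (Submodule.subset_span hz)
    rcases lt_or_gt_of_ne hg0 with h | h
    · exact ⟨g0, h, hz⟩
    · exact ⟨-g0, by simpa using h, fun z h' => by simp [hz z h']⟩
  have hfx1 : 0 < f x1 := by
    rcases (hf x1 hx1).eq_or_lt with h | h
    · have hx1Z : x1 ∈ Z := ⟨hx1, h.symm⟩
      exact absurd (Submodule.subset_span (Set.mem_insert_of_mem _ hx1Z)) hx1'
    · exact h
  have hXf : {x ∈ X | 0 < f x}.Finite := hX.subset fun x hx => hx.1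
  -- The most negative ratio tells when the rotation first hits a point. `g - m • f` is still
  -- nonnegative and also vanishes at `x2`; at `e` it equals `-m * f e > 0`, because `g e = 0`.
  obtain ⟨x2, ⟨hx2, hfx2⟩, hmin⟩ := Set.exists_min_image _ (fun x => g x / f x) hXf ⟨x1, hx1, hfx1⟩
  set m := g x2 / f x2
  have hm : m < 0 := (hmin x1 ⟨hx1, hfx1⟩).trans_lt (div_neg_of_neg_of_pos hg1 hfx1)
  have hpos : ∀ x ∈ X, 0 ≤ (g - m • f) x := by
    intro x hx
    simp only [LinearMap.sub_apply, LinearMap.smul_apply, smul_eq_mul]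
    rcases (hf x hx).eq_or_lt with h | h
    · rw [hgk x (Set.mem_insert_of_mem _ ⟨hx, h.symm⟩), ← h]; simp
    · have := hmin x ⟨hx, h⟩
      rw [le_div_iff₀ h] at this
      linarith
  have hlt2 : Submodule.span ℝ Z < Submodule.span ℝ {x ∈ X | (g - m • f) x = 0} := by
    refine lt_of_le_of_ne (Submodule.span_mono ?_) ?_
    · rintro x hx
      refine ⟨hx.1, ?_⟩
      simp [hgk x (Set.mem_insert_of_mem _ hx), hx.2]
    · intro heq
      have hx2m : x2 ∈ Submodule.span ℝ Z := by
        rw [heq]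
        refine Submodule.subset_span ⟨hx2, ?_⟩
        simp only [LinearMap.sub_apply, LinearMap.smul_apply, smul_eq_mul, m]
        field_simp
        ring
      have : Submodule.span ℝ Z ≤ LinearMap.ker f := Submodule.span_le.2 fun x hx => hx.2
      exact hfx2.ne' (this hx2m)
  have := Submodule.finrank_lt_finrank_of_lt hlt2
  have hPn : P (finrank ℝ (Submodule.span ℝ {x ∈ X | (g - m • f) x = 0})) := by
    refine ⟨g - m • f, hpos, ?_, rfl⟩
    simp only [LinearMap.sub_apply, LinearMap.smul_apply, smul_eq_mul,
      hgk e (Set.mem_insert _ _)]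
    nlinarith [mul_neg_of_neg_of_pos hm hfe]
  have := Nat.le_findGreatest (hbd _ hPn) hPn
  omega

/-- The facet `f = 0` contributes at least the affine dimension of `X` minus one, and the level
through `x` and `y` at least one more, which leanness forbids. -/
lemma IsLean.false_of_lower_face {X : Set W} (hX : X.Finite) {π : Dual ℝ W}
    (hπ : ∀ x ∈ X, π x = 1) (hL : IsLean X) {f f₂ : Dual ℝ W} (hf : ∀ x ∈ X, 0 ≤ f x)
    (hr : finrank ℝ (Submodule.span ℝ X) ≤ finrank ℝ (Submodule.span ℝ {x ∈ X | f x = 0}) + 1)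
    (hf₂ : ∀ x ∈ X, f x = 0 → f₂ x < 0) {x y : W} (hx : x ∈ X) (hy : y ∈ X) (hxy : x ≠ y)
    (hx0 : f₂ x = 0) (hy0 : f₂ y = 0) : False := by
  obtain ⟨K, hK⟩ := (hX.image f₂).bddAbove
  have hK' : ∀ x ∈ X, f₂ x ≤ K := fun x hx => hK ⟨x, hx, rfl⟩
  -- The sweep needs a final functional; this one is negative on all of `X`, so its face is empty.
  have hneg : ∀ x ∈ X, (f₂ - (K + 1) • π) x < 0 := fun x hx => by
    have := hK' x hx
    simp only [LinearMap.sub_apply, LinearMap.smul_apply, smul_eq_mul, hπ x hx]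
    linarith
  obtain ⟨b, hb, hb0, hb1, -⟩ := exists_stringOrder_of_sweep hf hf₂
    (fun x hx => (hneg x hx).le) (fun x hx h => absurd h (hneg x hx).ne)
  have h2 := two_le_finrank_span (S := X) hx hy (hπ x hx) (hπ y hy) hxy
  have hne : ∃ z ∈ X, f z = 0 := by
    by_contra! hcon
    have : {x ∈ X | f x = 0} = ∅ := by ext z; simpa using hcon z
    rw [this, Submodule.span_empty, finrank_bot] at hr
    omega
  obtain ⟨z, hz, hz0⟩ := hne
  have := hL b hb {0, 1} (by simp) (by
    intro c hc
    simp only [Finset.mem_insert, Finset.mem_singleton] at hc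
    rcases hc with rfl | rfl
    · exact ⟨z, hz, hb0 z hz hz0⟩
    · exact ⟨x, hx, hb1 x hx hx0⟩)
  rw [Finset.sum_pair (by norm_num)] at this
  have h3 : finrank ℝ (Submodule.span ℝ {x ∈ X | f x = 0}) ≤
      finrank ℝ (Submodule.span ℝ {x ∈ X | b x = 0}) :=
    Submodule.finrank_mono (Submodule.span_mono fun w hw => ⟨hw.1, hb0 w hw.1 hw.2⟩)
  have h4 := two_le_finrank_span (S := {x ∈ X | b x = 1}) ⟨hx, hb1 x hx hx0⟩ ⟨hy, hb1 y hy hy0⟩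
    (hπ x hx) (hπ y hy) hxy
  omega

/-- An exposed point off a facet has maximal height over it: otherwise some hyperplane through it
and a higher point misses the facet, and sweeping contradicts leanness. Two exposed points off the
facet then have equal height, and the parallel hyperplane through both gives the same contradiction.
-/
lemma IsLean.lower_face_eq_zero {X : Set W} (hX : X.Finite) {π : Dual ℝ W}
    (hπ : ∀ x ∈ X, π x = 1) (hL : IsLean X) {f : Dual ℝ W} (hf : ∀ x ∈ X, 0 ≤ f x)
    (hr : finrank ℝ (Submodule.span ℝ X) ≤ finrank ℝ (Submodule.span ℝ {x ∈ X | f x = 0}) + 1)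
    {e e' : W} (he : e ∈ exposed X) (he' : e' ∈ exposed X) (hne : e' ≠ e) (hfe : 0 < f e) :
    f e' = 0 := by
  have aux : ∀ e₀ ∈ exposed X, 0 < f e₀ → ∀ x ∈ X, ¬ f e₀ < f x := by
    rintro e₀ ⟨he₀, h, hh, hpos⟩ hf₀ x hx hlt
    have hxe : x ≠ e₀ := fun h' => by simp [h'] at hlt
    have hd : 0 < f x - f e₀ := sub_pos.2 hlt
    have ht : 0 < h x / (f x - f e₀) := div_pos (hpos x hx hxe) hd
    -- Both `-h` and `f - f e₀ • π` vanish at `e₀`; the coefficient makes the combination vanish at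
    -- `x` too. On the facet the first is nonpositive and the second negative.
    refine hL.false_of_lower_face hX hπ hf hr (x := e₀) (y := x)
      (f₂ := -h + (h x / (f x - f e₀)) • (f - f e₀ • π)) ?_ he₀ hx hxe.symm ?_ ?_
    · intro z hz hz0
      have hhz : 0 ≤ h z := by
        by_cases hz' : z = e₀
        · rw [hz', hh]
        · exact (hpos z hz hz').le
      simp only [LinearMap.sub_apply, LinearMap.add_apply, LinearMap.neg_apply,
        LinearMap.smul_apply, smul_eq_mul, hπ z hz, hz0]
      nlinarith [mul_pos ht hf₀]
    · simp [hh, hπ e₀ he₀]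
    · simp only [LinearMap.sub_apply, LinearMap.add_apply, LinearMap.neg_apply,
        LinearMap.smul_apply, smul_eq_mul, hπ x hx]
      field_simp
      ring
  by_contra h0
  have hfe' : 0 < f e' := lt_of_le_of_ne (hf _ he'.1) (Ne.symm h0)
  have h1 := aux e he hfe e' he'.1
  have h2 := aux e' he' hfe' e he.1
  have heq : f e = f e' := le_antisymm (not_lt.1 h2) (not_lt.1 h1)
  refine hL.false_of_lower_face hX hπ hf hr (x := e) (y := e')
    (f₂ := f - f e • π) ?_ he.1 he'.1 hne.symm ?_ ?_
  · intro z hz hz0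
    simp [hπ z hz, hz0, hfe]
  · simp [hπ e he.1]
  · simp [hπ e' he'.1, heq]

end Aligned

/-! ### Barycentric coordinates, and lean sets are aligned -/

section Aligned

variable {W : Type*} [AddCommGroup W] [Module ℝ W]

/-- On the hyperplane `π = 1`, affine functions and linear functionals agree. -/
lemma exists_dual_eq_affineMap {π : Dual ℝ W} (f : W →ᵃ[ℝ] ℝ) :
    ∃ g : Dual ℝ W, ∀ x, π x = 1 → f x = g x := by
  refine ⟨f.linear + f 0 • π, fun x hx => ?_⟩
  have := f.map_vadd 0 x
  simp only [vadd_eq_add, add_zero] at this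
  simp [this, hx]

/-- Coordinates with respect to a dual basis of affine functions. -/
lemma sum_coord_smul_eq {X : Set W} {T : Finset W} {c : W → W →ᵃ[ℝ] ℝ}
    (h1 : ∀ e ∈ T, c e e = 1) (h0 : ∀ e ∈ T, ∀ e' ∈ T, e' ≠ e → c e e' = 0)
    (hpos : ∀ f : W →ᵃ[ℝ] ℝ, (∀ e ∈ T, 0 < f e) → ∀ x ∈ X, 0 < f x) {x : W} (hx : x ∈ X) :
    (∀ e ∈ T, 0 ≤ c e x) ∧ ∑ e ∈ T, c e x = 1 ∧ ∑ e ∈ T, c e x • e = x := by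
  have hzero : ∀ g : W →ᵃ[ℝ] ℝ, (∀ e ∈ T, 0 ≤ g e) → 0 ≤ g x := by
    intro g hg
    -- Adding a small constant turns a function nonnegative on `T` into a positive one, to which
    -- `hpos` applies.
    refine le_of_forall_pos_le_add fun ε hε => ?_
    have := hpos (g + AffineMap.const ℝ W ε) (fun e he => by
      have := hg e he
      simp only [AffineMap.coe_add, Pi.add_apply, AffineMap.coe_const, Function.const_apply]
      linarith) x hx
    simpa using this.le
  have hsum : ∀ (g : W → ℝ) (y : W), (∑ e ∈ T, g e • c e) y = ∑ e ∈ T, g e * c e y := fun g y => by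
    classical
    clear h1 h0 hpos hzero
    induction T using Finset.induction_on with
    | empty => simp
    | insert a s ha ih => simp [Finset.sum_insert ha, ih]
  -- Interpolating `g` at the vertices leaves an error vanishing on `T`, hence nonnegative on `X`.
  -- The same for `-g` makes the error zero on `X`.
  have key : ∀ g : W →ᵃ[ℝ] ℝ, 0 ≤ (∑ e ∈ T, g e • c e - g) x := fun g => by
    refine hzero _ fun e he => ?_
    rw [AffineMap.coe_sub, Pi.sub_apply, hsum,
      Finset.sum_eq_single e (fun e' he' hne => by rw [h0 e' he' e he hne.symm, mul_zero])
      (fun h => absurd he h), h1 e he, mul_one, sub_self]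
  have key2 : ∀ g : W →ᵃ[ℝ] ℝ, ∑ e ∈ T, c e x * g e = g x := fun g => by
    have h2 := key g
    have h3 := key (-g)
    rw [AffineMap.coe_sub, Pi.sub_apply, hsum] at h2 h3
    simp only [AffineMap.coe_neg, Pi.neg_apply, neg_mul, Finset.sum_neg_distrib] at h3
    have : ∑ e ∈ T, c e x * g e = ∑ e ∈ T, g e * c e x := by simp [mul_comm]
    linarith
  refine ⟨fun e he => hzero _ fun e' he' => ?_, ?_, ?_⟩
  · by_cases h : e' = e
    · rw [h, h1 e he]; exact zero_le_one
    · rw [h0 e he e' he' h]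
  · simpa using key2 (AffineMap.const ℝ W 1)
  · rw [← sub_eq_zero, ← Module.forall_dual_apply_eq_zero_iff ℝ]
    intro g
    simpa [sub_eq_zero] using key2 g.toAffineMap

lemma linearIndepOn_of_coord {T : Finset W} {c : W → Dual ℝ W}
    (h1 : ∀ e ∈ T, c e e = 1) (h0 : ∀ e ∈ T, ∀ e' ∈ T, e' ≠ e → c e e' = 0) :
    LinearIndepOn ℝ id (T : Set W) := by
  rw [linearIndepOn_finset_iff]
  intro f hf e he
  have := congrArg (c e) hf
  simp only [id, map_sum, map_smul, smul_eq_mul, map_zero] at this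
  rwa [Finset.sum_eq_single e (fun e' he' hne => by rw [h0 e he e' he' hne, mul_zero])
    (fun h => absurd he h), h1 e he, mul_one] at this

variable [FiniteDimensional ℝ W]

lemma card_le_finrank_span {T : Finset W} (hT : LinearIndepOn ℝ id (T : Set W)) {S : Set W}
    (hTS : ↑T ⊆ S) : T.card ≤ finrank ℝ (Submodule.span ℝ S) := by
  rw [← finrank_span_finset_eq_card hT]
  exact Submodule.finrank_mono (Submodule.span_mono hTS)

/-- Each exposed point has a facet avoiding it and containing all the others, which gives dual
coordinates: `X` lies in the simplex of its exposed points. For the line condition, a functional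
vanishing at two non-vertices but at no vertex would separate the vertices into two complementary
faces, and a sweep between these through the two points would be too big. -/
theorem IsLean.isAligned {X : Set W} (hX : X.Finite) {π : Dual ℝ W}
    (hπ : ∀ x ∈ X, π x = 1) (hL : IsLean X) : IsAligned X (exposed X) := by
  classical
  have hsub : exposed X ⊆ X := fun x hx => hx.1
  have hposl : ∀ f : Dual ℝ W, (∀ e ∈ exposed X, 0 < f e) → ∀ x ∈ X, 0 < f x := by
    intro f hf x hx
    obtain ⟨e, he, hmin⟩ := exists_exposed_min hX ⟨x, hx⟩ hπ f
    exact (hf e he).trans_le (hmin x hx)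
  have hdual : ∀ e : W, ∃ c : Dual ℝ W, e ∈ exposed X → c e = 1 ∧
      ∀ e' ∈ exposed X, e' ≠ e → c e' = 0 := by
    intro e
    by_cases he : e ∈ exposed X
    · obtain ⟨f, hf, hfe, hr⟩ := exists_lower_face_of_finite hX hπ he.1
      refine ⟨(f e)⁻¹ • f, fun _ => ⟨by simp [hfe.ne'], fun e' he' hne => ?_⟩⟩
      simp [hL.lower_face_eq_zero hX hπ hf hr he he' hne hfe]
    · exact ⟨0, fun h => absurd h he⟩
  choose c hc using hdual
  set T := (hX.subset hsub).toFinset with hT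
  have hTm : ∀ e, e ∈ T ↔ e ∈ exposed X := fun e => by simp [hT]
  have h1 : ∀ e ∈ T, c e e = 1 := fun e he => (hc e ((hTm e).1 he)).1
  have h0 : ∀ e ∈ T, ∀ e' ∈ T, e' ≠ e → c e e' = 0 := fun e he e' he' hne =>
    (hc e ((hTm e).1 he)).2 e' ((hTm e').1 he') hne
  have hTX : (T : Set W) ⊆ X := fun x hx => hsub ((hTm x).1 hx)
  have hpos' : ∀ f : W →ᵃ[ℝ] ℝ, (∀ e ∈ exposed X, 0 < f e) → ∀ x ∈ X, 0 < f x := by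
    intro f hf x hx
    obtain ⟨g, hg⟩ := exists_dual_eq_affineMap (π := π) f
    rw [hg x (hπ x hx)]
    exact hposl g (fun e he => by rw [← hg e (hπ e (hsub he))]; exact hf e he) x hx
  have hco' : ∀ x ∈ X, (∀ e ∈ T, 0 ≤ c e x) ∧ ∑ e ∈ T, c e x = 1 ∧ ∑ e ∈ T, c e x • e = x :=
    fun x hx => sum_coord_smul_eq (c := fun e => (c e).toAffineMap) h1 h0
      (fun f hf => hpos' f fun e he => hf e ((hTm e).2 he)) hx
  have hco : ∀ x ∈ X, (∀ e ∈ T, 0 ≤ c e x) ∧ ∑ e ∈ T, c e x • e = x := fun x hx =>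
    ⟨(hco' x hx).1, (hco' x hx).2.2⟩
  have hval : ∀ x ∈ X, ∀ g : Dual ℝ W, g x = ∑ e ∈ T, c e x * g e := fun x hx g => by
    conv_lhs => rw [← (hco x hx).2]
    simp
  have hsum : ∀ x ∈ X, ∑ e ∈ T, c e x = 1 := fun x hx => (hco' x hx).2.1
  have hli := linearIndepOn_of_coord h1 h0
  have hspan : Submodule.span ℝ X = Submodule.span ℝ (T : Set W) := by
    refine le_antisymm (Submodule.span_le.2 fun x hx => ?_) (Submodule.span_mono hTX)
    rw [← (hco x hx).2]
    exact Submodule.sum_mem _ fun e he => Submodule.smul_mem _ _ (Submodule.subset_span he)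
  have hrank : finrank ℝ (Submodule.span ℝ X) = T.card := by
    rw [hspan, finrank_span_finset_eq_card hli]
  refine ⟨hsub, fun e he => ⟨(c e).toAffineMap, ?_, fun x hx hne => ?_⟩, hpos', ?_⟩
  · simp [(hc e he).1]
  · simpa using (hc e he).2 x hx hne
  · intro x hx hxT y hy hyT hxy
    have hmem : ∃ e ∈ T, e ∈ Submodule.span ℝ {x, y} := by
      by_contra! hcon
      set U := Submodule.span ℝ ({x, y} : Set W)
      -- If no vertex lies in the span `U` of `x` and `y`, a generic functional on the quotient by
      -- `U` is nonzero at every vertex.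
      obtain ⟨g, hg⟩ := Module.exists_dual_forall_apply_ne_zero (K := ℝ) (M := W ⧸ U)
        (fun e : T => U.mkQ e) (fun e => by
          rw [Submodule.mkQ_apply, Ne, Submodule.Quotient.mk_eq_zero]; exact hcon e e.2)
      set f : Dual ℝ W := g ∘ₗ U.mkQ with hf
      have hfe : ∀ e ∈ T, f e ≠ 0 := fun e he => hg ⟨e, he⟩
      have hfU : ∀ z ∈ U, f z = 0 := fun z hz => by
        rw [hf, LinearMap.comp_apply, Submodule.mkQ_apply, (Submodule.Quotient.mk_eq_zero U).2 hz,
          map_zero]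
      have hfx : f x = 0 := hfU x (Submodule.subset_span (by simp))
      have hfy : f y = 0 := hfU y (Submodule.subset_span (by simp))
      set P := T.filter fun e => 0 < f e with hPdef
      set N := T.filter fun e => ¬ 0 < f e with hNdef
      have hNlt : ∀ e ∈ N, f e < 0 := fun e he => by
        rw [hNdef, Finset.mem_filter] at he
        exact lt_of_le_of_ne (not_lt.1 he.2) (hfe e he.1)
      have hexpos : ∀ z ∈ X, ∃ e ∈ T, 0 < c e z := fun z hz => by
        by_contra! hle
        have := Finset.sum_nonpos hle
        rw [hsum z hz] at this
        linarith
      have hPne : P.Nonempty := by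
        by_contra hem
        obtain ⟨e, he, hce⟩ := hexpos x hx
        have hall : ∀ e ∈ T, f e < 0 := fun e he => hNlt e (by
          rw [hNdef, Finset.mem_filter]
          refine ⟨he, fun h => hem ⟨e, ?_⟩⟩
          rw [hPdef, Finset.mem_filter]; exact ⟨he, h⟩)
        have := hval x hx f
        rw [hfx] at this
        have hlt : ∑ e ∈ T, c e x * f e < 0 := Finset.sum_neg'
          (fun e' he' => mul_nonpos_of_nonneg_of_nonpos ((hco x hx).1 e' he') (hall e' he').le)
          ⟨e, he, mul_neg_of_pos_of_neg hce (hall e he)⟩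
        linarith
      have hNne : N.Nonempty := by
        by_contra hem
        obtain ⟨e, he, hce⟩ := hexpos x hx
        have hall : ∀ e ∈ T, 0 < f e := fun e he => by
          by_contra h
          exact hem ⟨e, by rw [hNdef, Finset.mem_filter]; exact ⟨he, h⟩⟩
        have := hval x hx f
        rw [hfx] at this
        have hlt : 0 < ∑ e ∈ T, c e x * f e := Finset.sum_pos'
          (fun e' he' => mul_nonneg ((hco x hx).1 e' he') (hall e' he').le)
          ⟨e, he, mul_pos hce (hall e he)⟩
        linarith
      have hPT : P ⊆ T := Finset.filter_subset _ _
      have hNT : N ⊆ T := Finset.filter_subset _ _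
      have hdisj : Disjoint P N := Finset.disjoint_filter_filter_not _ _ _
      have hcard : P.card + N.card = T.card := Finset.card_filter_add_card_filter_not _
      have hsplit : ∀ u : W → ℝ, ∑ e ∈ T, u e = ∑ e ∈ P, u e + ∑ e ∈ N, u e := fun u =>
        (Finset.sum_filter_add_sum_filter_not T _ u).symm
      -- On `X`, the first functional vanishes on the face spanned by `N` and the last one on the
      -- face spanned by `P`; `f` is negative on the former and positive on the latter.
      obtain ⟨b, hb, hb0, hb1, hb2⟩ := exists_stringOrder_of_sweep (X := X)
        (f₁ := ∑ e ∈ P, c e) (f₂ := f) (f₃ := -∑ e ∈ N, c e)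
        (fun z hz => by
          rw [LinearMap.sum_apply]
          exact Finset.sum_nonneg fun e he => (hco z hz).1 e (hPT he))
        (fun z hz h => by
          rw [LinearMap.sum_apply, Finset.sum_eq_zero_iff_of_nonneg
            fun e he => (hco z hz).1 e (hPT he)] at h
          obtain ⟨e, he, hce⟩ := hexpos z hz
          have heN : e ∈ N := by
            rw [hNdef, Finset.mem_filter]
            refine ⟨he, fun hfe => hce.ne' (h e ?_)⟩
            rw [hPdef, Finset.mem_filter]; exact ⟨he, hfe⟩
          rw [hval z hz f, hsplit, Finset.sum_eq_zero (fun e he => by rw [h e he, zero_mul]),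
            zero_add]
          exact Finset.sum_neg'
            (fun e' he' => mul_nonpos_of_nonneg_of_nonpos ((hco z hz).1 e' (hNT he'))
              (hNlt e' he').le) ⟨e, heN, mul_neg_of_pos_of_neg hce (hNlt e heN)⟩)
        (fun z hz => by
          rw [LinearMap.neg_apply, LinearMap.sum_apply, neg_nonpos]
          exact Finset.sum_nonneg fun e he => (hco z hz).1 e (hNT he))
        (fun z hz h => by
          rw [LinearMap.neg_apply, neg_eq_zero, LinearMap.sum_apply,
            Finset.sum_eq_zero_iff_of_nonneg fun e he => (hco z hz).1 e (hNT he)] at h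
          obtain ⟨e, he, hce⟩ := hexpos z hz
          have hP' : ∀ e ∈ P, 0 < f e := fun e he => (Finset.mem_filter.1 he).2
          have heP : e ∈ P := by
            rw [hPdef, Finset.mem_filter]
            refine ⟨he, ?_⟩
            by_contra hfe
            exact hce.ne' (h e (by rw [hNdef, Finset.mem_filter]; exact ⟨he, hfe⟩))
          rw [hval z hz f, hsplit, Finset.sum_eq_zero (s := N)
            (fun e he => by rw [h e he, zero_mul]), add_zero]
          exact Finset.sum_pos'
            (fun e' he' => mul_nonneg ((hco z hz).1 e' (hPT he')) (hP' e' he').le)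
            ⟨e, heP, mul_pos hce (hP' e heP)⟩)
      have hN0 : (N : Set W) ⊆ {x ∈ X | b x = 0} := fun e he => by
        refine ⟨hTX (hNT he), hb0 e (hTX (hNT he)) ?_⟩
        rw [LinearMap.sum_apply]
        exact Finset.sum_eq_zero fun e' he' => h0 e' (hPT he') e (hNT he)
          fun h => Finset.disjoint_left.1 hdisj he' (h ▸ he)
      have hP2 : (P : Set W) ⊆ {x ∈ X | b x = 2} := fun e he => by
        refine ⟨hTX (hPT he), hb2 e (hTX (hPT he)) ?_⟩
        rw [LinearMap.neg_apply, neg_eq_zero, LinearMap.sum_apply]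
        exact Finset.sum_eq_zero fun e' he' => h0 e' (hNT he') e (hPT he)
          fun h => Finset.disjoint_left.1 hdisj he (h ▸ he')
      obtain ⟨p, hp⟩ := hPne
      obtain ⟨n, hn⟩ := hNne
      have hfin := hL b hb {0, 1, 2} (by
          rw [Finset.card_insert_of_notMem (by norm_num)]; simp) (by
        intro t ht
        simp only [Finset.mem_insert, Finset.mem_singleton] at ht
        rcases ht with rfl | rfl | rfl
        · exact ⟨n, hN0 hn⟩
        · exact ⟨x, hx, hb1 x hx hfx⟩
        · exact ⟨p, hP2 hp⟩)
      -- The levels contribute at least `|N| - 1`, `1` and `|P| - 1`. These add up to `|T| - 1`, the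
      -- affine dimension of `X`.
      rw [Finset.sum_insert (by norm_num), Finset.sum_pair (by norm_num), hrank] at hfin
      have k0 := card_le_finrank_span (hli.mono (Finset.coe_subset.2 hNT)) hN0
      have k2 := card_le_finrank_span (hli.mono (Finset.coe_subset.2 hPT)) hP2
      have k1 := two_le_finrank_span (S := {x ∈ X | b x = 1}) ⟨hx, hb1 x hx hfx⟩
        ⟨hy, hb1 y hy hfy⟩ (hπ x hx) (hπ y hy) hxy
      omega
    obtain ⟨e, he, heU⟩ := hmem
    refine ⟨e, (hTm e).1 he, fun f hfx hfy => ?_⟩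
    obtain ⟨g, hg⟩ := exists_dual_eq_affineMap (π := π) f
    rw [hg e (hπ e (hTX he))]
    rw [hg x (hπ x hx)] at hfx
    rw [hg y (hπ y hy)] at hfy
    have hle : Submodule.span ℝ {x, y} ≤ LinearMap.ker g := Submodule.span_le.2 (by
      rintro z (rfl | rfl)
      · exact hfx
      · exact hfy)
    exact hle heU

end Aligned

/-! ### Points of a simplex pairwise collinear with vertices -/

section Classification

/-- In terms of barycentric coordinates `c`, the points `x` and `y` lie on a common ray from the
vertex `u`, with ratio of distances `s`. -/
structure CollinearWithVertex {α I : Type*} (c : α → I → ℝ) (u : I) (x y : α) (s : ℝ) : Prop where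
  pos : 0 < s
  eq : ∀ e, e ≠ u → c y e = s * c x e

variable {α I : Type*} {c : α → I → ℝ} {u v w : I} {x y z p : α} {s s' : ℝ}

lemma CollinearWithVertex.symm (h : CollinearWithVertex c u x y s) :
    CollinearWithVertex c u y x s⁻¹ :=
  ⟨inv_pos.2 h.pos, fun e he => by rw [h.eq e he, inv_mul_cancel_left₀ h.pos.ne']⟩

lemma CollinearWithVertex.trans (h : CollinearWithVertex c u x y s)
    (h' : CollinearWithVertex c u y z s') : CollinearWithVertex c u x z (s' * s) :=
  ⟨mul_pos h'.pos h.pos, fun e he => by rw [h'.eq e he, h.eq e he, mul_assoc]⟩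

/-- Barycentric coordinates of points of a simplex, distinct from its vertices. -/
structure IsBarycentric [Fintype I] (c : α → I → ℝ) : Prop where
  nonneg : ∀ x e, 0 ≤ c x e
  sum_eq : ∀ x, ∑ e, c x e = 1
  inj : Function.Injective c
  not_vertex : ∀ x u, ∃ e, e ≠ u ∧ 0 < c x e

variable [Fintype I]

lemma IsBarycentric.eq_of_forall_eq_mul (hc : IsBarycentric c) (h : ∀ e, c y e = s * c x e) :
    x = y := by
  apply hc.inj
  have h1 := hc.sum_eq y
  simp only [h, ← Finset.mul_sum, hc.sum_eq x, mul_one] at h1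
  funext e
  rw [h e, h1, one_mul]

/-- At a nonzero coordinate other than `u` and `v` the two ratios would agree. Then all coordinates
would be proportional, and the points would coincide. -/
lemma IsBarycentric.on_edge (hc : IsBarycentric c)
    (hxy : x ≠ y) (huv : u ≠ v) (hu : CollinearWithVertex c u x y s)
    (hv : CollinearWithVertex c v x y s') (e : I) (heu : e ≠ u) (hev : e ≠ v) : c x e = 0 := by
  by_contra hne
  have h1 := hu.eq e heu
  rw [hv.eq e hev] at h1
  have hs : s' = s := mul_right_cancel₀ hne h1
  subst hs
  refine hxy (hc.eq_of_forall_eq_mul (s := s') fun e => ?_)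
  by_cases he : e = u
  · exact hv.eq e (he ▸ huv)
  · exact hu.eq e he

variable [DecidableEq I]

lemma IsBarycentric.add_eq_one (hc : IsBarycentric c) (huv : u ≠ v)
    (h : ∀ e, e ≠ u → e ≠ v → c x e = 0) : c x u + c x v = 1 := by
  rw [← hc.sum_eq x, ← Finset.sum_pair huv]
  exact Finset.sum_subset (Finset.subset_univ _) fun e _ he => by
    simp only [Finset.mem_insert, Finset.mem_singleton, not_or] at he
    exact h e he.1 he.2

lemma IsBarycentric.add_add_eq_one (hc : IsBarycentric c) (huv : u ≠ v) (huw : u ≠ w) (hvw : v ≠ w)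
    (h : ∀ e, e ≠ u → e ≠ v → e ≠ w → c x e = 0) : c x u + (c x v + c x w) = 1 := by
  rw [← hc.sum_eq x, ← Finset.sum_pair hvw, ← Finset.sum_insert (by simp [huv, huw])]
  exact Finset.sum_subset (Finset.subset_univ _) fun e _ he => by
    simp only [Finset.mem_insert, Finset.mem_singleton, not_or] at he
    exact h e he.1 he.2.1 he.2.2

lemma IsBarycentric.pos_of_edge (hc : IsBarycentric c) 
    (h : ∀ e, e ≠ u → e ≠ v → c x e = 0) : 0 < c x v := by
  obtain ⟨e, he, hpos⟩ := hc.not_vertex x u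
  by_cases hev : e = v
  · exact hev ▸ hpos
  · exact absurd (h e he hev) hpos.ne'

lemma IsBarycentric.collinear_of_edge (hc : IsBarycentric c)
    (hx : ∀ e, e ≠ u → e ≠ v → c x e = 0) (hy : ∀ e, e ≠ u → e ≠ v → c y e = 0) :
    CollinearWithVertex c u x y (c y v / c x v) := by
  have h1 := hc.pos_of_edge hx
  have h2 := hc.pos_of_edge hy
  refine ⟨div_pos h2 h1, fun e he => ?_⟩
  by_cases hev : e = v
  · rw [hev]; field_simp
  · rw [hx e he hev, hy e he hev, mul_zero]

/-- If two points lie on an edge, then all points do. -/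
lemma IsBarycentric.collinear_of_two_on_edge (hc : IsBarycentric c)
    (hQ : ∀ x y, ∃ u s, CollinearWithVertex c u x y s) (hxy : x ≠ y) (huv : u ≠ v)
    (hx : ∀ e, e ≠ u → e ≠ v → c x e = 0) (hy : ∀ e, e ≠ u → e ≠ v → c y e = 0) :
    ∀ x y, ∃ s, CollinearWithVertex c u x y s := by
  have key : ∀ z, ∀ e, e ≠ u → e ≠ v → c z e = 0 := by
    intro z
    obtain ⟨t, s, h⟩ := hQ x z
    obtain ⟨t', s', h'⟩ := hQ y z
    by_cases ht : t = u ∨ t = v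
    · intro e heu hev
      rw [h.eq e (by rcases ht with rfl | rfl <;> assumption), hx e heu hev, mul_zero]
    by_cases ht' : t' = u ∨ t' = v
    · intro e heu hev
      rw [h'.eq e (by rcases ht' with rfl | rfl <;> assumption), hy e heu hev, mul_zero]
    -- Now `z` is joined to `x` and `y` through vertices off the edge, so its edge coordinates are
    -- multiples of those of both. These sum to one for `x` and for `y`, so the multiples agree and
    -- `x = y`.
    push Not at ht ht'
    exfalso
    have e1 := h.eq u ht.1.symm
    have e2 := h.eq v ht.2.symm
    have e3 := h'.eq u ht'.1.symm
    have e4 := h'.eq v ht'.2.symm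
    have e5 := hc.add_eq_one huv hx
    have e6 := hc.add_eq_one huv hy
    have hs : s = s' := by
      have : s * (c x u + c x v) = s' * (c y u + c y v) := by linarith
      simpa [e5, e6] using this
    subst hs
    refine hxy (hc.eq_of_forall_eq_mul (s := 1) fun e => ?_)
    rw [one_mul]
    by_cases heu : e = u
    · subst heu; exact mul_left_cancel₀ h.pos.ne' (e3.symm.trans e1)
    by_cases hev : e = v
    · subst hev; exact mul_left_cancel₀ h.pos.ne' (e4.symm.trans e2)
    rw [hx e heu hev, hy e heu hev]
  exact fun x y => ⟨_, hc.collinear_of_edge (key x) (key y)⟩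

/-- The points are pairwise on lines through vertices, but not all on lines through the same one. -/
structure IsSpread (c : α → I → ℝ) : Prop extends IsBarycentric c where
  line : ∀ x y, ∃ u s, CollinearWithVertex c u x y s
  not_all : ∀ u, ∃ x y, ∀ s, ¬ CollinearWithVertex c u x y s

/-- With two such vertices, `x` and `y` lie on their edge. Then all points do, and all are collinear
with `u`, which is excluded. -/
lemma IsSpread.vertex_unique (hc : IsSpread c) (hxy : x ≠ y)
    (hu : CollinearWithVertex c u x y s) (hv : CollinearWithVertex c v x y s') : u = v := by
  by_contra huv
  have h1 := hc.on_edge hxy huv hu hv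
  have h2 := hc.on_edge hxy.symm huv hu.symm hv.symm
  obtain ⟨a, b, hab⟩ := hc.not_all u
  obtain ⟨t, ht⟩ := hc.collinear_of_two_on_edge hc.line hxy huv h1 h2 a b
  exact hab t ht

/-- Passing from `x` to `z` directly or via `y` scales any coordinate outside `u, v, w` by `s₂` or
`s₃ * s₁`; if these agreed, comparing the coordinate at `u` would give `x = y`. So `x` lies in the
triangle `u v w`. It lies on none of its edges, because `y` would lie on the same edge, forcing all
points onto it. -/
lemma IsSpread.rainbow (hc : IsSpread c) {s₁ s₂ s₃ : ℝ} (hxy : x ≠ y)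
    (hu : CollinearWithVertex c u x y s₁) (hv : CollinearWithVertex c v x z s₂)
    (hw : CollinearWithVertex c w y z s₃) (huv : u ≠ v) (huw : u ≠ w) (hvw : v ≠ w) :
    (∀ e, e ≠ u → e ≠ v → e ≠ w → c x e = 0) ∧ 0 < c x u ∧ 0 < c x v ∧ 0 < c x w := by
  have h0 : ∀ e, e ≠ u → e ≠ v → e ≠ w → c x e = 0 := by
    intro e h1 h2 h3
    by_contra hne
    have e1 := hw.eq e h3
    rw [hv.eq e h2, hu.eq e h1, ← mul_assoc] at e1
    have hs : s₂ = s₃ * s₁ := mul_right_cancel₀ hne e1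
    refine hxy (hc.eq_of_forall_eq_mul (s := s₁) fun t => ?_)
    by_cases htu : t = u
    · subst htu
      have e2 := hw.eq t huw
      rw [hv.eq t huv, hs, mul_assoc] at e2
      exact (mul_left_cancel₀ hw.pos.ne' e2).symm
    · exact hu.eq t htu
  have edge : ∀ a b, a ≠ b → (∀ e, e ≠ a → e ≠ b → c x e = 0) →
      (∀ e, e ≠ a → e ≠ b → c y e = 0) → False := fun a b hab h1 h2 => by
    obtain ⟨a', b', hab'⟩ := hc.not_all a
    obtain ⟨t, ht⟩ := hc.collinear_of_two_on_edge hc.line hxy hab h1 h2 a' b'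
    exact hab' t ht
  refine ⟨h0, ?_, ?_, ?_⟩
  · refine lt_of_le_of_ne (hc.nonneg x u) fun h => ?_
    refine edge v w hvw (fun e h1 h2 => ?_) (fun e h1 h2 => ?_)
    · by_cases he : e = u
      · rw [he, ← h]
      · exact h0 e he h1 h2
    · by_cases he : e = u
      · subst he
        have e2 := hw.eq e h2
        rw [hv.eq e h1, ← h, mul_zero] at e2
        exact (mul_eq_zero.1 e2.symm).resolve_left hw.pos.ne'
      · rw [hu.eq e he, h0 e he h1 h2, mul_zero]
  · refine lt_of_le_of_ne (hc.nonneg x v) fun h => ?_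
    have hx : ∀ e, e ≠ u → e ≠ w → c x e = 0 := fun e h1 h2 => by
      by_cases he : e = v
      · rw [he, ← h]
      · exact h0 e h1 he h2
    exact edge u w huw hx fun e h1 h2 => by rw [hu.eq e h1, hx e h1 h2, mul_zero]
  · refine lt_of_le_of_ne (hc.nonneg x w) fun h => ?_
    have hx : ∀ e, e ≠ u → e ≠ v → c x e = 0 := fun e h1 h2 => by
      by_cases he : e = w
      · rw [he, ← h]
      · exact h0 e h1 h2 he
    exact edge u v huv hx fun e h1 h2 => by rw [hu.eq e h1, hx e h1 h2, mul_zero]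

/-- Take two distinct points, the vertex `u` joining them, and a third point off their line through
`u`. If two of the three joining vertices coincided, the third point would lie on that line. -/
lemma IsSpread.exists_rainbow (hc : IsSpread c) [Nonempty I] :
    ∃ x y z u v w s₁ s₂ s₃, x ≠ y ∧ x ≠ z ∧ y ≠ z ∧ u ≠ v ∧ u ≠ w ∧ v ≠ w ∧
      CollinearWithVertex c u x y s₁ ∧ CollinearWithVertex c v x z s₂ ∧
      CollinearWithVertex c w y z s₃ := by
  obtain ⟨u0⟩ := ‹Nonempty I›
  have refl : ∀ (a : α) (t : I), CollinearWithVertex c t a a 1 := fun a t => ⟨one_pos, by simp⟩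
  obtain ⟨x, y, hxy⟩ := hc.not_all u0
  have hne : x ≠ y := fun h => hxy 1 (h ▸ refl x u0)
  obtain ⟨u, s₁, hu⟩ := hc.line x y
  obtain ⟨z, hz⟩ : ∃ z, ∀ s, ¬ CollinearWithVertex c u x z s := by
    by_contra! hcon
    obtain ⟨a, b, hab⟩ := hc.not_all u
    obtain ⟨_, ha⟩ := hcon a
    obtain ⟨_, hb⟩ := hcon b
    exact hab _ (ha.symm.trans hb)
  obtain ⟨v, s₂, hv⟩ := hc.line x z
  obtain ⟨w, s₃, hw⟩ := hc.line y z
  have hxz : x ≠ z := fun h => hz 1 (h ▸ refl x u)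
  have hyz : y ≠ z := fun h => hz s₁ (h ▸ hu)
  refine ⟨x, y, z, u, v, w, s₁, s₂, s₃, hne, hxz, hyz, ?_, ?_, ?_, hu, hv, hw⟩
  · rintro rfl; exact hz _ hv
  · rintro rfl; exact hz _ (hu.trans hw)
  · rintro rfl; exact hz _ (hc.vertex_unique hne hu (hv.trans hw.symm) ▸ hv)

/-- `y` lies strictly between `x` and the vertex `u`. -/
def BetweenVertex (c : α → I → ℝ) (u : I) (x y : α) : Prop :=
  ∃ τ : ℝ, 0 < τ ∧ τ < 1 ∧ ∀ e, c y e = (1 - τ) * c x e + if e = u then τ else 0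

lemma IsBarycentric.coord_vertex (hc : IsBarycentric c) (h : CollinearWithVertex c u x y s) (e : I) :
    c y e = (1 - (1 - s)) * c x e + if e = u then 1 - s else 0 := by
  split_ifs with he
  · subst he
    have h1 := hc.sum_eq x
    have h2 := hc.sum_eq y
    rw [← Finset.add_sum_erase _ _ (Finset.mem_univ e)] at h1 h2
    have h3 : ∑ t ∈ Finset.univ.erase e, c y t = s * ∑ t ∈ Finset.univ.erase e, c x t := by
      rw [Finset.mul_sum]
      exact Finset.sum_congr rfl fun t ht => h.eq t (Finset.ne_of_mem_erase ht)
    rw [h3] at h2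
    linear_combination h2 - s * h1
  · rw [h.eq e he]; ring

lemma IsBarycentric.between (hc : IsBarycentric c) (h : CollinearWithVertex c u x y s)
    (hs : s < 1) : BetweenVertex c u x y :=
  ⟨1 - s, by linarith, by linarith [h.pos], hc.coord_vertex h⟩

/-- Points that are pairwise on lines through vertices, but not all on lines through the same one,
are three points, each lying between another one and a vertex, cyclically. -/
theorem IsSpread.eq_triangle (hc : IsSpread c) [Nonempty I] :
    ∃ x y z u v w, u ≠ v ∧ u ≠ w ∧ v ≠ w ∧ x ≠ z ∧ (∀ p, p = x ∨ p = y ∨ p = z) ∧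
      BetweenVertex c u x y ∧ BetweenVertex c w y z ∧ BetweenVertex c v z x := by
  -- Any three points joined by three different vertices exhaust all points, and the ratio `s₁`
  -- decides the sense of the cycle.
  have main : ∀ x y z u v w s₁ s₂ s₃, x ≠ y → x ≠ z → y ≠ z → u ≠ v → u ≠ w → v ≠ w →
      CollinearWithVertex c u x y s₁ → CollinearWithVertex c v x z s₂ →
      CollinearWithVertex c w y z s₃ → (∀ p, p = x ∨ p = y ∨ p = z) ∧
      (s₁ < 1 → BetweenVertex c u x y ∧ BetweenVertex c w y z ∧ BetweenVertex c v z x) ∧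
      s₁ ≠ 1 := by
    intro x y z u v w s₁ s₂ s₃ hxy hxz hyz huv huw hvw hu hv hw
    obtain ⟨hx0, hxu, hxv, hxw⟩ := hc.rainbow hxy hu hv hw huv huw hvw
    obtain ⟨hy0, hyu, hyw, hyv⟩ := hc.rainbow hxy.symm hu.symm hw hv huw huv hvw.symm
    obtain ⟨hz0, hzv, hzw, hzu⟩ := hc.rainbow hxz.symm hv.symm hw.symm hu hvw huv.symm huw.symm
    have eyv := hu.eq v huv.symm
    have eyw := hu.eq w huw.symm
    have ezu := hv.eq u huv
    have ezw := hv.eq w hvw.symm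
    have ezu' := hw.eq u huw
    have ezv' := hw.eq v hvw
    have sx := hc.add_add_eq_one huv huw hvw hx0
    have sy := hc.add_add_eq_one huv huw hvw fun e h1 h2 h3 => hy0 e h1 h3 h2
    have sz := hc.add_add_eq_one huv huw hvw fun e h1 h2 h3 => hz0 e h2 h3 h1
    have p1 := hu.pos
    have p2 := hv.pos
    have p3 := hw.pos
    refine ⟨fun p => ?_, fun hs' => ?_, fun hs => ?_⟩
    · by_contra! hp
      obtain ⟨hpx, hpy, hpz⟩ := hp
      obtain ⟨c1, t1, k1⟩ := hc.line p x
      obtain ⟨c2, t2, k2⟩ := hc.line p y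
      obtain ⟨c3, t3, k3⟩ := hc.line p z
      -- A joining vertex outside `u, v, w` would make `p, x, y` a triple of the kind treated in
      -- `rainbow`, giving `x` a positive coordinate outside its triangle.
      have n1 : c1 ≠ u → c1 ≠ v → c1 = w := by
        intro h1 h2
        by_contra h3
        by_cases hc2 : c1 = c2
        · subst hc2
          exact h1 (hc.vertex_unique hxy (k1.symm.trans k2) hu)
        by_cases hc2' : c2 = u
        · subst hc2'
          exact h1 (hc.vertex_unique hpx k1 (k2.trans hu.symm))
        have := hc.rainbow hpx.symm k1.symm hu k2 h1 hc2 (Ne.symm hc2')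
        exact this.2.1.ne' (hx0 c1 h1 h2 h3)
      have n2 : c2 ≠ u → c2 ≠ w → c2 = v := by
        intro h1 h2
        by_contra h3
        by_cases hc2 : c2 = c1
        · subst hc2
          exact h1 (hc.vertex_unique hxy (k1.symm.trans k2) hu)
        by_cases hc2' : c1 = u
        · subst hc2'
          exact h1 (hc.vertex_unique hpy k2 (k1.trans hu))
        have := hc.rainbow hpy.symm k2.symm hu.symm k1 h1 hc2 (Ne.symm hc2')
        exact this.2.1.ne' (hy0 c2 h1 h2 h3)
      have n3 : c3 ≠ v → c3 ≠ w → c3 = u := by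
        intro h1 h2
        by_contra h3
        by_cases hc2 : c3 = c1
        · subst hc2
          exact h1 (hc.vertex_unique hxz (k1.symm.trans k3) hv)
        by_cases hc2' : c1 = v
        · subst hc2'
          exact h1 (hc.vertex_unique hpz k3 (k1.trans hv))
        have := hc.rainbow hpz.symm k3.symm hv.symm k1 h1 hc2 (Ne.symm hc2')
        exact this.2.1.ne' (hz0 c3 h1 h2 h3)
      have m1 : c1 ≠ u := by
        rintro rfl
        have : c2 = c1 := hc.vertex_unique hpy k2 (k1.trans hu)
        subst this
        have a1 : c3 ≠ v := by
          rintro rfl; exact huv (hc.vertex_unique hpx k1 (k3.trans hv.symm))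
        have a2 : c3 ≠ w := by
          rintro rfl; exact huw (hc.vertex_unique hpy k2 (k3.trans hw.symm))
        have := n3 a1 a2
        subst this
        exact huv (hc.vertex_unique hxz (k1.symm.trans k3) hv)
      have m1' : c1 ≠ v := by
        rintro rfl
        have : c3 = c1 := hc.vertex_unique hpz k3 (k1.trans hv)
        subst this
        have a1 : c2 ≠ u := by
          rintro rfl; exact huv (hc.vertex_unique hpx (k2.trans hu.symm) k1)
        have a2 : c2 ≠ w := by
          rintro rfl; exact hvw (hc.vertex_unique hpz k3 (k2.trans hw))
        have := n2 a1 a2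
        subst this
        exact hvw (hc.vertex_unique hyz (k2.symm.trans k3) hw)
      have := n1 m1 m1'
      subst this
      have m2 : c2 ≠ u := by
        rintro rfl; exact m1 (hc.vertex_unique hpx k1 (k2.trans hu.symm))
      have m2' : c2 ≠ c1 := by
        rintro rfl; exact huw (hc.vertex_unique hxy hu (k1.symm.trans k2))
      have := n2 m2 m2'
      subst this
      have m3 : c3 ≠ c2 := by
        rintro rfl; exact m1' (hc.vertex_unique hpx k1 (k3.trans hv.symm))
      have m3' : c3 ≠ c1 := by
        rintro rfl; exact m1' (hc.vertex_unique hxz (k1.symm.trans k3) hv)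
      have := n3 m3 m3'
      subst this
      -- Now `p, x, y, z` form a complete quadrangle whose diagonal points are the three vertices.
      -- In suitable homogeneous coordinates the four points are `(±1 : ±1 : 1)`, only one of which
      -- is positive. In the computation, multiplying the relations determines the square of `s₂` as
      -- that of `s₃ * s₁`, and positivity selects the root.
      have q1 := k1.eq c3 huw
      have q2 := k1.eq c2 hvw
      have q3 := k2.eq c3 huv
      have q4 := k2.eq c1 hvw.symm
      have q5 := k3.eq c2 huv.symm
      have q6 := k3.eq c1 huw.symm
      have r1 := k1.pos
      have r2 := k2.pos
      have r3 := k3.pos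
      have pu : 0 < c p c3 := pos_of_mul_pos_right (q1 ▸ hxu) r1.le
      have pv : 0 < c p c2 := pos_of_mul_pos_right (q2 ▸ hxv) r1.le
      have pw : 0 < c p c1 := pos_of_mul_pos_right (q4 ▸ hyw) r2.le
      have e1 : c x c2 * c p c3 = c x c3 * c p c2 := by rw [q1, q2]; ring
      have e2 : c y c3 * c p c1 = c y c1 * c p c3 := by rw [q3, q4]; ring
      have e3 : c z c1 * c p c2 = c z c2 * c p c1 := by rw [q5, q6]; ring
      have e4 : (c y c3 * c x c2 * c z c1) * (c p c3 * c p c2 * c p c1)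
          = (c y c1 * c x c3 * c z c2) * (c p c3 * c p c2 * c p c1) := by
        linear_combination (c y c3 * c p c1 * c z c1 * c p c2) * e1
          + (c x c3 * c p c2 * c z c1 * c p c2) * e2
          + (c x c3 * c p c2 * c y c1 * c p c3) * e3
      have e5 := mul_right_cancel₀ (by positivity) e4
      rw [ezw, ezv', eyv, eyw] at e5
      have e6 : c y c3 * s₂ = s₁ ^ 2 * s₃ * c x c3 := by
        apply mul_right_cancel₀ (mul_pos hxv hxw).ne'
        linear_combination e5
      have e7 : s₂ * c x c3 = s₃ * c y c3 := ezu.symm.trans ezu'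
      have e8 : s₂ ^ 2 = (s₃ * s₁) ^ 2 := by
        apply mul_right_cancel₀ hxu.ne'
        linear_combination s₂ * e7 + s₃ * e6
      have e9 : s₂ = s₃ * s₁ := (pow_left_inj₀ p2.le (mul_pos p3 p1).le two_ne_zero).1 e8
      have e10 : c y c3 = s₁ * c x c3 := by
        apply mul_left_cancel₀ p3.ne'
        rw [← e7, e9]; ring
      refine hxy (hc.eq_of_forall_eq_mul (s := s₁) fun e => ?_)
      by_cases he : e = c3
      · rw [he, e10]
      · exact hu.eq e he
    · have hyu' : s₁ * c x u < c y u := by rw [eyv, eyw] at sy; nlinarith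
      have hs : s₃ * s₁ < s₂ := by
        have : s₃ * s₁ * c x u < s₂ * c x u := by
          rw [← ezu, ezu', mul_assoc]; exact mul_lt_mul_of_pos_left hyu' p3
        exact lt_of_mul_lt_mul_right this hxu.le
      have h2 : 1 < s₂ := by
        rw [ezv', ezu, ezw, eyv] at sz
        nlinarith [mul_lt_mul_of_pos_right hs hxv]
      have h3 : s₃ < 1 := by
        rw [ezv', ezu', ezw] at sz
        rw [eyw] at sy
        nlinarith [mul_lt_mul_of_pos_right hs hxw]
      exact ⟨hc.between hu hs', hc.between hw h3, hc.between hv.symm (inv_lt_one_of_one_lt₀ h2)⟩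
    · refine hxy (hc.eq_of_forall_eq_mul (s := 1) fun e => ?_)
      by_cases he : e = u
      · rw [he]; rw [eyv, eyw, hs] at sy; linarith
      · rw [hu.eq e he, hs]
  obtain ⟨x, y, z, u, v, w, s₁, s₂, s₃, hxy, hxz, hyz, huv, huw, hvw, hu, hv, hw⟩ :=
    hc.exists_rainbow
  obtain ⟨m1, m2, m3⟩ := main x y z u v w s₁ s₂ s₃ hxy hxz hyz huv huw hvw hu hv hw
  rcases lt_or_gt_of_ne m3 with h | h
  · obtain ⟨b1, b2, b3⟩ := m2 h
    exact ⟨x, y, z, u, v, w, huv, huw, hvw, hxz, m1, b1, b2, b3⟩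
  -- For `s₁ > 1`, exchanging `x` with `y` and `v` with `w` inverts the ratio.
  · obtain ⟨m1, m2, m3⟩ := main y x z u w v _ _ _ hxy.symm hyz hxz huw huv hvw.symm hu.symm hw hv
    obtain ⟨b1, b2, b3⟩ := m2 (inv_lt_one_of_one_lt₀ h)
    exact ⟨y, x, z, u, w, v, huw, huv, hvw.symm, hyz, m1, b1, b2, b3⟩

end Classification

/-! ### Trichotomy for aligned sets -/

section Coordinates

variable {W : Type*} [AddCommGroup W] [Module ℝ W]

/-- A dual basis of affine functions at the vertices of an aligned set. -/
structure IsCoord (X : Set W) (T : Finset W) (c : W → W →ᵃ[ℝ] ℝ) : Prop where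
  self : ∀ e ∈ T, c e e = 1
  ne : ∀ e ∈ T, ∀ e' ∈ T, e' ≠ e → c e e' = 0
  nonneg : ∀ x ∈ X, ∀ e ∈ T, 0 ≤ c e x
  sum_eq : ∀ x ∈ X, ∑ e ∈ T, c e x = 1
  sum_smul : ∀ x ∈ X, ∑ e ∈ T, c e x • e = x

variable {X : Set W} {T : Finset W} {c : W → W →ᵃ[ℝ] ℝ}

lemma IsAligned.exists_isCoord (h : IsAligned X T) : ∃ c, IsCoord X T c := by
  have : ∀ e : W, ∃ c : W →ᵃ[ℝ] ℝ, e ∈ T → c e = 1 ∧ ∀ e' ∈ T, e' ≠ e → c e' = 0 := by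
    intro e
    by_cases he : e ∈ T
    · obtain ⟨f, hfe, hf⟩ := h.dual e he
      exact ⟨(f e)⁻¹ • f, fun _ => ⟨by simp [hfe.ne'], fun e' he' hne => by simp [hf e' he' hne]⟩⟩
    · exact ⟨0, fun h => absurd h he⟩
  choose c hc using this
  have key := fun x hx => sum_coord_smul_eq (X := X) (T := T) (c := c) (fun e he => (hc e he).1)
    (fun e he => (hc e he).2) h.pos (x := x) hx
  exact ⟨c, fun e he => (hc e he).1, fun e he => (hc e he).2, fun x hx => (key x hx).1,
    fun x hx => (key x hx).2.1, fun x hx => (key x hx).2.2⟩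

lemma IsCoord.exists_pos (hc : IsCoord X T c) {x : W} (hx : x ∈ X) (hxT : x ∉ T) (u : W) :
    ∃ e ∈ T, e ≠ u ∧ 0 < c e x := by
  by_contra! hcon
  have h0 : ∀ e ∈ T, e ≠ u → c e x = 0 := fun e he hne =>
    le_antisymm (hcon e he hne) (hc.nonneg x hx e he)
  have h1 := hc.sum_eq x hx
  have h2 := hc.sum_smul x hx
  by_cases hu : u ∈ T
  · rw [Finset.sum_eq_single u h0 (fun h => absurd hu h)] at h1
    rw [Finset.sum_eq_single u (fun e he hne => by rw [h0 e he hne, zero_smul])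
      (fun h => absurd hu h), h1, one_smul] at h2
    exact hxT (h2 ▸ hu)
  · rw [Finset.sum_eq_zero fun e he => h0 e he fun h => hu (h ▸ he)] at h1
    exact zero_ne_one h1

lemma IsCoord.ext (hc : IsCoord X T c) {x y : W} (hx : x ∈ X) (hy : y ∈ X)
    (h : ∀ e ∈ T, c e x = c e y) : x = y := by
  rw [← hc.sum_smul x hx, ← hc.sum_smul y hy]
  exact Finset.sum_congr rfl fun e he => by rw [h e he]

/-- Since `u` is on the line of `x` and `y`, all two-by-two minors of the coordinates of `x` and `y`
off `u` vanish. These coordinates are therefore proportional. -/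
lemma IsAligned.exists_ratio (h : IsAligned X T) (hc : IsCoord X T c) {x y : W} (hx : x ∈ X)
    (hxT : x ∉ T) (hy : y ∈ X) (hyT : y ∉ T) (hxy : x ≠ y) :
    ∃ u ∈ T, ∃ s : ℝ, 0 < s ∧ ∀ e ∈ T, e ≠ u → c e y = s * c e x := by
  obtain ⟨u, hu, hf⟩ := h.line x hx hxT y hy hyT hxy
  have hu' : u ∈ T := hu
  have det : ∀ e₁ ∈ T, e₁ ≠ u → ∀ e₂ ∈ T, e₂ ≠ u → c e₁ x * c e₂ y = c e₁ y * c e₂ x := by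
    intro e₁ he₁ hne₁ e₂ he₂ hne₂
    by_contra hD
    have hD' : c e₁ x * c e₂ y - c e₁ y * c e₂ x ≠ 0 := sub_ne_zero.2 hD
    -- This is a three-by-three determinant in the coordinates `u, e₁, e₂`, with rows for the
    -- variable point, `x` and `y`. It vanishes at `x` and `y`, and its value at `u` is the minor.
    have := hf ((c e₁ x * c e₂ y - c e₁ y * c e₂ x) • c u
      - (c u x * c e₂ y - c u y * c e₂ x) • c e₁ - (c e₁ x * c u y - c e₁ y * c u x) • c e₂)
      (by simp only [AffineMap.coe_sub, Pi.sub_apply, AffineMap.coe_smul, Pi.smul_apply, smul_eq_mul]; ring)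
      (by simp only [AffineMap.coe_sub, Pi.sub_apply, AffineMap.coe_smul, Pi.smul_apply, smul_eq_mul]; ring)
    simp only [AffineMap.coe_sub, Pi.sub_apply, AffineMap.coe_smul, Pi.smul_apply, smul_eq_mul, hc.self u hu,
      hc.ne e₁ he₁ u hu hne₁.symm, hc.ne e₂ he₂ u hu hne₂.symm, mul_one, mul_zero, sub_zero] at this
    exact hD' this
  obtain ⟨e₁, he₁, hne₁, hp₁⟩ := hc.exists_pos hx hxT u
  obtain ⟨e₂, he₂, hne₂, hp₂⟩ := hc.exists_pos hy hyT u
  refine ⟨u, hu, c e₁ y / c e₁ x, div_pos (lt_of_le_of_ne (hc.nonneg y hy e₁ he₁) fun h0 => ?_) hp₁,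
    fun e he hne => ?_⟩
  · have := det e₁ he₁ hne₁ e₂ he₂ hne₂
    rw [← h0, zero_mul] at this
    exact (mul_pos hp₁ hp₂).ne' this
  · have := det e₁ he₁ hne₁ e he hne
    field_simp
    linarith

/-- `y` lies strictly between `x` and `u`. -/
def Btw (x u y : W) : Prop := ∃ τ : ℝ, 0 < τ ∧ τ < 1 ∧ y = (1 - τ) • x + τ • u

/-- The structure of an aligned set: either all points other than vertices lie on a segment from a
vertex to one of them, or there are three of them, each lying between another one and a vertex. -/
theorem IsAligned.cases (h : IsAligned X T) (hX : X.Finite) :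
    X ⊆ T ∨ (∃ u ∈ T, ∃ a ∈ X, a ∉ T ∧ ∀ x ∈ X, x ∉ T → x ≠ a → Btw a u x) ∨
    ∃ x ∈ X, ∃ y ∈ X, ∃ z ∈ X, ∃ u ∈ T, ∃ v ∈ T, ∃ w ∈ T, u ≠ v ∧ u ≠ w ∧ v ≠ w ∧ x ≠ z ∧
      x ∉ T ∧ y ∉ T ∧ z ∉ T ∧ (∀ p ∈ X, p ∉ T → p = x ∨ p = y ∨ p = z) ∧
      Btw x u y ∧ Btw y w z ∧ Btw z v x := by
  classical
  obtain ⟨c, hc⟩ := h.exists_isCoord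
  by_cases hXT : X ⊆ T
  · exact Or.inl hXT
  right
  obtain ⟨x₀, hx₀, hx₀T⟩ := Set.not_subset.1 hXT
  have hx₀T' : x₀ ∉ T := hx₀T
  let α := {x : W // x ∈ X ∧ x ∉ T}
  let d : α → T → ℝ := fun x e => c e x
  have hd : IsBarycentric d :=
    { nonneg := fun x e => hc.nonneg x x.2.1 e e.2
      sum_eq := fun x => by
        rw [← hc.sum_eq x x.2.1]
        exact Finset.sum_coe_sort T fun e => c e x
      inj := fun x y hxy => Subtype.ext (hc.ext x.2.1 y.2.1 fun e he => congrFun hxy ⟨e, he⟩)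
      not_vertex := fun x u => by
        obtain ⟨e, he, hne, hp⟩ := hc.exists_pos x.2.1 x.2.2 u
        exact ⟨⟨e, he⟩, fun h => hne (congrArg Subtype.val h), hp⟩ }
  have hbtw : ∀ (x y : α) (u : T), BetweenVertex d u x y → Btw (x : W) (u : W) (y : W) := by
    rintro x y u ⟨τ, h0, h1, hτ⟩
    refine ⟨τ, h0, h1, ?_⟩
    conv_lhs => rw [← hc.sum_smul y y.2.1]
    conv_rhs => rw [← hc.sum_smul x x.2.1]
    rw [Finset.smul_sum, ← Finset.sum_coe_sort T, ← Finset.sum_coe_sort T]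
    have : ∀ e : T, c e y • (e : W) =
        (1 - τ) • c e x • (e : W) + (if e = u then τ else 0) • (e : W) := fun e => by
      rw [smul_smul, ← add_smul]
      exact congrArg (· • (e : W)) (hτ e)
    rw [Finset.sum_congr rfl fun e _ => this e, Finset.sum_add_distrib]
    simp
  by_cases hall : ∃ u, ∀ x y : α, ∃ s, CollinearWithVertex d u x y s
  · left
    obtain ⟨u, hu⟩ := hall
    -- The point with least `u`-coordinate is the farthest from `u`, so all others lie between it
    -- and `u`.
    obtain ⟨a, ⟨ha, haT⟩, hmin⟩ := Set.exists_min_image {x ∈ X | x ∉ T} (fun x => c u x)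
      (hX.subset fun x hx => hx.1) ⟨x₀, hx₀, hx₀T⟩
    refine ⟨u, u.2, a, ha, haT, fun x hx hxT hxa => ?_⟩
    obtain ⟨s, hs⟩ := hu ⟨a, ha, haT⟩ ⟨x, hx, hxT⟩
    refine hbtw ⟨a, ha, haT⟩ ⟨x, hx, hxT⟩ u (hd.between hs ?_)
    have h1 : c u x = _ := hd.coord_vertex hs u
    have h2 := hmin x ⟨hx, hxT⟩
    rw [if_pos rfl] at h1
    change c u x = (1 - (1 - s)) * c u a + (1 - s) at h1
    have h3 : c u a < 1 := by
      obtain ⟨e, he, hne, hp⟩ := hc.exists_pos ha haT u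
      rw [← hc.sum_eq a ha]
      exact Finset.single_lt_sum hne u.2 he hp fun k hk _ => hc.nonneg a ha k hk
    by_contra hs1
    rcases (not_lt.1 hs1).eq_or_lt with rfl | h4
    · refine hxa (hc.ext hx ha fun e he => ?_)
      have : c e x = _ := hd.coord_vertex hs ⟨e, he⟩
      simpa [d] using this
    · nlinarith
  · right
    push Not at hall
    have hsp : IsSpread d :=
      { hd with
        line := fun x y => by
          by_cases hxy : x = y
          -- The argument `0` is arbitrary: all that is needed is some vertex.
          · obtain ⟨e, he, -⟩ := hc.exists_pos x.2.1 x.2.2 0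
            exact ⟨⟨e, he⟩, 1, one_pos, by simp [hxy]⟩
          · obtain ⟨u, hu, s, hs, hs'⟩ := h.exists_ratio hc x.2.1 x.2.2 y.2.1 y.2.2
              fun h' => hxy (Subtype.ext h')
            exact ⟨⟨u, hu⟩, s, hs, fun e he => hs' e e.2 fun h' => he (Subtype.ext h')⟩
        not_all := hall }
    have : Nonempty T := by
      obtain ⟨e, he, -⟩ := hc.exists_pos hx₀ hx₀T 0
      exact ⟨e, he⟩
    obtain ⟨x, y, z, u, v, w, huv, huw, hvw, hxz, hp, h1, h2, h3⟩ := hsp.eq_triangle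
    refine ⟨x, x.2.1, y, y.2.1, z, z.2.1, u, u.2, v, v.2, w, w.2, Subtype.coe_injective.ne huv,
      Subtype.coe_injective.ne huw, Subtype.coe_injective.ne hvw, Subtype.coe_injective.ne hxz,
      x.2.2, y.2.2, z.2.2, fun p hp' hpT => ?_, hbtw _ _ _ h1, hbtw _ _ _ h2, hbtw _ _ _ h3⟩
    rcases hp ⟨p, hp', hpT⟩ with h | h | h
    · exact Or.inl (congrArg Subtype.val h)
    · exact Or.inr (Or.inl (congrArg Subtype.val h))
    · exact Or.inr (Or.inr (congrArg Subtype.val h))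

end Coordinates

/-! ### Extending order-preserving maps to strictly increasing functions -/

section Extension

/-- Add the points from left to right, continuing linearly beyond the previous maximum. -/
lemma exists_strictMono_eqOn (s : Finset ℝ) : ∀ γ : ℝ → ℝ, StrictMonoOn γ s →
    ∃ φ : ℝ → ℝ, StrictMono φ ∧ Set.EqOn φ γ s := by
  classical
  induction s using Finset.induction_on_max with
  | empty => exact fun γ _ => ⟨id, strictMono_id, by simp⟩
  | insert a s ha ih =>
    intro γ hγ
    rcases s.eq_empty_or_nonempty with rfl | hs
    · refine ⟨fun t => t + (γ a - a), fun x y h => by simpa using h, fun x hx => ?_⟩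
      simp only [insert_empty_eq, Finset.coe_singleton, Set.mem_singleton_iff] at hx
      simp [hx]
    obtain ⟨φ, hφ, hφs⟩ := ih γ (hγ.mono (by simp))
    set m := s.max' hs
    have hm : m ∈ s := s.max'_mem hs
    have hma : m < a := ha m hm
    have hγm : γ m < γ a := hγ (by simp [hm]) (by simp) hma
    have hφm : φ m = γ m := hφs hm
    have hk : 0 < (γ a - γ m) / (a - m) := div_pos (sub_pos.2 hγm) (sub_pos.2 hma)
    refine ⟨fun t => if t ≤ m then φ t else γ m + (t - m) * ((γ a - γ m) / (a - m)), ?_, ?_⟩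
    · intro t t' htt
      dsimp only
      split_ifs with h1 h2 h2
      · exact hφ htt
      · have := hφ.monotone h1
        have := mul_pos (sub_pos.2 (not_le.1 h2)) hk
        linarith
      · exact absurd (htt.le.trans h2) h1
      · have := mul_lt_mul_of_pos_right (sub_lt_sub_right htt m) hk
        linarith
    · intro t ht
      dsimp only
      simp only [Finset.coe_insert, Set.mem_insert_iff, Finset.mem_coe] at ht
      rcases ht with rfl | ht
      · rw [if_neg (not_le.2 hma)]
        have : t - m ≠ 0 := (sub_pos.2 hma).ne'
        field_simp
        ring
      · rw [if_pos (s.le_max' t ht)]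
        exact hφs ht

/-- As `γ` is constant on levels of `β`, it factors through `β` on `K`; the factor is strictly
increasing on finitely many values and extends. -/
lemma exists_strictMono_comp_eq {W : Type*} {K : Set W} (hK : K.Finite) {β γ : W → ℝ}
    (h : ∀ x ∈ K, ∀ y ∈ K, (β x < β y → γ x < γ y) ∧ (β x = β y → γ x = γ y)) :
    ∃ φ : ℝ → ℝ, StrictMono φ ∧ ∀ x ∈ K, φ (β x) = γ x := by
  classical
  let p : ℝ → ℝ := fun t => if ht : ∃ x ∈ K, β x = t then γ ht.choose else 0
  have hp : ∀ x ∈ K, p (β x) = γ x := by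
    intro x hx
    have hex : ∃ y ∈ K, β y = β x := ⟨x, hx, rfl⟩
    simp only [p, dif_pos hex]
    exact (h _ hex.choose_spec.1 _ hx).2 hex.choose_spec.2
  obtain ⟨φ, hφ, hφp⟩ := exists_strictMono_eqOn (hK.image β).toFinset p (by
    intro t ht t' ht' htt
    simp only [Set.Finite.coe_toFinset] at ht ht'
    obtain ⟨x, hx, rfl⟩ := ht
    obtain ⟨y, hy, rfl⟩ := ht'
    rw [hp x hx, hp y hy]
    exact (h x hx y hy).1 htt)
  refine ⟨φ, hφ, fun x hx => ?_⟩
  rw [hφp (by simpa using ⟨x, hx, rfl⟩), hp x hx]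

lemma exists_strictMono_three {β₁ β₂ β₃ γ₁ γ₂ γ₃ : ℝ} (hβ₁ : β₁ ≤ β₂) (hβ₂ : β₂ ≤ β₃)
    (h₁ : β₁ < β₂ → γ₁ < γ₂) (h₁' : β₁ = β₂ → γ₁ = γ₂) (h₂ : β₂ < β₃ → γ₂ < γ₃)
    (h₂' : β₂ = β₃ → γ₂ = γ₃) :
    ∃ φ : ℝ → ℝ, StrictMono φ ∧ φ β₁ = γ₁ ∧ φ β₂ = γ₂ ∧ φ β₃ = γ₃ := by
  obtain ⟨φ, hφ, hφK⟩ := exists_strictMono_comp_eq (K := (Set.univ : Set (Fin 3)))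
    (β := ![β₁, β₂, β₃]) (γ := ![γ₁, γ₂, γ₃]) Set.finite_univ (by
      have k1 : γ₁ ≤ γ₂ := by
        rcases hβ₁.lt_or_eq with h | h
        · exact (h₁ h).le
        · exact (h₁' h).le
      have k2 : γ₂ ≤ γ₃ := by
        rcases hβ₂.lt_or_eq with h | h
        · exact (h₂ h).le
        · exact (h₂' h).le
      have k3 : β₁ < β₃ → γ₁ < γ₃ := fun h => by
        rcases hβ₁.lt_or_eq with h' | h'
        · exact (h₁ h').trans_le k2
        · exact k1.trans_lt (h₂ (h' ▸ h))
      have k4 : β₁ = β₃ → γ₁ = γ₃ := fun h =>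
        (h₁' (le_antisymm hβ₁ (h ▸ hβ₂))).trans (h₂' (le_antisymm hβ₂ (h ▸ hβ₁)))
      rintro i - j -
      fin_cases i <;> fin_cases j <;> simp
      · exact ⟨h₁, h₁'⟩
      · exact ⟨k3, k4⟩
      · exact ⟨fun h => absurd h (not_lt.2 hβ₁), fun h => (h₁' h.symm).symm⟩
      · exact ⟨h₂, h₂'⟩
      · exact ⟨fun h => absurd h (not_lt.2 (hβ₁.trans hβ₂)), fun h => (k4 h.symm).symm⟩
      · exact ⟨fun h => absurd h (not_lt.2 hβ₂), fun h => (h₂' h.symm).symm⟩)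
  exact ⟨φ, hφ, hφK 0 trivial, hφK 1 trivial, hφK 2 trivial⟩

lemma StrictMono.glue {φ ψ : ℝ → ℝ} (hφ : StrictMono φ) (hψ : StrictMono ψ) {t₀ : ℝ}
    (h0 : φ t₀ = 0) (h0' : ψ t₀ = 0) : StrictMono fun t => if t₀ ≤ t then φ t else ψ t := by
  intro t t' htt
  dsimp only
  split_ifs with h1 h2 h2
  · exact hφ htt
  · exact absurd (h1.trans htt.le) h2
  · have := hφ.monotone h2
    have := hψ (not_le.1 h1)
    linarith
  · exact hψ htt

end Extension

/-! ### Every string order of an aligned set is induced by a functional -/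

section Coherence

variable {W : Type*} [AddCommGroup W] [Module ℝ W] {X : Set W} {b : W → ℝ}

lemma IsStringOrder.neg (hb : IsStringOrder X b) : IsStringOrder X (-b) := by
  intro x₀ hx₀
  obtain ⟨f, hf⟩ := hb x₀ hx₀
  refine ⟨-f, fun x hx => ?_⟩
  rw [LinearMap.neg_apply, Left.sign_neg, hf x hx, ← Left.sign_neg]
  congr 1
  simp only [Pi.neg_apply]
  ring

lemma InducesOrder.neg {g : Dual ℝ W} (h : InducesOrder X (-b) g) : InducesOrder X b (-g) := by
  intro x hx y hy
  have h1 := h y hy x hx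
  simp only [Pi.neg_apply, neg_lt_neg_iff, neg_inj] at h1
  simp only [LinearMap.neg_apply, neg_lt_neg_iff, neg_inj]
  exact ⟨h1.1, fun h => (h1.2 h.symm).symm⟩

lemma IsStringOrder.exists_apply (hb : IsStringOrder X b) {x₀ : W} (hx₀ : x₀ ∈ X) :
    ∃ f : Dual ℝ W, f x₀ = 0 ∧ ∀ x ∈ X, (0 < f x ↔ b x₀ < b x) ∧ (f x < 0 ↔ b x < b x₀) ∧
      (f x = 0 ↔ b x = b x₀) := by
  obtain ⟨f, hf⟩ := hb x₀ hx₀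
  have key : ∀ x ∈ X, (0 < f x ↔ b x₀ < b x) ∧ (f x < 0 ↔ b x < b x₀) ∧
      (f x = 0 ↔ b x = b x₀) := by
    intro x hx
    have h := hf x hx
    rw [← sign_eq_one_iff, ← sign_eq_neg_one_iff, ← sign_eq_zero_iff, h, sign_eq_one_iff,
      sign_eq_neg_one_iff, sign_eq_zero_iff, sub_pos, sub_neg, sub_eq_zero]
    exact ⟨Iff.rfl, Iff.rfl, Iff.rfl⟩
  exact ⟨f, (key x₀ hx₀).2.2.2 rfl, key⟩

/-- The functional cutting out the level of `y` vanishes at `y`, so its values at `x` and `u` have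
opposite signs or are both zero. -/
lemma IsStringOrder.btw (hb : IsStringOrder X b) {x u y : W} (hx : x ∈ X) (hu : u ∈ X) (hy : y ∈ X)
    (h : Btw x u y) : (b x < b y ∧ b y < b u) ∨ (b u < b y ∧ b y < b x) ∨
      (b x = b y ∧ b u = b y) := by
  obtain ⟨τ, h0, h1, rfl⟩ := h
  obtain ⟨f, hf0, hf⟩ := hb.exists_apply hy
  simp only [map_add, map_smul, smul_eq_mul] at hf0
  have h1' : 0 < 1 - τ := by linarith
  rcases lt_trichotomy (f x) 0 with h | h | h
  · left
    refine ⟨(hf x hx).2.1.1 h, (hf u hu).1.1 ?_⟩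
    have := mul_neg_of_pos_of_neg h1' h
    exact pos_of_mul_pos_right (by linarith : 0 < τ * f u) h0.le
  · right; right
    refine ⟨(hf x hx).2.2.1 h, (hf u hu).2.2.1 ?_⟩
    rw [h, mul_zero, zero_add] at hf0
    exact (mul_eq_zero.1 hf0).resolve_left h0.ne'
  · right; left
    refine ⟨(hf u hu).2.1.1 ?_, (hf x hx).1.1 h⟩
    have := mul_pos h1' h
    by_contra hcon
    have := mul_nonneg h0.le (not_lt.1 hcon)
    linarith

/-- A functional that equals a strictly increasing function of `b` induces the order of `b`. -/
lemma InducesOrder.of_strictMono {φ : ℝ → ℝ} (hφ : StrictMono φ) {g : Dual ℝ W}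
    (h : ∀ x ∈ X, g x = φ (b x)) : InducesOrder X b g := fun x hx y hy =>
  ⟨fun hxy => by rw [h x hx, h y hy]; exact hφ hxy, fun hxy => by rw [h x hx, h y hy, hxy]⟩

lemma IsCoord.exists_dual {T : Finset W} {c : W → W →ᵃ[ℝ] ℝ} (hc : IsCoord X T c) (hTX : ↑T ⊆ X)
    {π : Dual ℝ W} (hπ : ∀ x ∈ X, π x = 1) (γ : W → ℝ) : ∃ g : Dual ℝ W, ∀ e ∈ T, g e = γ e := by
  choose d hd using fun e => exists_dual_eq_affineMap (π := π) (c e)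
  refine ⟨∑ e ∈ T, γ e • d e, fun e he => ?_⟩
  simp only [LinearMap.sum_apply, LinearMap.smul_apply, smul_eq_mul]
  rw [Finset.sum_eq_single e, ← hd e e (hπ e (hTX he)), hc.self e he, mul_one]
  · intro e' he' hne
    rw [← hd e' e (hπ e (hTX he)), hc.ne e' he' e he hne.symm, mul_zero]
  · exact fun h => absurd he h

/-- A strictly increasing function vanishing at `t₀` can be rescaled on both sides of `t₀` so that
a given weighted sum vanishes, provided that some weighted sum with the same signs does. -/
lemma exists_rescale {ι : Type*} {T : Finset ι} {w β f : ι → ℝ} {t₀ : ℝ} (hw : ∀ e ∈ T, 0 ≤ w e)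
    (hf : ∀ e ∈ T, (0 < f e ↔ t₀ < β e) ∧ (f e < 0 ↔ β e < t₀) ∧ (f e = 0 ↔ β e = t₀))
    (hsum : ∑ e ∈ T, w e * f e = 0) {φ : ℝ → ℝ} (hφ : StrictMono φ) (h0 : φ t₀ = 0) :
    ∃ κ₁ κ₂ : ℝ, 0 < κ₁ ∧ 0 < κ₂ ∧
      ∑ e ∈ T, w e * ((if t₀ ≤ β e then κ₁ else κ₂) * φ (β e)) = 0 := by
  classical
  set P := ∑ e ∈ T with t₀ ≤ β e, w e * φ (β e) with hP
  set N := ∑ e ∈ T with ¬ t₀ ≤ β e, w e * φ (β e) with hN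
  have hsplit : ∀ κ₁ κ₂ : ℝ, ∑ e ∈ T, w e * ((if t₀ ≤ β e then κ₁ else κ₂) * φ (β e)) =
      κ₁ * P + κ₂ * N := fun κ₁ κ₂ => by
    rw [← Finset.sum_filter_add_sum_filter_not T (fun e => t₀ ≤ β e), hP, hN, Finset.mul_sum,
      Finset.mul_sum]
    congr 1
    · refine Finset.sum_congr rfl fun e he => ?_
      rw [if_pos (Finset.mem_filter.1 he).2]; ring
    · refine Finset.sum_congr rfl fun e he => ?_
      rw [if_neg (Finset.mem_filter.1 he).2]; ring
  have hPn : ∀ e ∈ T.filter (fun e => t₀ ≤ β e), 0 ≤ w e * φ (β e) := fun e he =>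
    mul_nonneg (hw e (Finset.mem_filter.1 he).1)
      (h0 ▸ hφ.monotone (Finset.mem_filter.1 he).2)
  have hNn : ∀ e ∈ T.filter (fun e => ¬ t₀ ≤ β e), w e * φ (β e) ≤ 0 := fun e he =>
    mul_nonpos_of_nonneg_of_nonpos (hw e (Finset.mem_filter.1 he).1)
      (h0 ▸ (hφ (not_le.1 (Finset.mem_filter.1 he).2)).le)
  have hP0 : 0 ≤ P := Finset.sum_nonneg hPn
  have hN0 : N ≤ 0 := Finset.sum_nonpos hNn
  rcases hP0.eq_or_lt with h | h
  · refine ⟨1, 1, one_pos, one_pos, ?_⟩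
    have hz := (Finset.sum_eq_zero_iff_of_nonneg hPn).1 h.symm
    have hle : ∀ e ∈ T, w e * f e ≤ 0 := fun e he => by
      by_contra hcon
      push Not at hcon
      have hwe : 0 < w e := lt_of_le_of_ne (hw e he) fun h => by simp [← h] at hcon
      have hfe : 0 < f e := (pos_iff_pos_of_mul_pos hcon).1 hwe
      have hlt := (hf e he).1.1 hfe
      have := hz e (Finset.mem_filter.2 ⟨he, hlt.le⟩)
      exact (mul_pos hwe (h0 ▸ hφ hlt : 0 < φ (β e))).ne' this
    have hz' := (Finset.sum_eq_zero_iff_of_nonpos hle).1 hsum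
    refine Finset.sum_eq_zero fun e he => ?_
    rcases mul_eq_zero.1 (hz' e he) with h | h
    · rw [h, zero_mul]
    · rw [(hf e he).2.2.1 h, h0]; simp
  · rcases hN0.eq_or_lt with h' | h'
    · exfalso
      have hz := (Finset.sum_eq_zero_iff_of_nonpos hNn).1 h'
      have hle : ∀ e ∈ T, 0 ≤ w e * f e := fun e he => by
        by_contra hcon
        push Not at hcon
        have hwe : 0 < w e := lt_of_le_of_ne (hw e he) fun h => by simp [← h] at hcon
        have hfe : f e < 0 := by
          by_contra h''
          linarith [mul_nonneg hwe.le (not_lt.1 h'')]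
        have hlt := (hf e he).2.1.1 hfe
        have := hz e (Finset.mem_filter.2 ⟨he, not_le.2 hlt⟩)
        exact (mul_neg_of_pos_of_neg hwe (h0 ▸ hφ hlt : φ (β e) < 0)).ne this
      have hz' := (Finset.sum_eq_zero_iff_of_nonneg hle).1 hsum
      refine h.ne' (Finset.sum_eq_zero fun e he => ?_)
      have he' := (Finset.mem_filter.1 he).1
      rcases mul_eq_zero.1 (hz' e he') with h | h
      · rw [h, zero_mul]
      · rw [(hf e he').2.2.1 h, h0]; simp
    · refine ⟨-N, P, by linarith, h, ?_⟩
      rw [hsplit]; ring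

/-- Let `f` cut out the level of `a`. On the line from `a` to `u`, `f` is ordered like `b`, so it
equals `φ ∘ b` there with `φ` strictly increasing and zero at the level of `a`. Give each vertex `e`
the value `φ (b e)`, rescaled by one constant above that level and another below it so that the
functional vanishes at `a`. On the line this is a multiple of `f`, so it still follows the rescaled
function of `b`. -/
theorem exists_inducesOrder_of_line {T : Finset W} {c : W → W →ᵃ[ℝ] ℝ} (hc : IsCoord X T c)
    (hX : X.Finite) (hTX : ↑T ⊆ X) {π : Dual ℝ W} (hπ : ∀ x ∈ X, π x = 1)
    (hb : IsStringOrder X b) {u a : W} (hu : u ∈ T) (ha : a ∈ X)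
    (hline : ∀ x ∈ X, x ∉ T → x ≠ a → Btw a u x) : ∃ g, InducesOrder X b g := by
  obtain ⟨f, hfa, hf⟩ := hb.exists_apply ha
  have hval : ∀ g : Dual ℝ W, g a = ∑ e ∈ T, c e a * g e := fun g => by
    conv_lhs => rw [← hc.sum_smul a ha]
    simp
  set K := {x ∈ X | x ∉ T ∨ x = u ∨ x = a} with hK
  have hpos : ∀ x ∈ K, ∃ τ : ℝ, 0 ≤ τ ∧ τ ≤ 1 ∧ x = (1 - τ) • a + τ • u := by
    rintro x ⟨hx, h⟩
    by_cases hxa : x = a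
    · exact ⟨0, le_rfl, zero_le_one, by simp [hxa]⟩
    by_cases hxu : x = u
    · exact ⟨1, zero_le_one, le_rfl, by simp [hxu]⟩
    obtain ⟨τ, h0, h1, h⟩ := hline x hx (by simpa [hxa, hxu] using h) hxa
    exact ⟨τ, h0.le, h1.le, h⟩
  choose! τ hτ0 hτ1 hτ using hpos
  have hKf : ∀ x ∈ K, f x = τ x * f u := fun x hx => by
    conv_lhs => rw [hτ x hx]
    simp [hfa]
  -- The functional `h` at the level of `x` is affine in the position `τ`; its slope `h u - h a` has
  -- the sign of `b u - b a`, as does `f u`.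
  have hcons : ∀ x ∈ K, ∀ y ∈ K, (b x < b y → f x < f y) ∧ (b x = b y → f x = f y) := by
    intro x hx y hy
    obtain ⟨h, h0, hh⟩ := hb.exists_apply hx.1
    have e1 : (1 - τ x) * h a + τ x * h u = 0 := by
      rw [hτ x hx] at h0; simpa using h0
    have e2 : h y = (1 - τ y) * h a + τ y * h u := by
      conv_lhs => rw [hτ y hy]
      simp
    have e3 : h y = (τ y - τ x) * (h u - h a) := by linear_combination e2 + e1
    have hτx := hτ0 x hx
    have hτx' := hτ1 x hx
    have huX := hTX hu
    have hle : h u ≤ h a → h u ≤ 0 ∧ 0 ≤ h a := fun h' => by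
      constructor <;> nlinarith
    have hle' : h a ≤ h u → h a ≤ 0 ∧ 0 ≤ h u := fun h' => by
      constructor <;> nlinarith
    rw [hKf x hx, hKf y hy]
    rcases lt_trichotomy (b a) (b u) with hab | hab | hab
    · have hfu := (hf u huX).1.2 hab
      have hlt : h a < h u := by
        by_contra hcon
        obtain ⟨k1, k2⟩ := hle (not_lt.1 hcon)
        have m1 := mt (hh u huX).1.2 (not_lt.2 k1)
        have m2 := mt (hh a ha).2.1.2 (not_lt.2 k2)
        linarith
      refine ⟨fun hxy => ?_, fun hxy => ?_⟩
      · have := (hh y hy.1).1.2 hxy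
        rw [e3] at this
        have := pos_of_mul_pos_left this (sub_pos.2 hlt).le
        nlinarith
      · have := (hh y hy.1).2.2.2 hxy.symm
        rw [e3] at this
        rcases mul_eq_zero.1 this with h' | h'
        · rw [sub_eq_zero.1 h']
        · linarith
    · have hfu := (hf u huX).2.2.2 hab.symm
      have heq : h u = h a := by
        rcases lt_trichotomy (h u) (h a) with h' | h' | h'
        · obtain ⟨k1, k2⟩ := hle h'.le
          rcases k1.lt_or_eq with k | k
          · have := (hh a ha).2.1.2 (hab ▸ (hh u huX).2.1.1 k)
            linarith
          · have := (hh a ha).2.2.2 (hab ▸ (hh u huX).2.2.1 k)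
            linarith
        · exact h'
        · obtain ⟨k1, k2⟩ := hle' h'.le
          rcases k1.lt_or_eq with k | k
          · have := (hh u huX).2.1.2 (hab ▸ (hh a ha).2.1.1 k)
            linarith
          · have := (hh u huX).2.2.2 (hab ▸ (hh a ha).2.2.1 k)
            linarith
      refine ⟨fun hxy => ?_, fun _ => by rw [hfu, mul_zero, mul_zero]⟩
      have := (hh y hy.1).1.2 hxy
      rw [e3, heq, sub_self, mul_zero] at this
      exact absurd this (lt_irrefl _)
    · have hfu := (hf u huX).2.1.2 hab
      have hlt : h u < h a := by
        by_contra hcon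
        obtain ⟨k1, k2⟩ := hle' (not_lt.1 hcon)
        have m1 := mt (hh a ha).1.2 (not_lt.2 k1)
        have m2 := mt (hh u huX).2.1.2 (not_lt.2 k2)
        linarith
      refine ⟨fun hxy => ?_, fun hxy => ?_⟩
      · have := (hh y hy.1).1.2 hxy
        rw [e3] at this
        have : τ y < τ x := by
          by_contra hcon
          linarith [mul_nonpos_of_nonneg_of_nonpos (sub_nonneg.2 (not_lt.1 hcon))
            (sub_neg.2 hlt).le]
        nlinarith
      · have := (hh y hy.1).2.2.2 hxy.symm
        rw [e3] at this
        rcases mul_eq_zero.1 this with h' | h'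
        · rw [sub_eq_zero.1 h']
        · linarith
  obtain ⟨φ, hφ, hφK⟩ := exists_strictMono_comp_eq (hX.subset fun x hx => hx.1) hcons
  have hφ0 : φ (b a) = 0 := by rw [hφK a ⟨ha, Or.inr (Or.inr rfl)⟩, hfa]
  obtain ⟨κ₁, κ₂, h1, h2, hsum⟩ := exists_rescale (β := b) (f := f) (fun e he => hc.nonneg a ha e he)
    (fun e he => hf e (hTX he)) (by rw [← hval, hfa]) hφ hφ0
  obtain ⟨g, hg⟩ := hc.exists_dual hTX hπ
    fun e => (if b a ≤ b e then κ₁ else κ₂) * φ (b e)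
  have hga : g a = 0 := by
    rw [hval, ← hsum]
    exact Finset.sum_congr rfl fun e he => by rw [hg e he]
  have hmono := StrictMono.glue (φ := fun t => κ₁ * φ t) (ψ := fun t => κ₂ * φ t) (t₀ := b a)
    (hφ.const_mul h1) (hφ.const_mul h2) (by simp [hφ0]) (by simp [hφ0])
  refine ⟨g, InducesOrder.of_strictMono hmono fun x hx => ?_⟩
  by_cases hxT : x ∈ T
  · rw [hg x hxT]; split_ifs <;> rfl
  have hxK : x ∈ K := ⟨hx, Or.inl hxT⟩
  have hgx : g x = τ x * g u := by
    conv_lhs => rw [hτ x hxK]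
    simp [hga]
  have huX := hTX hu
  have huK : u ∈ K := ⟨huX, Or.inr (Or.inl rfl)⟩
  have hfx := hKf x hxK
  have key : φ (b x) = τ x * φ (b u) := by rw [hφK x hxK, hφK u huK, hfx]
  rw [hgx, hg u hu]
  have hτx := hτ0 x hxK
  by_cases hab : b a ≤ b u
  · have h3 : b a ≤ b x := hφ.le_iff_le.1 (by
      rw [hφ0, key]; exact mul_nonneg hτx (hφ0 ▸ hφ.monotone hab))
    rw [if_pos hab, if_pos h3, key]; ring
  · rw [if_neg hab]
    by_cases h3 : b a ≤ b x
    · have h4 := hφ.monotone h3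
      rw [hφ0] at h4
      have h5 := hφ (not_le.1 hab)
      rw [hφ0] at h5
      -- With `u` below the level of `a`, a point of the segment not below that level can only be
      -- `a` itself.
      have h6 : τ x = 0 := le_antisymm (by nlinarith) hτx
      rw [if_pos h3, key, h6]; ring
    · rw [if_neg h3, key]; ring

/-- Aim for value zero at the middle point `y`. Then `u`, `z` and `w` are not below the level of
`y`, while `x` and `v` are not above it, so the values on the two sides can be chosen by separate
increasing functions. The function `φ` copies the level functional of `y` at `z` and `w`, which
respects `z` between `y` and `w`; `ψ` is built to fit the other two betweenness relations. -/
theorem exists_inducesOrder_of_triangle {T : Finset W} {c : W → W →ᵃ[ℝ] ℝ} (hc : IsCoord X T c)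
    (hTX : ↑T ⊆ X) {π : Dual ℝ W} (hπ : ∀ x ∈ X, π x = 1)
    (hb : IsStringOrder X b) {x y z u v w : W} (hx : x ∈ X) (hy : y ∈ X) (hz : z ∈ X)
    (hu : u ∈ T) (hv : v ∈ T) (hw : w ∈ T) (hp : ∀ p ∈ X, p ∉ T → p = x ∨ p = y ∨ p = z)
    (hyu : Btw x u y) (hzw : Btw y w z) (hxv : Btw z v x) (hxy : b x ≤ b y) (hyz : b y ≤ b z) :
    ∃ g, InducesOrder X b g := by
  have huX := hTX hu
  have hvX := hTX hv
  have hwX := hTX hw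
  have o1 := hb.btw hx huX hy hyu
  have o2 := hb.btw hy hwX hz hzw
  have o3 := hb.btw hz hvX hx hxv
  obtain ⟨τ₁, p1, q1, e1⟩ := hyu
  obtain ⟨τ₂, p2, q2, e2⟩ := hzw
  obtain ⟨τ₃, p3, q3, e3⟩ := hxv
  obtain ⟨f, hfy, hf⟩ := hb.exists_apply hy
  have hfz : f z = τ₂ * f w := by rw [e2]; simp [hfy]
  have hyw : b y ≤ b w := by rcases o2 with o | o | o <;> linarith
  have hzw : b z ≤ b w := by rcases o2 with o | o | o <;> linarith
  have hyu : b y ≤ b u := by rcases o1 with o | o | o <;> linarith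
  have hvx : b v ≤ b x := by rcases o3 with o | o | o <;> linarith
  have hfw : 0 ≤ f w := not_lt.1 fun h => by linarith [(hf w hwX).2.1.1 h]
  obtain ⟨φ, hφ, hφy, hφz', hφw⟩ := exists_strictMono_three (γ₁ := 0) (γ₂ := f z) (γ₃ := f w) hyz hzw
    (hf z hz).1.2 (fun h => ((hf z hz).2.2.2 h.symm).symm)
    (fun h => by
      have h' : b y < b w := by linarith
      have := (hf w hwX).1.2 h'
      rw [hfz]; exact mul_lt_of_lt_one_left this q2)
    (fun h => by
      have h' : b w = b y := by rcases o2 with o | o | o <;> linarith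
      rw [hfz, (hf w hwX).2.2.2 h', mul_zero])
  have hφz : φ (b z) = τ₂ * φ (b w) := by rw [hφz', hφw, hfz]
  set U := φ (b u) with hU
  set V := φ (b w) with hV
  have hτ1 : 0 < 1 - τ₁ := by linarith
  -- The value forced at `x` by value zero at `y` and `U` at `u`.
  obtain ⟨γx, hγx⟩ : ∃ γx : ℝ, (1 - τ₁) * γx + τ₁ * U = 0 :=
    ⟨-(τ₁ * U) / (1 - τ₁), by field_simp; ring⟩
  -- The value forced at `v`, since `x` lies between `z`, where the value should be `τ₂ * V`, and
  -- `v`.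
  obtain ⟨γv, hγv⟩ : ∃ γv : ℝ, τ₃ * γv = γx - (1 - τ₃) * (τ₂ * V) :=
    ⟨(γx - (1 - τ₃) * (τ₂ * V)) / τ₃, by field_simp⟩
  have hV0 : 0 ≤ V := by rw [hV, ← hφy]; exact hφ.monotone hyw
  have hU0 : 0 ≤ U := by rw [hU, ← hφy]; exact hφ.monotone hyu
  obtain ⟨ψ, hψ, hψy, hψx, hψv⟩ : ∃ ψ : ℝ → ℝ, StrictMono ψ ∧ ψ (b y) = 0 ∧ ψ (b x) = γx ∧
      ψ (b v) = γv := by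
    have hmul : 0 ≤ (1 - τ₃) * (τ₂ * V) := mul_nonneg (by linarith) (mul_nonneg p2.le hV0)
    have hx0 : b x = b y → γx = 0 := fun h => by
      have : b u = b y := by rcases o1 with o | o | o <;> linarith
      rw [hU, this, hφy, mul_zero, add_zero] at hγx
      exact (mul_eq_zero.1 hγx).resolve_left hτ1.ne'
    have hx1 : b x < b y → γx < 0 := fun h => by
      have : b y < b u := by rcases o1 with o | o | o <;> linarith
      have hU1 : 0 < U := by rw [hU, ← hφy]; exact hφ this
      nlinarith [mul_pos p1 hU1]
    have hv0 : b v = b x → γv = γx := fun h => by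
      have e1 : b x = b y := by rcases o3 with o | o | o <;> linarith
      have e2 : b w = b y := by rcases o3 with o | o | o <;> rcases o2 with o | o | o <;> linarith
      rw [hV, e2, hφy, hx0 e1] at hγv
      rw [hx0 e1]
      simpa [p3.ne'] using hγv
    have hv1 : b v < b x → γv < γx := fun h => by
      have hxz : b x < b z := by rcases o3 with o | o | o <;> linarith
      have : γx < 0 ∨ 0 < (1 - τ₃) * (τ₂ * V) := by
        rcases hxy.lt_or_eq with h' | h'
        · exact Or.inl (hx1 h')
        · right
          have : b y < b w := by rcases o2 with o | o | o <;> linarith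
          have hV1 : 0 < V := by rw [hV, ← hφy]; exact hφ this
          exact mul_pos (by linarith) (mul_pos p2 hV1)
      have hx2 : γx ≤ 0 := by
        rcases hxy.lt_or_eq with h' | h'
        · exact (hx1 h').le
        · exact (hx0 h').le
      rcases this with h' | h' <;> nlinarith
    obtain ⟨ψ, hψ, h1, h2, h3⟩ := exists_strictMono_three hvx hxy hv1 hv0 hx1 hx0
    exact ⟨ψ, hψ, h3, h2, h1⟩
  obtain ⟨g, hg⟩ := hc.exists_dual hTX hπ fun e => if b y ≤ b e then φ (b e) else ψ (b e)
  have hmono := StrictMono.glue hφ hψ hφy hψy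
  have below : ∀ t, t ≤ b y → (if b y ≤ t then φ t else ψ t) = ψ t := fun t ht => by
    split_ifs with h
    · rw [le_antisymm ht h, hφy, hψy]
    · rfl
  have hgu : g u = U := by rw [hg u hu, if_pos hyu]
  have hgw : g w = V := by rw [hg w hw, if_pos hyw]
  have hgv : g v = γv := by rw [hg v hv, below _ (hvx.trans hxy), hψv]
  have gy : g y = (1 - τ₁) * g x + τ₁ * U := by
    rw [← hgu]; conv_lhs => rw [e1]
    simp
  have gz : g z = (1 - τ₂) * g y + τ₂ * V := by
    rw [← hgw]; conv_lhs => rw [e2]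
    simp
  have gx : g x = (1 - τ₃) * g z + τ₃ * γv := by
    rw [← hgv]; conv_lhs => rw [e3]
    simp
  have hgx : g x = (1 - τ₃) * (1 - τ₂) * g y + γx := by
    rw [gx, gz, hγv]; ring
  -- Going around the triangle expresses `g y` as a multiple of itself by a factor less than one,
  -- the constants cancelling by the choice of `γx` and `γv`.
  have hgy : g y = 0 := by
    have h1 : (1 - (1 - τ₁) * ((1 - τ₃) * (1 - τ₂))) * g y = 0 := by
      linear_combination gy + (1 - τ₁) * hgx + hγx
    have h2 : (1 - τ₃) * (1 - τ₂) < 1 := by nlinarith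
    have h3 : (1 - τ₁) * ((1 - τ₃) * (1 - τ₂)) < 1 := by
      have : 0 < (1 - τ₃) * (1 - τ₂) := mul_pos (by linarith) (by linarith)
      exact (mul_lt_of_lt_one_left this (by linarith)).trans h2
    exact (mul_eq_zero.1 h1).resolve_left (by linarith)
  refine ⟨g, InducesOrder.of_strictMono hmono fun t ht => ?_⟩
  by_cases htT : t ∈ T
  · exact hg t htT
  rcases hp t ht htT with rfl | rfl | rfl
  · rw [below _ hxy, hψx, hgx, hgy]; ring
  · rw [if_pos le_rfl, hφy, hgy]
  · rw [if_pos hyz, hφz, gz, hgy]; ring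

theorem IsAligned.exists_inducesOrder {T : Finset W} (h : IsAligned X T) (hX : X.Finite)
    {π : Dual ℝ W} (hπ : ∀ x ∈ X, π x = 1) (hb : IsStringOrder X b) :
    ∃ g, InducesOrder X b g := by
  obtain ⟨c, hc⟩ := h.exists_isCoord
  rcases h.cases hX with hXT | ⟨u, hu, a, ha, -, hline⟩ |
    ⟨x, hx, y, hy, z, hz, u, hu, v, hv, w, hw, -, -, -, -, -, -, -, hp, h1, h2, h3⟩
  · obtain ⟨g, hg⟩ := hc.exists_dual h.subset hπ b
    exact ⟨g, InducesOrder.of_strictMono strictMono_id fun x hx => hg x (hXT hx)⟩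
  · exact exists_inducesOrder_of_line hc hX h.subset hπ hb hu ha hline
  -- The configuration is cyclically symmetric, so three levels in any cyclically increasing order
  -- are covered by rotation. The other orders are reduced to these by negating `b`.
  · have main : ∀ b : W → ℝ, IsStringOrder X b → (b x ≤ b y ∧ b y ≤ b z ∨
        b y ≤ b z ∧ b z ≤ b x ∨ b z ≤ b x ∧ b x ≤ b y) → ∃ g, InducesOrder X b g := by
      rintro b hb (⟨k1, k2⟩ | ⟨k1, k2⟩ | ⟨k1, k2⟩)
      · exact exists_inducesOrder_of_triangle hc h.subset hπ hb hx hy hz hu hv hw hp h1 h2 h3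
          k1 k2
      · exact exists_inducesOrder_of_triangle hc h.subset hπ hb hy hz hx hw hu hv
          (fun p hp' hpT => by have := hp p hp' hpT; tauto) h2 h3 h1 k1 k2
      · exact exists_inducesOrder_of_triangle hc h.subset hπ hb hz hx hy hv hw hu
          (fun p hp' hpT => by have := hp p hp' hpT; tauto) h3 h1 h2 k1 k2
    by_cases hcase : b x ≤ b y ∧ b y ≤ b z ∨ b y ≤ b z ∧ b z ≤ b x ∨ b z ≤ b x ∧ b x ≤ b y
    · exact main b hb hcase
    · obtain ⟨g, hg⟩ := main (-b) hb.neg (by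
        simp only [Pi.neg_apply, neg_le_neg_iff]
        have := le_total (b x) (b y)
        have := le_total (b y) (b z)
        have := le_total (b z) (b x)
        tauto)
      exact ⟨-g, hg.neg⟩

end Coherence

/-! ### Invariance under equality of oriented matroids -/

section OrientedMatroid

variable {V : Type*} [AddCommGroup V] [Module ℝ V] {W : Type*} [AddCommGroup W] [Module ℝ W]

/-- Every clause of alignment concerns only signs of affine functions on the set, so all clauses
pull back, with the preimage of `T` as vertex set. -/
lemma IsAligned.of_equiv {X : Set V} {Y : Set W} (e : X ≃ Y)
    (he : ∀ s : Y → SignType, s ∈ covectors Y ↔ (fun x => s (e x)) ∈ covectors X)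
    {T : Set W} (hT : IsAligned Y T) : ∃ T', IsAligned X T' := by
  have h1 : ∀ f : V →ᵃ[ℝ] ℝ, ∃ g : W →ᵃ[ℝ] ℝ, ∀ x : X,
      SignType.sign (g (e x)) = SignType.sign (f x) := by
    intro f
    obtain ⟨g, hg⟩ := (he fun y => SignType.sign (f (e.symm y))).2 ⟨f, fun x => by simp⟩
    exact ⟨g, fun x => by rw [← hg (e x)]; simp⟩
  have h2 : ∀ g : W →ᵃ[ℝ] ℝ, ∃ f : V →ᵃ[ℝ] ℝ, ∀ x : X,
      SignType.sign (g (e x)) = SignType.sign (f x) := by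
    intro g
    obtain ⟨f, hf⟩ := (he fun y => SignType.sign (g y)).1 ⟨g, fun y => rfl⟩
    exact ⟨f, fun x => hf x⟩
  have zero : ∀ {p q : ℝ}, SignType.sign p = SignType.sign q → (p = 0 ↔ q = 0) := fun h => by
    rw [← sign_eq_zero_iff, h, sign_eq_zero_iff]
  have pos : ∀ {p q : ℝ}, SignType.sign p = SignType.sign q → (0 < p ↔ 0 < q) := fun h => by
    rw [← sign_eq_one_iff, h, sign_eq_one_iff]
  refine ⟨{x | ∃ hx : x ∈ X, (e ⟨x, hx⟩ : W) ∈ T}, fun x hx => hx.1, ?_, ?_, ?_⟩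
  · rintro x ⟨hx, hxT⟩
    obtain ⟨g, hg1, hg2⟩ := hT.dual _ hxT
    obtain ⟨f, hf⟩ := h2 g
    refine ⟨f, (pos (hf ⟨x, hx⟩)).1 hg1, ?_⟩
    rintro y ⟨hy, hyT⟩ hyx
    exact (zero (hf ⟨y, hy⟩)).1 (hg2 _ hyT fun h =>
      hyx (congrArg Subtype.val (e.injective (Subtype.ext h))))
  · intro f hf x hx
    obtain ⟨g, hg⟩ := h1 f
    refine (pos (hg ⟨x, hx⟩)).1 (hT.pos g (fun y hy => ?_) _ (e ⟨x, hx⟩).2)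
    obtain ⟨x', hx'⟩ := e.surjective ⟨y, hT.subset hy⟩
    have hy' : (e x' : W) = y := congrArg Subtype.val hx'
    rw [← hy']
    exact (pos (hg x')).2 (hf x' ⟨x'.2, by rw [hy']; exact hy⟩)
  · intro x hx hxT y hy hyT hxy
    obtain ⟨t, ht, htf⟩ := hT.line (e ⟨x, hx⟩) (e ⟨x, hx⟩).2 (fun h => hxT ⟨hx, h⟩)
      (e ⟨y, hy⟩) (e ⟨y, hy⟩).2 (fun h => hyT ⟨hy, h⟩)
      fun h => hxy (congrArg Subtype.val (e.injective (Subtype.ext h)))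
    obtain ⟨x', hx'⟩ := e.surjective ⟨t, hT.subset ht⟩
    have ht' : (e x' : W) = t := congrArg Subtype.val hx'
    refine ⟨x', ⟨x'.2, by rw [ht']; exact ht⟩, fun f hfx hfy => ?_⟩
    obtain ⟨g, hg⟩ := h1 f
    refine (zero (hg x')).1 ?_
    rw [ht']
    exact htf g ((zero (hg ⟨x, hx⟩)).2 hfx) ((zero (hg ⟨y, hy⟩)).2 hfy)

lemma SameOrientedMatroid.exists_isAligned_iff {X : Set V} {Y : Set W}
    (h : SameOrientedMatroid X Y) : (∃ T, IsAligned X T) ↔ ∃ T, IsAligned Y T := by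
  obtain ⟨e, he⟩ := h
  constructor
  · rintro ⟨T, hT⟩
    refine IsAligned.of_equiv e.symm (fun s => ?_) hT
    rw [he]
    simp
  · rintro ⟨T, hT⟩
    exact IsAligned.of_equiv e he hT

lemma sameOrientedMatroid_image (φ : V ≃ₗ[ℝ] W) (X : Set V) : SameOrientedMatroid X (φ '' X) := by
  refine ⟨Equiv.Set.image φ X φ.injective, fun s => ⟨?_, ?_⟩⟩
  · rintro ⟨f, hf⟩
    exact ⟨f.comp φ.toLinearMap.toAffineMap, fun x => hf _⟩
  · rintro ⟨f, hf⟩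
    refine ⟨f.comp φ.symm.toLinearMap.toAffineMap, fun y => ?_⟩
    obtain ⟨x, rfl⟩ := (Equiv.Set.image φ X φ.injective).surjective y
    have := hf x
    simpa using this

end OrientedMatroid

/-! ### The listed configurations are aligned -/

section Listed

variable {W : Type*} [AddCommGroup W] [Module ℝ W]

lemma apply_eq_zero_of_mem_affineSpan {S : Set W} {f : W →ᵃ[ℝ] ℝ} (hf : ∀ x ∈ S, f x = 0) {x : W}
    (hx : x ∈ affineSpan ℝ S) : f x = 0 := by
  have h := (AffineSubspace.map_span f S).symm ▸ AffineSubspace.mem_map_of_mem f hx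
  have h2 : affineSpan ℝ (f '' S) ≤ affineSpan ℝ {0} := affineSpan_mono ℝ (by
    rintro _ ⟨y, hy, rfl⟩; exact hf y hy)
  simpa using h2 h

lemma isColoop_of_apply {X : Set W} {x : W} (hx : x ∈ X) {f : W →ᵃ[ℝ] ℝ} (hfx : f x ≠ 0)
    (hf : ∀ y ∈ X, y ≠ x → f y = 0) : IsColoop X x :=
  ⟨hx, fun h => hfx (apply_eq_zero_of_mem_affineSpan (fun y hy => hf y hy.1 hy.2) h)⟩

lemma exists_apply_eq_one_of_notMem {S : Set W} {x : W} (hx : x ∉ affineSpan ℝ S) :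
    ∃ f : W →ᵃ[ℝ] ℝ, f x = 1 ∧ ∀ y ∈ S, f y = 0 := by
  rcases S.eq_empty_or_nonempty with rfl | ⟨p, hp⟩
  · exact ⟨AffineMap.const ℝ W 1, by simp, by simp⟩
  have hp' := subset_affineSpan ℝ S hp
  have hd : x -ᵥ p ∉ (affineSpan ℝ S).direction := by
    rwa [AffineSubspace.vsub_right_mem_direction_iff_mem hp']
  obtain ⟨g, hg0, hg⟩ := Submodule.exists_le_ker_of_notMem hd
  refine ⟨(g x - g p)⁻¹ • (g.toAffineMap - AffineMap.const ℝ W (g p)), ?_, fun y hy => ?_⟩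
  · rw [vsub_eq_sub, map_sub] at hg0
    simp [inv_mul_cancel₀ hg0]
  · have h1 : g (y -ᵥ p) = 0 :=
      hg (AffineSubspace.vsub_mem_direction (subset_affineSpan ℝ S hy) hp')
    rw [vsub_eq_sub, map_sub] at h1
    simp [h1]

lemma IsColoop.exists_apply {X : Set W} {x : W} (h : IsColoop X x) :
    ∃ f : W →ᵃ[ℝ] ℝ, f x = 1 ∧ ∀ y ∈ X, y ≠ x → f y = 0 := by
  obtain ⟨f, h1, h0⟩ := exists_apply_eq_one_of_notMem h.2
  exact ⟨f, h1, fun y hy hne => h0 y ⟨hy, hne⟩⟩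

/-- A coloop has an affine function vanishing at all other points, so it can be a further vertex.
The dual function of an old vertex is corrected by these functions to vanish on `L`, and no new
non-vertices arise. -/
lemma IsAligned.union_coloops {E L T : Set W} (hE : IsAligned E T) (hL : L.Finite)
    (hc : ∀ x ∈ L, IsColoop (E ∪ L) x) : IsAligned (E ∪ L) (T ∪ L) := by
  classical
  have : ∀ x : W, ∃ f : W →ᵃ[ℝ] ℝ, x ∈ L → f x = 1 ∧ ∀ y ∈ E ∪ L, y ≠ x → f y = 0 := fun x => by
    by_cases hx : x ∈ L
    · obtain ⟨f, hf⟩ := (hc x hx).exists_apply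
      exact ⟨f, fun _ => hf⟩
    · exact ⟨0, fun h => absurd h hx⟩
  choose φ hφ using this
  refine ⟨Set.union_subset_union_left _ hE.subset, ?_, ?_, ?_⟩
  · intro e he
    by_cases heL : e ∈ L
    · refine ⟨φ e, by rw [(hφ e heL).1]; exact one_pos, fun x hx hne => (hφ e heL).2 x ?_ hne⟩
      exact Set.union_subset_union_left _ hE.subset hx
    have heT : e ∈ T := he.resolve_right heL
    obtain ⟨f, hfe, hf⟩ := hE.dual e heT
    have hsum : ∀ y, (∑ x ∈ hL.toFinset, f x • φ x) y = ∑ x ∈ hL.toFinset, f x * φ x y := by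
      intro y
      induction hL.toFinset using Finset.induction_on with
      | empty => simp
      | insert a s ha ih => simp [Finset.sum_insert ha, ih]
    refine ⟨f - ∑ x ∈ hL.toFinset, f x • φ x, ?_, ?_⟩
    · rw [AffineMap.coe_sub, Pi.sub_apply, hsum, Finset.sum_eq_zero, sub_zero]
      · exact hfe
      · intro x hx
        rw [Set.Finite.mem_toFinset] at hx
        rw [(hφ x hx).2 e (Or.inl (hE.subset heT)) fun h => heL (h ▸ hx), mul_zero]
    · intro y hy hne
      rw [AffineMap.coe_sub, Pi.sub_apply, hsum]
      by_cases hyL : y ∈ L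
      · rw [Finset.sum_eq_single y, (hφ y hyL).1, mul_one, sub_self]
        · intro x hx hxy
          rw [Set.Finite.mem_toFinset] at hx
          rw [(hφ x hx).2 y (Or.inr hyL) hxy.symm, mul_zero]
        · intro h
          exact absurd (hL.mem_toFinset.2 hyL) h
      · have hyT := hy.resolve_right hyL
        rw [hf y hyT hne, Finset.sum_eq_zero, sub_zero]
        intro x hx
        rw [Set.Finite.mem_toFinset] at hx
        rw [(hφ x hx).2 y (Or.inl (hE.subset hyT)) fun h => hyL (h ▸ hx), mul_zero]
  · rintro f hf x (hx | hx)
    · exact hE.pos f (fun e he => hf e (Or.inl he)) x hx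
    · exact hf x (Or.inr hx)
  · intro x hx hxT y hy hyT hxy
    rw [Set.mem_union, not_or] at hxT hyT
    obtain ⟨e, he, hf⟩ := hE.line x (hx.resolve_right hxT.2) hxT.1 y (hy.resolve_right hyT.2) hyT.1
      hxy
    exact ⟨e, Or.inl he, hf⟩

lemma AffineIndependent.exists_apply {ι : Type*} {p : ι → W} (hp : AffineIndependent ℝ p) (i : ι) :
    ∃ f : W →ᵃ[ℝ] ℝ, 0 < f (p i) ∧ ∀ x ∈ Set.range p, x ≠ p i → f x = 0 := by
  obtain ⟨f, h1, h0⟩ := exists_apply_eq_one_of_notMem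
    (hp.notMem_affineSpan_sdiff i Set.univ)
  refine ⟨f, by rw [h1]; exact one_pos, ?_⟩
  rintro _ ⟨j, rfl⟩ hne
  exact h0 _ ⟨j, ⟨trivial, fun h => hne (h ▸ rfl)⟩, rfl⟩

/-- The two extreme points serve as vertices: an affine function vanishing at two points of a line
vanishes on the whole line. -/
lemma IsU.isAligned {n : ℕ} {E : Set W} (h : IsU n E) : ∃ T, IsAligned E T := by
  obtain ⟨hn, hcard, hcol⟩ := h
  have hfin : E.Finite := Set.finite_of_ncard_pos (by omega)
  have hne : E.Nonempty := Set.nonempty_of_ncard_ne_zero (by omega)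
  obtain ⟨p₀, d, hd⟩ := (collinear_iff_exists_forall_eq_smul_vadd E).1 hcol
  obtain ⟨x₁, hx₁, x₂, hx₂, hx12⟩ := (Set.one_lt_ncard_iff hfin).1 (by omega : 1 < E.ncard) |>.imp
    fun a ⟨b, ha, hb, hab⟩ => (⟨ha, b, hb, hab⟩ : a ∈ E ∧ ∃ b ∈ E, a ≠ b)
  have hd0 : d ≠ 0 := by
    rintro rfl
    obtain ⟨r, hr⟩ := hd x₁ hx₁
    obtain ⟨s, hs⟩ := hd x₂ hx₂
    exact hx12 (by rw [hr, hs]; simp)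
  obtain ⟨g, hg⟩ := Module.exists_dual_forall_apply_ne_zero (K := ℝ) (M := W) (fun _ : Unit => d)
    fun _ => hd0
  replace hg : g d ≠ 0 := hg ()
  have hval : ∀ x ∈ E, x = p₀ + ((g x - g p₀) / g d) • d := by
    intro x hx
    obtain ⟨r, rfl⟩ := hd x hx
    have : (g (r • d +ᵥ p₀) - g p₀) / g d = r := by
      rw [vadd_eq_add, map_add, map_smul, smul_eq_mul]; field_simp; ring
    rw [this, vadd_eq_add, add_comm]
  have hinj : ∀ x ∈ E, ∀ y ∈ E, g x = g y → x = y := fun x hx y hy hxy => by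
    rw [hval x hx, hval y hy, hxy]
  obtain ⟨A, hA, hmin⟩ := Set.exists_min_image E g hfin hne
  obtain ⟨B, hB, hmax⟩ := Set.exists_max_image E g hfin hne
  have hAB : g A < g B := by
    refine lt_of_le_of_ne (hmin B hB) fun h => hx12 (hinj _ hx₁ _ hx₂ ?_)
    linarith [hmin x₁ hx₁, hmax x₁ hx₁, hmin x₂ hx₂, hmax x₂ hx₂]
  -- On the line every affine function is affine in the coordinate `g`; this is the resulting
  -- relation among three values.
  have haff : ∀ (f : W →ᵃ[ℝ] ℝ), ∀ x ∈ E, ∀ y ∈ E, ∀ z ∈ E,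
      f x * (g z - g y) + f y * (g x - g z) + f z * (g y - g x) = 0 := by
    intro f x hx y hy z hz
    have : ∀ t ∈ E, f t = f p₀ + (g t - g p₀) / g d * f.linear d := fun t ht => by
      conv_lhs => rw [hval t ht]
      rw [add_comm, ← vadd_eq_add, f.map_vadd]
      simp [add_comm]
    rw [this x hx, this y hy, this z hz]
    field_simp
    ring
  refine ⟨{A, B}, ?_, ?_, ?_, ?_⟩
  · rintro x (rfl | rfl) <;> assumption
  · rintro x (rfl | rfl)
    · refine ⟨AffineMap.const ℝ W (g B) - g.toAffineMap, by simpa using hAB, ?_⟩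
      rintro y (rfl | rfl) hne
      · exact absurd rfl hne
      · simp
    · refine ⟨g.toAffineMap - AffineMap.const ℝ W (g A), by simpa using hAB, ?_⟩
      rintro y (rfl | rfl) hne
      · simp
      · exact absurd rfl hne
  · intro f hf x hx
    have h1 := hf A (by simp)
    have h2 := hf B (by simp)
    have h3 := haff f x hx A hA B hB
    have h4 := hmin x hx
    have h5 := hmax x hx
    by_contra hcon
    have h6 : f x * (g B - g A) ≤ 0 :=
      mul_nonpos_of_nonpos_of_nonneg (not_lt.1 hcon) (by linarith)
    have h7 : f A * (g x - g B) ≤ 0 := mul_nonpos_of_nonneg_of_nonpos h1.le (by linarith)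
    have h8 : f B * (g A - g x) ≤ 0 := mul_nonpos_of_nonneg_of_nonpos h2.le (by linarith)
    have h9 : f A * (g x - g B) = 0 := by linarith
    have h10 : f B * (g A - g x) = 0 := by linarith
    have := (mul_eq_zero.1 h9).resolve_left h1.ne'
    have := (mul_eq_zero.1 h10).resolve_left h2.ne'
    linarith
  · intro x hx _ y hy _ hxy
    refine ⟨A, by simp, fun f hfx hfy => ?_⟩
    have := haff f x hx y hy A hA
    rw [hfx, hfy, zero_mul, zero_mul, zero_add, zero_add] at this
    exact (mul_eq_zero.1 this).resolve_right
      (sub_ne_zero.2 fun h => hxy (hinj x hx y hy h.symm))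

/-- The last vertex is on the line of every pair of the `a i`. The closed simplex suffices, so this
serves both `IsE` and `IsETilde`. -/
lemma isAligned_simplex {k m : ℕ} (s : Affine.Simplex ℝ W k) {a : Fin m → W}
    (ha : ∀ i, a i ∈ s.closedInterior)
    (hcol : Collinear ℝ (insert (s.points (Fin.last k)) (Set.range a))) :
    IsAligned (Set.range s.points ∪ Set.range a) (Set.range s.points) := by
  refine ⟨Set.subset_union_left, ?_, ?_, ?_⟩
  · rintro _ ⟨i, rfl⟩
    exact AffineIndependent.exists_apply s.independent i
  · rintro f hf _ (⟨i, rfl⟩ | ⟨i, rfl⟩)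
    · exact hf _ ⟨i, rfl⟩
    · obtain ⟨w, hw1, hw, h⟩ := ha i
      rw [← h, Finset.map_affineCombination _ _ _ hw1,
        Finset.affineCombination_eq_linear_combination _ _ _ hw1]
      have hn : ∀ j ∈ Finset.univ, 0 ≤ w j • (f ∘ s.points) j := fun j _ =>
        mul_nonneg (hw j).1 (hf _ ⟨j, rfl⟩).le
      refine lt_of_le_of_ne (Finset.sum_nonneg hn) fun h0 => ?_
      rw [eq_comm, Finset.sum_eq_zero_iff_of_nonneg hn] at h0
      have : ∀ j ∈ Finset.univ, w j = 0 := fun j hj =>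
        (mul_eq_zero.1 (h0 j hj)).resolve_right (hf _ ⟨j, rfl⟩).ne'
      rw [Finset.sum_eq_zero this] at hw1
      exact zero_ne_one hw1
  · intro x hx hxT y hy hyT hxy
    refine ⟨_, ⟨Fin.last k, rfl⟩, fun f hfx hfy => ?_⟩
    have h := hcol.mem_affineSpan_of_mem_of_ne (Or.inr (hx.resolve_left hxT))
      (Or.inr (hy.resolve_left hyT)) (Set.mem_insert _ _) hxy
    refine apply_eq_zero_of_mem_affineSpan (S := {x, y}) ?_ h
    rintro z (rfl | rfl) <;> assumption

lemma IsE.isAligned {k m : ℕ} {E : Set W} (h : IsE k m E) : ∃ T, IsAligned E T := by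
  obtain ⟨-, -, s, a, -, ha, hcol, rfl⟩ := h
  exact ⟨_, isAligned_simplex s (fun i => s.interior_subset_closedInterior (ha i)) hcol⟩

lemma IsETilde.isAligned {k m : ℕ} {E : Set W} (h : IsETilde k m E) : ∃ T, IsAligned E T := by
  obtain ⟨-, -, s, a, -, h0, ha, hcol, rfl⟩ := h
  refine ⟨_, isAligned_simplex s (fun i => ?_) hcol⟩
  by_cases hi : (i : ℕ) = 0
  · exact (h0 i hi).1
  · exact s.interior_subset_closedInterior (ha i hi)

lemma apply_openSegment {f : W →ᵃ[ℝ] ℝ} {x y z : W} (hz : z ∈ openSegment ℝ x y) :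
    ∃ s t : ℝ, 0 < s ∧ 0 < t ∧ s + t = 1 ∧ z = s • x + t • y ∧ f z = s * f x + t * f y := by
  obtain ⟨s, t, hs, ht, hst, rfl⟩ := hz
  refine ⟨s, t, hs, ht, hst, rfl, ?_⟩
  exact Convex.combo_affine_apply hst

lemma apply_pos_of_openSegment {f : W →ᵃ[ℝ] ℝ} {x y z : W} (hz : z ∈ openSegment ℝ x y)
    (hx : 0 < f x) (hy : 0 < f y) : 0 < f z := by
  obtain ⟨s, t, hs, ht, -, -, h⟩ := apply_openSegment (f := f) hz
  rw [h]; positivity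

lemma apply_eq_zero_of_openSegment {f : W →ᵃ[ℝ] ℝ} {x y z z' : W} (hz : z ∈ openSegment ℝ x y)
    (hz' : z' ∈ openSegment ℝ x y) (hne : z ≠ z') (h : f z = 0) (h' : f z' = 0) : f x = 0 := by
  obtain ⟨s, t, hs, ht, hst, e, hf⟩ := apply_openSegment (f := f) hz
  obtain ⟨s', t', hs', ht', hst', e', hf'⟩ := apply_openSegment (f := f) hz'
  rw [h] at hf
  rw [h'] at hf'
  have : (s - s') * f x = 0 := by
    have h1 : t = 1 - s := by linarith
    have h2 : t' = 1 - s' := by linarith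
    rw [h1] at hf
    rw [h2] at hf'
    linear_combination (1 - s) * hf' - (1 - s') * hf
  refine (mul_eq_zero.1 this).resolve_left (sub_ne_zero.2 fun hss => hne ?_)
  rw [e, e', ← hss, show t' = t by linarith]

/-- Any two of `D, G, H` lie on a common segment issuing from one of `A, B, C`. -/
lemma IsR3.isAligned {E : Set W} (h : IsR3 E) : ∃ T, IsAligned E T := by
  obtain ⟨A, B, C, A', B', C', D, G, H, hind, hA', hB', hC', hD, hG, hH, -, rfl⟩ := h
  have hrange : Set.range ![A, B, C] = {A, B, C} := by
    ext x
    simp [eq_comm]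
    tauto
  refine ⟨{A, B, C}, ?_, ?_, ?_, ?_⟩
  · rintro x (rfl | rfl | rfl) <;> simp
  · rw [← hrange]
    rintro _ ⟨i, rfl⟩
    exact AffineIndependent.exists_apply hind i
  · intro f hf x hx
    have fA := hf A (by simp)
    have fB := hf B (by simp)
    have fC := hf C (by simp)
    have fA' := apply_pos_of_openSegment hA' fB fC
    have fB' := apply_pos_of_openSegment hB' fC fA
    have fC' := apply_pos_of_openSegment hC' fA fB
    rcases hx with rfl | rfl | rfl | rfl | rfl | rfl
    · exact fA
    · exact fB
    · exact fC
    · exact apply_pos_of_openSegment hD.1 fA fA'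
    · exact apply_pos_of_openSegment hG.1 fB fB'
    · exact apply_pos_of_openSegment hH.1 fC fC'
  · intro x hx hxT y hy hyT hxy
    have hx' : x = D ∨ x = G ∨ x = H := by
      simp only [Set.mem_insert_iff, Set.mem_singleton_iff, not_or] at hx hxT
      tauto
    have hy' : y = D ∨ y = G ∨ y = H := by
      simp only [Set.mem_insert_iff, Set.mem_singleton_iff, not_or] at hy hyT
      tauto
    rcases hx' with rfl | rfl | rfl <;> rcases hy' with rfl | rfl | rfl
    · exact absurd rfl hxy
    · exact ⟨B, by simp, fun f h1 h2 => apply_eq_zero_of_openSegment hD.2 hG.1 hxy h1 h2⟩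
    · exact ⟨A, by simp, fun f h1 h2 => apply_eq_zero_of_openSegment hD.1 hH.2 hxy h1 h2⟩
    · exact ⟨B, by simp, fun f h1 h2 => apply_eq_zero_of_openSegment hG.1 hD.2 hxy h1 h2⟩
    · exact absurd rfl hxy
    · exact ⟨C, by simp, fun f h1 h2 => apply_eq_zero_of_openSegment hG.2 hH.1 hxy h1 h2⟩
    · exact ⟨A, by simp, fun f h1 h2 => apply_eq_zero_of_openSegment hH.2 hD.1 hxy h1 h2⟩
    · exact ⟨C, by simp, fun f h1 h2 => apply_eq_zero_of_openSegment hH.1 hG.2 hxy h1 h2⟩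
    · exact absurd rfl hxy

theorem IsListed.isAligned {X : Set W} (h : IsListed X) (hX : X.Finite) : ∃ T, IsAligned X T := by
  obtain ⟨E, L, rfl, hc, hE⟩ := h
  obtain ⟨T, hT⟩ : ∃ T, IsAligned E T := by
    rcases hE with rfl | ⟨n, h⟩ | ⟨k, m, h⟩ | ⟨k, m, h⟩ | h
    · exact ⟨∅, Set.Subset.rfl, by simp, by simp, by simp⟩
    · exact h.isAligned
    · exact h.isAligned
    · exact h.isAligned
    · exact h.isAligned
  exact ⟨_, hT.union_coloops (hX.subset Set.subset_union_right) hc⟩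

end Listed

/-! ### Enumerations with a prescribed first or last element -/

section Enumeration

/-- A finite set can be enumerated starting with a given element. -/
lemma exists_enumeration_zero {W : Type*} {S : Set W} (hS : S.Finite) {a : W} (ha : a ∈ S) :
    ∃ (m : ℕ) (p : Fin m → W), 1 ≤ m ∧ Function.Injective p ∧ Set.range p = S ∧
      ∀ i : Fin m, (i : ℕ) = 0 ↔ p i = a := by
  classical
  set s := hS.toFinset with hs
  have has : a ∈ s := by simpa [hs] using ha
  have hcard : s.card = (s.card - 1) + 1 := by
    have := Finset.card_pos.2 ⟨a, has⟩
    omega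
  let e := s.equivFinOfCardEq hcard
  let e' := e.trans (Equiv.swap (e ⟨a, has⟩) 0)
  have he' : e' ⟨a, has⟩ = 0 := by simp [e']
  refine ⟨s.card - 1 + 1, fun i => e'.symm i, by omega,
    Subtype.val_injective.comp e'.symm.injective, ?_, fun i => ?_⟩
  · ext x
    constructor
    · rintro ⟨i, rfl⟩
      exact hS.mem_toFinset.1 (e'.symm i).2
    · intro hx
      exact ⟨e' ⟨x, by simpa [hs] using hx⟩, by simp⟩
  · constructor
    · intro hi
      have : i = 0 := Fin.ext hi
      dsimp only
      rw [this, ← he', Equiv.symm_apply_apply]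
    · intro hi
      have : e'.symm i = ⟨a, has⟩ := Subtype.ext hi
      rw [Equiv.symm_apply_eq, he'] at this
      rw [this]; rfl

lemma exists_enumeration_last {W : Type*} {S : Finset W} {k : ℕ} (hS : S.card = k + 1) {a : W} (ha : a ∈ S) :
    ∃ p : Fin (k + 1) → W, Function.Injective p ∧ Set.range p = S ∧ p (Fin.last k) = a := by
  classical
  let e := S.equivFinOfCardEq hS
  let e' := e.trans (Equiv.swap (e ⟨a, ha⟩) (Fin.last k))
  have he' : e' ⟨a, ha⟩ = Fin.last k := by simp [e']
  refine ⟨fun i => e'.symm i, Subtype.val_injective.comp e'.symm.injective, ?_, ?_⟩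
  · ext x
    constructor
    · rintro ⟨i, rfl⟩
      exact (e'.symm i).2
    · intro hx
      exact ⟨e' ⟨x, hx⟩, by simp⟩
  · dsimp only
    rw [← he', Equiv.symm_apply_apply]

lemma sum_comp_enumeration {W M ι : Type*} [AddCommMonoid M] [Fintype ι] {S : Finset W} {p : ι → W}
    (hp : Function.Injective p) (hS : Set.range p = S) (g : W → M) :
    ∑ i, g (p i) = ∑ e ∈ S, g e := by
  classical
  rw [← Finset.sum_image (s := Finset.univ) (f := g) (g := p) fun i _ j _ hij => hp hij]
  refine Finset.sum_congr ?_ fun _ _ => rfl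
  ext e
  rw [← Finset.mem_coe (s := S), ← hS]
  simp

end Enumeration

/-! ### Aligned sets are of listed form -/

section ToListed

variable {W : Type*} [AddCommGroup W] [Module ℝ W] {X : Set W} {T : Finset W}
  {c : W → W →ᵃ[ℝ] ℝ}

lemma apply_affine_combo (f : W →ᵃ[ℝ] ℝ) (τ : ℝ) (x y : W) :
    f ((1 - τ) • x + τ • y) = (1 - τ) * f x + τ * f y :=
  Convex.combo_affine_apply (by ring)

lemma IsCoord.isColoop (hc : IsCoord X T c) (hTX : ↑T ⊆ X) {e : W} (he : e ∈ T)
    (h0 : ∀ x ∈ X, x ∉ T → c e x = 0) : IsColoop X e :=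
  isColoop_of_apply (hTX he) (f := c e) (by rw [hc.self e he]; exact one_ne_zero) fun y hy hne => by
    by_cases hyT : y ∈ T
    · exact hc.ne e he y hyT hne
    · exact h0 y hy hyT

lemma IsCoord.affineIndependent (hc : IsCoord X T c) {ι : Type*} {p : ι → W} (hp : ∀ i, p i ∈ T)
    (hinj : Function.Injective p) : AffineIndependent ℝ p := by
  classical
  rw [affineIndependent_iff]
  intro s w hw hsum i hi
  have key : ∀ f : W →ᵃ[ℝ] ℝ, ∑ j ∈ s, w j * f (p j) = 0 := fun f => by
    have h1 : ∀ t, f t = f.linear t + f 0 := fun t => by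
      have := f.map_vadd 0 t
      simpa using this
    have h2 := congrArg f.linear hsum
    simp only [map_sum, map_smul, smul_eq_mul, map_zero] at h2
    rw [Finset.sum_congr rfl fun j _ => by rw [h1 (p j), mul_add], Finset.sum_add_distrib, h2,
      ← Finset.sum_mul, hw, zero_mul, zero_add]
  have := key (c (p i))
  rwa [Finset.sum_eq_single i, hc.self _ (hp i), mul_one] at this
  · intro j _ hne
    rw [hc.ne _ (hp i) _ (hp j) (hinj.ne hne), mul_zero]
  · exact fun h => absurd hi h

/-- Only `u` and the vertices with nonzero coordinate at `a` matter; the other vertices are coloops.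
Two relevant vertices give points on a line. Otherwise all non-vertices except possibly `a` are
interior to the simplex of relevant vertices, and `a` is on its boundary exactly when its
`u`-coordinate vanishes. -/
lemma IsAligned.isListed_of_line (h : IsAligned X T) (hc : IsCoord X T c) (hX : X.Finite)
    {u a : W} (hu : u ∈ T) (ha : a ∈ X) (haT : a ∉ T)
    (hline : ∀ x ∈ X, x ∉ T → x ≠ a → Btw a u x) : IsListed X := by
  classical
  set T₀ := T.filter fun e => c e a ≠ 0 ∨ e = u with hT₀
  have hT₀T : T₀ ⊆ T := Finset.filter_subset _ _
  have huT₀ : u ∈ T₀ := by simp [hT₀, hu]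
  set A := {x ∈ X | x ∉ T} with hA
  have haA : a ∈ A := ⟨ha, haT⟩
  have hAX : A ⊆ X := fun x hx => hx.1
  have hT0 : ∀ e ∈ T, e ∉ T₀ → c e a = 0 ∧ e ≠ u := fun e he heT₀ => by
    rw [hT₀, Finset.mem_filter] at heT₀
    push Not at heT₀
    exact heT₀ he
  have hAcoord : ∀ x ∈ A, ∀ e ∈ T, e ∉ T₀ → c e x = 0 := by
    intro x hx e he heT₀
    obtain ⟨h1, h2⟩ := hT0 e he heT₀
    by_cases hxa : x = a
    · rw [hxa, h1]
    · obtain ⟨τ, -, -, rfl⟩ := hline x hx.1 hx.2 hxa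
      rw [apply_affine_combo, h1, hc.ne e he u hu h2.symm, mul_zero, mul_zero, add_zero]
  have hXE : X = (↑T₀ ∪ A) ∪ ↑(T \ T₀) := by
    ext x
    simp only [Set.mem_union, Finset.mem_coe, Finset.mem_sdiff, hA, Set.mem_ofPred_eq]
    constructor
    · intro hx
      by_cases hxT : x ∈ T
      · by_cases hx0 : x ∈ T₀
        · exact Or.inl (Or.inl hx0)
        · exact Or.inr ⟨hxT, hx0⟩
      · exact Or.inl (Or.inr ⟨hx, hxT⟩)
    · rintro ((h1 | h1) | h1)
      · exact h.subset (hT₀T h1)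
      · exact h1.1
      · exact h.subset h1.1
  refine ⟨↑T₀ ∪ A, ↑(T \ T₀), hXE, ?_, ?_⟩
  · rw [← hXE]
    intro e he
    rw [Finset.mem_coe, Finset.mem_sdiff] at he
    exact hc.isColoop h.subset he.1 fun x hx hxT => hAcoord x ⟨hx, hxT⟩ e he.1 he.2
  right
  obtain ⟨e₀, he₀, hne₀, hpos₀⟩ := hc.exists_pos ha haT u
  have he₀T₀ : e₀ ∈ T₀ := by simp [hT₀, he₀, hpos₀.ne']
  have hAsum : ∀ x ∈ A, ∑ e ∈ T₀, c e x = 1 := fun x hx => by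
    rw [← hc.sum_eq x hx.1]
    exact Finset.sum_subset hT₀T fun e he he' => hAcoord x hx e he he'
  have hAsmul : ∀ x ∈ A, ∑ e ∈ T₀, c e x • e = x := fun x hx => by
    conv_rhs => rw [← hc.sum_smul x hx.1]
    exact Finset.sum_subset hT₀T fun e he he' => by rw [hAcoord x hx e he he', zero_smul]
  have hfin : (↑T₀ ∪ A).Finite := T₀.finite_toSet.union (hX.subset hAX)
  by_cases hcard : T₀.card = 2
  · left
    have hT₀' : T₀ = {u, e₀} := (Finset.eq_of_subset_of_card_le
      (by intro x; simp only [Finset.mem_insert, Finset.mem_singleton]; rintro (rfl | rfl) <;> assumption)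
      (by rw [hcard, Finset.card_pair hne₀.symm])).symm
    refine ⟨_, ?_, rfl, ?_⟩
    · rw [← Set.ncard_pair hne₀.symm]
      apply Set.ncard_le_ncard _ hfin
      rw [hT₀']
      simp
    · rw [collinear_iff_exists_forall_eq_smul_vadd]
      refine ⟨u, e₀ - u, ?_⟩
      rintro x (hx | hx)
      · rw [hT₀'] at hx
        simp only [Finset.coe_insert, Finset.coe_singleton, Set.mem_insert_iff,
          Set.mem_singleton_iff] at hx
        rcases hx with rfl | rfl
        · exact ⟨0, by simp⟩
        · exact ⟨1, by simp⟩
      · refine ⟨c e₀ x, ?_⟩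
        have h1 := hAsum x hx
        have h2 := hAsmul x hx
        rw [hT₀', Finset.sum_pair hne₀.symm] at h1 h2
        conv_lhs => rw [← h2]
        rw [eq_sub_of_add_eq h1, vadd_eq_add]
        module
  right
  have hcard2 : 2 ≤ T₀.card := by
    rw [← Finset.card_pair hne₀.symm]
    exact Finset.card_le_card (by
      intro x; simp only [Finset.mem_insert, Finset.mem_singleton]; rintro (rfl | rfl) <;> assumption)
  obtain ⟨k, hk⟩ : ∃ k, T₀.card = k + 1 := ⟨T₀.card - 1, by omega⟩
  obtain ⟨p, hpinj, hprange, hplast⟩ := exists_enumeration_last hk huT₀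
  obtain ⟨m, q, hm, hqinj, hqrange, hq0⟩ := exists_enumeration_zero (hX.subset hAX) haA
  have hpT₀ : ∀ i, p i ∈ T₀ := fun i => by
    rw [← Finset.mem_coe, ← hprange]; exact ⟨i, rfl⟩
  let s : Affine.Simplex ℝ W k := ⟨p, hc.affineIndependent (fun i => hT₀T (hpT₀ i)) hpinj⟩
  have hw1 : ∀ x ∈ A, ∑ i, c (p i) x = 1 := fun x hx => by
    rw [sum_comp_enumeration hpinj hprange fun e => c e x, hAsum x hx]
  have hcomb : ∀ x ∈ A, Finset.univ.affineCombination ℝ s.points (fun i => c (p i) x) = x := by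
    intro x hx
    rw [Finset.affineCombination_eq_linear_combination _ _ _ (hw1 x hx)]
    exact (sum_comp_enumeration hpinj hprange fun e => c e x • e).trans (hAsmul x hx)
  have hcol : Collinear ℝ (insert (s.points (Fin.last k)) (Set.range q)) := by
    rw [collinear_iff_exists_forall_eq_smul_vadd]
    refine ⟨a, u - a, ?_⟩
    rintro x (rfl | hx)
    · exact ⟨1, by simp [s, hplast]⟩
    · rw [hqrange] at hx
      by_cases hxa : x = a
      · exact ⟨0, by simp [hxa]⟩
      · obtain ⟨τ, -, -, rfl⟩ := hline x hx.1 hx.2 hxa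
        exact ⟨τ, by rw [vadd_eq_add]; module⟩
  have hE : ↑T₀ ∪ A = Set.range s.points ∪ Set.range q := by rw [hqrange, ← hprange]
  have hlt1 : ∀ x ∈ A, ∀ e ∈ T, c e x < 1 := fun x hx e he => by
    obtain ⟨e', he', hne, hp⟩ := hc.exists_pos hx.1 hx.2 e
    rw [← hc.sum_eq x hx.1]
    exact Finset.single_lt_sum hne he he' hp fun k hk _ => hc.nonneg x hx.1 k hk
  have ha_pos : ∀ e ∈ T₀, e ≠ u → 0 < c e a := fun e he hne => by
    rw [hT₀, Finset.mem_filter] at he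
    exact lt_of_le_of_ne (hc.nonneg a ha e he.1) (he.2.resolve_right hne).symm
  have hint : ∀ x ∈ A, x ≠ a → x ∈ s.interior := by
    intro x hx hxa
    rw [← hcomb x hx, s.affineCombination_mem_interior_iff (hw1 x hx)]
    refine fun i => ⟨?_, hlt1 x hx _ (hT₀T (hpT₀ i))⟩
    obtain ⟨τ, h0, h1, rfl⟩ := hline x hx.1 hx.2 hxa
    rw [apply_affine_combo]
    have hT := hT₀T (hpT₀ i)
    by_cases hpu : p i = u
    · have := hc.nonneg a ha _ hT
      rw [hpu] at this ⊢
      rw [hc.self u hu]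
      nlinarith
    · rw [hc.ne _ hT u hu fun h => hpu h.symm, mul_zero, add_zero]
      exact mul_pos (by linarith) (ha_pos _ (hpT₀ i) hpu)
  have hqA : ∀ i, q i ∈ A := fun i => by rw [← hqrange]; exact ⟨i, rfl⟩
  by_cases hua : c u a = 0
  · right; left
    refine ⟨k, m, by omega, hm, s, q, hqinj, fun i hi => ?_, fun i hi => ?_, hcol, hE⟩
    · rw [(hq0 i).1 hi, ← hcomb a haA, s.affineCombination_mem_closedInterior_iff (hw1 a haA),
        s.affineCombination_mem_interior_iff (hw1 a haA)]
      refine ⟨fun i => ⟨hc.nonneg a ha _ (hT₀T (hpT₀ i)), (hlt1 a haA _ (hT₀T (hpT₀ i))).le⟩,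
        fun h => ?_, ?_⟩
      · have := (h (Fin.last k)).1
        rw [hplast, hua] at this
        exact lt_irrefl _ this
      · rw [hcomb a haA]
        rintro ⟨j, hj⟩
        exact haT (hj ▸ hT₀T (hpT₀ j))
    · exact hint _ (hqA i) fun h => hi ((hq0 i).2 h)
  · left
    refine ⟨k, m, by omega, hm, s, q, hqinj, fun i => ?_, hcol, hE⟩
    by_cases hqa : q i = a
    · rw [hqa, ← hcomb a haA, s.affineCombination_mem_interior_iff (hw1 a haA)]
      refine fun j => ⟨?_, hlt1 a haA _ (hT₀T (hpT₀ j))⟩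
      by_cases hpu : p j = u
      · rw [hpu]; exact lt_of_le_of_ne (hc.nonneg a ha u hu) (Ne.symm hua)
      · exact ha_pos _ (hpT₀ j) hpu
    · exact hint _ (hqA i) hqa

/-- If `y` is between `x` and `u`, `z` between `y` and `w`, and `x` between `z` and `v`, then `x`
and `y` lie on a segment from `u` to a point between `v` and `w`. -/
lemma exists_mem_openSegment_of_cyclic {x y z u v w : W} (h₁ : Btw x u y) (h₂ : Btw y w z)
    (h₃ : Btw z v x) :
    ∃ p ∈ openSegment ℝ v w, x ∈ openSegment ℝ u p ∧ y ∈ openSegment ℝ u p := by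
  obtain ⟨τ₁, p1, q1, e1⟩ := h₁
  obtain ⟨τ₂, p2, q2, e2⟩ := h₂
  obtain ⟨τ₃, p3, q3, e3⟩ := h₃
  have r1 : 0 < 1 - τ₁ := by linarith
  have r2 : 0 < 1 - τ₂ := by linarith
  have r3 : 0 < 1 - τ₃ := by linarith
  set ρ := (1 - τ₁) * ((1 - τ₂) * (1 - τ₃)) with hρ
  have hρ1 : 0 < 1 - ρ := by
    have h1 : (1 - τ₂) * (1 - τ₃) < 1 := by nlinarith
    have h2 := mul_lt_of_lt_one_left (mul_pos r2 r3) (by linarith : 1 - τ₁ < 1)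
    linarith
  -- Going once around the cycle expresses `x` through itself with factor `ρ < 1` and through `u, v,
  -- w`. Solving for `x` and merging the terms at `v` and `w` into one point gives `p`.
  have hx : (1 - ρ) • x = ((1 - τ₃) * ((1 - τ₂) * τ₁)) • u + ((1 - τ₃) * τ₂) • w + τ₃ • v := by
    have : x = (1 - τ₃) • ((1 - τ₂) • ((1 - τ₁) • x + τ₁ • u) + τ₂ • w) + τ₃ • v := by
      rw [← e1, ← e2, ← e3]
    rw [sub_smul, one_smul]
    conv_lhs => enter [1]; rw [this]
    rw [hρ]
    module
  set β := τ₃ + (1 - τ₃) * τ₂ with hβ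
  have hβ0 : 0 < β := by positivity
  set p := (τ₃ / β) • v + ((1 - τ₃) * τ₂ / β) • w with hp
  set α := ((1 - τ₃) * ((1 - τ₂) * τ₁)) / (1 - ρ) with hα
  have hα0 : 0 < α := by positivity
  have hαβ : α + β / (1 - ρ) = 1 := by
    rw [hα, ← add_div, div_eq_one_iff_eq hρ1.ne', hβ, hρ]; ring
  have hxp : x = α • u + (β / (1 - ρ)) • p := by
    rw [← inv_smul_smul₀ hρ1.ne' x, hx, hp, hα]
    simp only [smul_add, smul_smul]
    have k1 : β / (1 - ρ) * (τ₃ / β) = (1 - ρ)⁻¹ * τ₃ := by field_simp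
    have k2 : β / (1 - ρ) * ((1 - τ₃) * τ₂ / β) = (1 - ρ)⁻¹ * ((1 - τ₃) * τ₂) := by field_simp
    rw [k1, k2, div_eq_inv_mul]
    abel
  have hxs : x ∈ openSegment ℝ u p := ⟨α, β / (1 - ρ), hα0, by positivity, hαβ, hxp.symm⟩
  refine ⟨p, ⟨τ₃ / β, (1 - τ₃) * τ₂ / β, by positivity, by positivity, ?_, rfl⟩, hxs, ?_⟩
  · rw [← add_div, div_self hβ0.ne']
  · refine ⟨(1 - τ₁) * α + τ₁, (1 - τ₁) * (β / (1 - ρ)), by positivity, by positivity, ?_, ?_⟩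
    · linear_combination (1 - τ₁) * hαβ
    · conv_rhs => rw [e1, hxp]
      module

/-- In the cyclic case the two points joined through a vertex lie on a segment from it to the
opposite side. The three such segments meet pairwise in the three non-vertices, which is `R_3`; the
remaining vertices are coloops. -/
theorem IsAligned.isListed (h : IsAligned X T) (hX : X.Finite) : IsListed X := by
  classical
  obtain ⟨c, hc⟩ := h.exists_isCoord
  rcases h.cases hX with hXT | ⟨u, hu, a, ha, haT, hline⟩ |
    ⟨x, hx, y, hy, z, hz, u, hu, v, hv, w, hw, huv, huw, hvw, hxz, hxT, hyT, hzT, hp, h1, h2, h3⟩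
  · refine ⟨∅, X, by simp, fun e he => ?_, Or.inl rfl⟩
    rw [Set.empty_union]
    exact hc.isColoop h.subset (hXT he) fun x hx hxT => absurd (hXT hx) hxT
  · exact h.isListed_of_line hc hX hu ha haT hline
  · have hXE : X = {u, v, w, x, z, y} ∪ ↑(T \ {u, v, w}) := by
      ext t
      simp only [Set.mem_union, Finset.mem_coe, Finset.mem_sdiff, Set.mem_insert_iff,
        Set.mem_singleton_iff, Finset.mem_insert, Finset.mem_singleton]
      constructor
      · intro ht
        by_cases htT : t ∈ T
        · tauto
        · have := hp t ht htT
          tauto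
      · rintro ((rfl | rfl | rfl | rfl | rfl | rfl) | ht)
        · exact h.subset hu
        · exact h.subset hv
        · exact h.subset hw
        · exact hx
        · exact hz
        · exact hy
        · exact h.subset ht.1
    refine ⟨{u, v, w, x, z, y}, ↑(T \ {u, v, w}), hXE, ?_, ?_⟩
    · rw [← hXE]
      intro e he
      simp only [Finset.mem_coe, Finset.mem_sdiff, Finset.mem_insert, Finset.mem_singleton,
        not_or] at he
      obtain ⟨he, heu, hev, hew⟩ := he
      obtain ⟨p, hps, hxs, hys⟩ := exists_mem_openSegment_of_cyclic h1 h2 h3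
      obtain ⟨q, hqs, -, hzs⟩ := exists_mem_openSegment_of_cyclic h2 h3 h1
      have hu0 := hc.ne e he u hu (Ne.symm heu)
      have hv0 := hc.ne e he v hv (Ne.symm hev)
      have hw0 := hc.ne e he w hw (Ne.symm hew)
      have seg : ∀ {a b t : W}, t ∈ openSegment ℝ a b → c e a = 0 → c e b = 0 → c e t = 0 :=
        fun ht ha hb => by
          obtain ⟨_, _, -, -, -, -, h⟩ := apply_openSegment (f := c e) ht
          rw [h, ha, hb, mul_zero, mul_zero, add_zero]
      have hp0 := seg hps hv0 hw0
      have hq0 := seg hqs hu0 hv0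
      refine hc.isColoop h.subset he fun t ht htT => ?_
      rcases hp t ht htT with rfl | rfl | rfl
      · exact seg hxs hu0 hp0
      · exact seg hys hu0 hp0
      · exact seg hzs hw0 hq0
    · right; right; right; right
      obtain ⟨A', hA', hxA, hyA⟩ := exists_mem_openSegment_of_cyclic h1 h2 h3
      obtain ⟨C', hC', hyC, hzC⟩ := exists_mem_openSegment_of_cyclic h2 h3 h1
      obtain ⟨B', hB', hzB, hxB⟩ := exists_mem_openSegment_of_cyclic h3 h1 h2
      refine ⟨u, v, w, A', B', C', x, z, y, ?_, hA', hB', hC', ⟨hxA, hxB⟩, ⟨hzB, hzC⟩, ⟨hyC, hyA⟩,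
        hxz, rfl⟩
      refine hc.affineIndependent (fun i => ?_) fun i j hij => ?_
      · fin_cases i <;> assumption
      · fin_cases i <;> fin_cases j <;> simp_all

end ToListed

/-! ### Perturbing string orders; induced orders force leanness -/

section Refinement

variable {W : Type*} [AddCommGroup W] [Module ℝ W]

lemma exists_dual_extending {J : Set W} (hJ : LinearIndepOn ℝ id J) (γ : W → ℝ) :
    ∃ h : Dual ℝ W, ∀ x ∈ J, h x = γ x := by
  refine ⟨(Basis.extend hJ).constr ℝ fun i => γ i, fun x hx => ?_⟩
  have hx' : x ∈ hJ.extend (Set.subset_univ _) := hJ.subset_extend _ hx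
  have := (Basis.extend hJ).constr_basis ℝ (fun i => γ i) ⟨x, hx'⟩
  rwa [Basis.extend_apply_self] at this

/-- Perturbing a string order inside each level by a linear functional gives a string order. -/
lemma IsStringOrder.refine {X : Set W} (hX : X.Finite) {π : Dual ℝ W} (hπ : ∀ x ∈ X, π x = 1)
    {b : W → ℝ} (hb : IsStringOrder X b) (h : ℝ → Dual ℝ W) :
    ∃ b', IsStringOrder X b' ∧
      ∀ x ∈ X, ∀ y ∈ X, b x = b y → (b' x < b' y ↔ h (b x) x < h (b x) y) ∧
        (b' x = b' y ↔ h (b x) x = h (b x) y) := by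
  have hev : ∀ᶠ ε in 𝓝[>] (0 : ℝ), ∀ x ∈ X, ∀ y ∈ X, b x < b y →
      0 < (b y - b x) + ε * (h (b y) y - h (b x) x) := by
    rw [hX.eventually_all]
    intro x _
    rw [hX.eventually_all]
    intro y _
    by_cases hxy : b x < b y
    · filter_upwards [eventually_pos_add_mul (Or.inl (sub_pos.2 hxy))] with ε hε _ using hε
    · simp [hxy]
  -- One `ε` keeps distinct levels of `b` apart. A second small parameter `δ`, depending on `x₀`,
  -- perturbs the functional of the level without changing signs off that level.
  obtain ⟨ε, hε, hε0⟩ := (hev.and self_mem_nhdsWithin).exists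
  replace hε0 : 0 < ε := hε0
  refine ⟨fun x => b x + ε * h (b x) x, fun x₀ hx₀ => ?_, fun x _ y _ hxy => ?_⟩
  · obtain ⟨f, hf0, hf⟩ := hb.exists_apply hx₀
    have hev' : ∀ᶠ δ in 𝓝[>] (0 : ℝ), ∀ x ∈ X,
        (b x₀ < b x → 0 < f x + δ * (h (b x₀) x - h (b x₀) x₀)) ∧
        (b x < b x₀ → 0 < -f x + δ * -(h (b x₀) x - h (b x₀) x₀)) := by
      rw [hX.eventually_all]
      intro x hx
      rcases lt_trichotomy (b x₀) (b x) with hlt | heq | hlt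
      · filter_upwards [eventually_pos_add_mul (Or.inl ((hf x hx).1.2 hlt))] with δ hδ
        exact ⟨fun _ => hδ, fun h => absurd h hlt.not_gt⟩
      · simp [heq]
      · filter_upwards [eventually_pos_add_mul (Or.inl (neg_pos.2 ((hf x hx).2.1.2 hlt)))]
          with δ hδ
        exact ⟨fun h => absurd h hlt.not_gt, fun _ => hδ⟩
    obtain ⟨δ, hδ, hδ0⟩ := (hev'.and self_mem_nhdsWithin).exists
    replace hδ0 : 0 < δ := hδ0
    refine ⟨f + δ • (h (b x₀) - h (b x₀) x₀ • π), fun x hx => ?_⟩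
    have hval : (f + δ • (h (b x₀) - h (b x₀) x₀ • π)) x =
        f x + δ * (h (b x₀) x - h (b x₀) x₀) := by
      simp [hπ x hx]
    rw [hval]
    dsimp only
    rcases lt_trichotomy (b x₀) (b x) with hlt | heq | hlt
    · rw [sign_pos ((hδ x hx).1 hlt), sign_pos]
      have := hε x₀ hx₀ x hx hlt
      linarith
    · rw [(hf x hx).2.2.2 heq.symm, ← heq, zero_add, sign_mul, sign_pos hδ0, one_mul]
      have : b x₀ + ε * h (b x₀) x - (b x₀ + ε * h (b x₀) x₀) =
          ε * (h (b x₀) x - h (b x₀) x₀) := by ring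
      rw [this, sign_mul, sign_pos hε0, one_mul]
    · have h1 := (hδ x hx).2 hlt
      have h2 := hε x hx x₀ hx₀ hlt
      rw [sign_neg (by linarith), sign_neg (by linarith)]
  · dsimp only
    rw [← hxy, add_lt_add_iff_left, mul_lt_mul_iff_right₀ hε0, add_right_inj,
      mul_right_inj' hε0.ne']
    exact ⟨Iff.rfl, Iff.rfl⟩

variable [FiniteDimensional ℝ W]

/-- If all string orders are induced by linear functionals, then the levels of each of them have
total affine dimension less than that of `X`. -/
theorem isLean_of_forall_inducesOrder {X : Set W} (hX : X.Finite) {π : Dual ℝ W}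
    (hπ : ∀ x ∈ X, π x = 1) (hall : ∀ b, IsStringOrder X b → ∃ g, InducesOrder X b g) :
    IsLean X := by
  classical
  intro b hb C hC2 hC
  by_contra! hge
  obtain ⟨g, hg⟩ := hall b hb
  have hbasis : ∀ t : ℝ, ∃ J : Set W, J ⊆ {x ∈ X | b x = t} ∧
      Submodule.span ℝ J = Submodule.span ℝ {x ∈ X | b x = t} ∧ LinearIndepOn ℝ id J :=
    fun t => exists_linearIndependent ℝ _
  choose J hJX hJspan hJli using hbasis
  have hJfin : ∀ t, (J t).Finite := fun t => hX.subset fun x hx => (hJX t hx).1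
  have hJne : ∀ t : C, ∃ x, x ∈ J t := fun t => by
    by_contra! hcon
    obtain ⟨x, hx, hbx⟩ := hC t t.2
    have h1 := hJspan t
    rw [Set.eq_empty_of_forall_notMem hcon, Submodule.span_empty] at h1
    have h2 : x ∈ Submodule.span ℝ {x ∈ X | b x = t} := Submodule.subset_span ⟨hx, hbx⟩
    rw [← h1, Submodule.mem_bot] at h2
    have := hπ x hx
    rw [h2, map_zero] at this
    exact zero_ne_one this
  choose x₀ hx₀ using hJne
  let σ := Σ t : C, {x // x ∈ (hJfin t).toFinset.erase (x₀ t)}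
  have hσJ : ∀ s : σ, s.2.1 ∈ J s.1 ∧ s.2.1 ≠ x₀ s.1 := fun s => by
    have := s.2.2
    rw [Finset.mem_erase, Set.Finite.mem_toFinset] at this
    exact this.symm
  have hcardJ : ∀ t : ℝ, (hJfin t).toFinset.card =
      finrank ℝ (Submodule.span ℝ {x ∈ X | b x = t}) := fun t => by
    rw [← hJspan t]
    have h1 : LinearIndepOn ℝ id ((hJfin t).toFinset : Set W) := by simpa using hJli t
    have h2 := finrank_span_finset_eq_card h1
    rw [Set.Finite.coe_toFinset] at h2
    exact h2.symm
  have hcard : (Fintype.card σ : ℤ) = ∑ t ∈ C,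
      ((finrank ℝ (Submodule.span ℝ {x ∈ X | b x = t}) : ℤ) - 1) := by
    rw [Fintype.card_sigma, Nat.cast_sum, ← Finset.sum_coe_sort C]
    refine Finset.sum_congr rfl fun t _ => ?_
    have hmem : x₀ t ∈ (hJfin t).toFinset := (hJfin t).mem_toFinset.2 (hx₀ t)
    have hpos := Finset.card_pos.2 ⟨_, hmem⟩
    rw [Fintype.card_coe, Finset.card_erase_of_mem hmem, hcardJ]
    rw [hcardJ] at hpos
    omega
  -- All directions within levels lie in `K`. Since `g` is not constant on `X`, the rank of `K` is
  -- at most that of `X` minus two.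
  set K := Submodule.span ℝ X ⊓ LinearMap.ker π ⊓ LinearMap.ker g with hK
  obtain ⟨t₁, ht₁, t₂, ht₂, ht12⟩ := Finset.one_lt_card.1 (by omega : 1 < C.card)
  obtain ⟨y₁, hy₁, hby₁⟩ := hC t₁ ht₁
  obtain ⟨y₂, hy₂, hby₂⟩ := hC t₂ ht₂
  have hgy : g y₁ ≠ g y₂ := by
    rcases lt_or_gt_of_ne ht12 with hlt | hlt
    · exact ((hg y₁ hy₁ y₂ hy₂).1 (by rw [hby₁, hby₂]; exact hlt)).ne
    · exact ((hg y₂ hy₂ y₁ hy₁).1 (by rw [hby₁, hby₂]; exact hlt)).ne'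
  have hK1 : K < Submodule.span ℝ X ⊓ LinearMap.ker π := by
    refine lt_of_le_of_ne inf_le_left fun heq => hgy ?_
    have : y₁ - y₂ ∈ K := by
      rw [heq]
      refine ⟨Submodule.sub_mem _ (Submodule.subset_span hy₁) (Submodule.subset_span hy₂), ?_⟩
      simp [hπ _ hy₁, hπ _ hy₂]
    have := this.2
    rw [SetLike.mem_coe, LinearMap.mem_ker, map_sub, sub_eq_zero] at this
    exact this
  have hK2 : Submodule.span ℝ X ⊓ LinearMap.ker π < Submodule.span ℝ X := by
    refine lt_of_le_of_ne inf_le_left fun heq => ?_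
    have : y₁ ∈ Submodule.span ℝ X := Submodule.subset_span hy₁
    rw [← heq] at this
    have h1 : π y₁ = 0 := this.2
    rw [hπ _ hy₁] at h1
    exact one_ne_zero h1
  have hr1 := Submodule.finrank_lt_finrank_of_lt hK1
  have hr2 := Submodule.finrank_lt_finrank_of_lt hK2
  have hσX : ∀ s : σ, s.2.1 ∈ X ∧ b s.2.1 = s.1 := fun s => hJX _ (hσJ s).1
  have h0X : ∀ t : C, x₀ t ∈ X ∧ b (x₀ t) = t := fun t => hJX _ (hx₀ t)
  let vec : σ → K := fun s => ⟨s.2.1 - x₀ s.1, ⟨Submodule.sub_mem _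
    (Submodule.subset_span (hσX s).1) (Submodule.subset_span (h0X s.1).1), by
      simp [hπ _ (hσX s).1, hπ _ (h0X s.1).1]⟩, by
      rw [SetLike.mem_coe, LinearMap.mem_ker, map_sub, sub_eq_zero]
      exact (hg _ (hσX s).1 _ (h0X s.1).1).2 ((hσX s).2.trans (h0X s.1).2.symm)⟩
  have hdep : ¬ LinearIndependent ℝ vec := fun hli => by
    have := hli.fintype_card_le_finrank
    omega
  rw [Fintype.not_linearIndependent_iff] at hdep
  obtain ⟨κ, hκ, s₀, hs₀⟩ := hdep
  replace hκ : ∑ s, κ s • (s.2.1 - x₀ s.1) = 0 := by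
    have := congrArg (Submodule.subtype K) hκ
    simpa [vec] using this
  -- Within each level, basis points are moved up or down relative to the base point `x₀ t`
  -- according to the signs of the coefficients of the linear relation.
  have hdual : ∀ t : ℝ, ∃ h : Dual ℝ W, ∀ ht : t ∈ C, h (x₀ ⟨t, ht⟩) = 0 ∧
      ∀ x : {x // x ∈ (hJfin t).toFinset.erase (x₀ ⟨t, ht⟩)},
        h x.1 = SignType.sign (κ ⟨⟨t, ht⟩, x⟩) := by
    intro t
    by_cases ht : t ∈ C
    · obtain ⟨h, hh⟩ := exists_dual_extending (hJli t) fun x =>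
        if hx : x ∈ (hJfin t).toFinset.erase (x₀ ⟨t, ht⟩) then
          ((SignType.sign (κ ⟨⟨t, ht⟩, ⟨x, hx⟩⟩) : SignType) : ℝ) else 0
      refine ⟨h, fun _ => ⟨?_, fun x => ?_⟩⟩
      · rw [hh _ (hx₀ ⟨t, ht⟩), dif_neg (by simp)]
      · rw [hh _ (hσJ ⟨⟨t, ht⟩, x⟩).1, dif_pos x.2]
    · exact ⟨0, fun h => absurd h ht⟩
  choose h hh using hdual
  obtain ⟨b', hb', hbb'⟩ := hb.refine hX hπ h
  obtain ⟨g', hg'⟩ := hall b' hb'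
  -- A functional inducing the refined order makes every nonzero term of the relation positive.
  have key : ∀ s : σ, 0 ≤ κ s * g' (s.2.1 - x₀ s.1) ∧
      (κ s ≠ 0 → 0 < κ s * g' (s.2.1 - x₀ s.1)) := by
    intro s
    have hs := hσX s
    have h0 := h0X s.1
    have e0 := (hh s.1 s.1.2).1
    have e1 := (hh s.1 s.1.2).2 s.2
    have e2 := hbb' _ hs.1 _ h0.1 (hs.2.trans h0.2.symm)
    have e3 := hbb' _ h0.1 _ hs.1 (h0.2.trans hs.2.symm)
    rw [hs.2, e0, e1] at e2
    rw [h0.2, e0, e1] at e3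
    rw [map_sub]
    rcases lt_trichotomy (κ s) 0 with hk | hk | hk
    · have hlt := (hg' _ hs.1 _ h0.1).1 (e2.1.2 (by simp [hk]))
      have := mul_pos_of_neg_of_neg hk (sub_neg.2 hlt)
      exact ⟨this.le, fun _ => this⟩
    · rw [hk, zero_mul]; exact ⟨le_rfl, fun h => absurd rfl h⟩
    · have hlt := (hg' _ h0.1 _ hs.1).1 (e3.1.2 (by simp [hk]))
      have := mul_pos hk (sub_pos.2 hlt)
      exact ⟨this.le, fun _ => this⟩
  have hsum := congrArg g' hκ
  rw [map_sum, map_zero] at hsum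
  simp only [map_smul, smul_eq_mul] at hsum
  have := Finset.sum_pos' (fun s _ => (key s).1) ⟨s₀, Finset.mem_univ _, (key s₀).2 hs₀⟩
  exact this.ne' hsum

end Refinement

/-! ### Faces and cellular strings of a zonotope in coefficients -/

section Faces

variable {V : Type*} [AddCommGroup V] [Module ℝ V] {ι : Type*} [Fintype ι] {p : V} {v : ι → V}

/-- The coefficients of a zonotope. -/
def IsUnit01 (t : ι → ℝ) : Prop := ∀ i, 0 ≤ t i ∧ t i ≤ 1

lemma mem_zonotope {t : ι → ℝ} (ht : IsUnit01 t) : p + ∑ i, t i • v i ∈ zonotope p v :=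
  ⟨t, ht, rfl⟩

/-- Membership in a face of a zonotope, in terms of any coefficients of the point. -/
lemma mem_minFace_iff {t : ι → ℝ} (ht : IsUnit01 t) (ψ : Dual ℝ V) :
    p + ∑ i, t i • v i ∈ minFace (zonotope p v) ψ ↔
      ∀ i, (0 < ψ (v i) → t i = 0) ∧ (ψ (v i) < 0 → t i = 1) := by
  classical
  have hval : ∀ t : ι → ℝ, ψ (p + ∑ i, t i • v i) = ψ p + ∑ i, t i * ψ (v i) := fun t => by simp
  constructor
  · rintro ⟨-, hmin⟩ i
    have key : ∀ r : ℝ, 0 ≤ r → r ≤ 1 → t i * ψ (v i) ≤ r * ψ (v i) := by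
      intro r h0 h1
      have := hmin _ (mem_zonotope (p := p) (v := v) (t := Function.update t i r) fun j => by
        by_cases hj : j = i
        · subst hj; simp [h0, h1]
        · simpa [Function.update_of_ne hj] using ht j)
      rw [hval, hval, add_le_add_iff_left, ← Finset.add_sum_erase _ _ (Finset.mem_univ i),
        ← Finset.add_sum_erase _ (fun j => Function.update t i r j * ψ (v j)) (Finset.mem_univ i),
        Function.update_self, Finset.sum_congr rfl fun j hj => by
          rw [← Function.update_of_ne (Finset.ne_of_mem_erase hj) r t]] at this
      linarith
    refine ⟨fun h => ?_, fun h => ?_⟩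
    · have := key 0 le_rfl zero_le_one
      have := (ht i).1
      by_contra hne
      have := mul_pos (lt_of_le_of_ne this (Ne.symm hne)) h
      linarith
    · have := key 1 zero_le_one le_rfl
      have h1 := (ht i).2
      by_contra hne
      have := mul_neg_of_pos_of_neg (sub_pos.2 (lt_of_le_of_ne h1 hne)) h
      linarith
  · refine fun h => ⟨mem_zonotope ht, ?_⟩
    rintro _ ⟨s, hs, rfl⟩
    rw [hval, hval, add_le_add_iff_left]
    refine Finset.sum_le_sum fun i _ => ?_
    rcases lt_trichotomy (ψ (v i)) 0 with h0 | h0 | h0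
    · rw [(h i).2 h0]; nlinarith [(hs i).2]
    · rw [h0, mul_zero, mul_zero]
    · rw [(h i).1 h0]; nlinarith [(hs i).1]

lemma minFace_congr {ψ ψ' : Dual ℝ V}
    (h : ∀ i, SignType.sign (ψ (v i)) = SignType.sign (ψ' (v i))) :
    minFace (zonotope p v) ψ = minFace (zonotope p v) ψ' := by
  have pos : ∀ i, (0 < ψ (v i) ↔ 0 < ψ' (v i)) ∧ (ψ (v i) < 0 ↔ ψ' (v i) < 0) := fun i => by
    rw [← sign_eq_one_iff, ← sign_eq_neg_one_iff, h i, sign_eq_one_iff, sign_eq_neg_one_iff]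
    exact ⟨Iff.rfl, Iff.rfl⟩
  ext x
  constructor
  · intro hx
    obtain ⟨t, ht, rfl⟩ := hx.1
    rw [mem_minFace_iff ht] at hx ⊢
    exact fun i => ⟨fun h => (hx i).1 ((pos i).1.2 h), fun h => (hx i).2 ((pos i).2.2 h)⟩
  · intro hx
    obtain ⟨t, ht, rfl⟩ := hx.1
    rw [mem_minFace_iff ht] at hx ⊢
    exact fun i => ⟨fun h => (hx i).1 ((pos i).1.1 h), fun h => (hx i).2 ((pos i).2.1 h)⟩

lemma minFace_eq_self {ψ : Dual ℝ V} (h : ∀ i, ψ (v i) = 0) :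
    minFace (zonotope p v) ψ = zonotope p v := by
  refine Set.Subset.antisymm (fun x hx => hx.1) ?_
  rintro _ ⟨t, ht, rfl⟩
  rw [mem_minFace_iff ht]
  exact fun i => ⟨fun h' => absurd (h i) h'.ne', fun h' => absurd (h i) h'.ne⟩

/-- A point of a minimal face with prescribed coefficients on the generators parallel to it. -/
lemma exists_coeff (ψ : Dual ℝ V) (r : ι → ℝ) (hr : IsUnit01 r) :
    ∃ t : ι → ℝ, IsUnit01 t ∧ (∀ i, ψ (v i) = 0 → t i = r i) ∧
      (∀ i, 0 < ψ (v i) → t i = 0) ∧ (∀ i, ψ (v i) < 0 → t i = 1) ∧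
      p + ∑ i, t i • v i ∈ minFace (zonotope p v) ψ := by
  classical
  let t : ι → ℝ := fun i => if 0 < ψ (v i) then 0 else if ψ (v i) < 0 then 1 else r i
  have ht : IsUnit01 t := fun i => by
    simp only [t]; split_ifs
    · simp
    · simp
    · exact hr i
  have h1 : ∀ i, 0 < ψ (v i) → t i = 0 := fun i h => if_pos h
  have h2 : ∀ i, ψ (v i) < 0 → t i = 1 := fun i h => by simp [t, h, h.not_gt]
  exact ⟨t, ht, fun i h => by simp [t, h], h1, h2, (mem_minFace_iff ht ψ).2 fun i => ⟨h1 i, h2 i⟩⟩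

/-- Coefficients of the other generators are fixed on the face, while those of generators killed by
`ψ` vary freely. -/
lemma dim_minFace (ψ : Dual ℝ V) :
    dim (minFace (zonotope p v) ψ) =
      finrank ℝ (Submodule.span ℝ {x | ∃ i, ψ (v i) = 0 ∧ v i = x}) := by
  classical
  have : vectorSpan ℝ (minFace (zonotope p v) ψ) =
      Submodule.span ℝ {x | ∃ i, ψ (v i) = 0 ∧ v i = x} := by
    apply le_antisymm
    · rw [vectorSpan_def, Submodule.span_le]
      rintro _ ⟨x, hx, y, hy, rfl⟩
      obtain ⟨t, ht, rfl⟩ := hx.1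
      obtain ⟨s, hs, rfl⟩ := hy.1
      rw [mem_minFace_iff ht] at hx
      rw [mem_minFace_iff hs] at hy
      have : (p + ∑ i, t i • v i) -ᵥ (p + ∑ i, s i • v i) = ∑ i, (t i - s i) • v i := by
        simp only [vsub_eq_sub, sub_smul, Finset.sum_sub_distrib]; abel
      dsimp only
      rw [this]
      refine Submodule.sum_mem _ fun i _ => ?_
      rcases lt_trichotomy (ψ (v i)) 0 with h | h | h
      · rw [(hx i).2 h, (hy i).2 h, sub_self, zero_smul]; exact Submodule.zero_mem _
      · exact Submodule.smul_mem _ _ (Submodule.subset_span ⟨i, h, rfl⟩)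
      · rw [(hx i).1 h, (hy i).1 h, sub_self, zero_smul]; exact Submodule.zero_mem _
    · rw [Submodule.span_le]
      rintro _ ⟨i, hi, rfl⟩
      obtain ⟨t, ht, h0, h1, h2, hmem⟩ := exists_coeff (p := p) (v := v) ψ (fun _ => 0)
        fun _ => by simp
      obtain ⟨s, hs, h0', h1', h2', hmem'⟩ := exists_coeff (p := p) (v := v) ψ
        (fun j => if j = i then 1 else 0) fun j => by dsimp only; split_ifs <;> simp
      have := vsub_mem_vectorSpan ℝ hmem' hmem
      have hst : ∀ j, s j - t j = if j = i then 1 else 0 := fun j => by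
        rcases lt_trichotomy (ψ (v j)) 0 with h | h | h
        · rw [h2 j h, h2' j h, if_neg (by rintro rfl; linarith), sub_self]
        · rw [h0 j h, h0' j h, sub_zero]
        · rw [h1 j h, h1' j h, if_neg (by rintro rfl; linarith), sub_self]
      have hv : (p + ∑ i, s i • v i) -ᵥ (p + ∑ i, t i • v i) = v i := by
        simp only [vsub_eq_sub, add_sub_add_left_eq_sub, ← Finset.sum_sub_distrib, ← sub_smul, hst]
        simp
      rwa [hv] at this
  rw [dim, this]

variable {π : Dual ℝ V}

/-- Compare with the point of the face whose free coefficients are all one: it dominates term by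
term in `π`, so a maximizer agrees with it in every term. -/
lemma coeff_eq_one_of_max (hπ : ∀ i, 0 < π (v i)) {t : ι → ℝ} (ht : IsUnit01 t) {ψ : Dual ℝ V}
    (hmem : p + ∑ i, t i • v i ∈ minFace (zonotope p v) ψ)
    (hmax : ∀ y ∈ minFace (zonotope p v) ψ, π y ≤ π (p + ∑ i, t i • v i)) (i : ι)
    (hi : ψ (v i) ≤ 0) : t i = 1 := by
  obtain ⟨s, hs, h0, h1, h2, hs'⟩ := exists_coeff (p := p) (v := v) ψ (fun _ => 1) fun _ => by simp
  have h := hmax _ hs'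
  rw [mem_minFace_iff ht] at hmem
  simp only [map_add, map_sum, map_smul, smul_eq_mul, add_le_add_iff_left] at h
  have hle : ∀ j ∈ Finset.univ, t j * π (v j) ≤ s j * π (v j) := fun j _ => by
    refine mul_le_mul_of_nonneg_right ?_ (hπ j).le
    rcases lt_trichotomy (ψ (v j)) 0 with h | h | h
    · rw [h2 j h]; exact (ht j).2
    · rw [h0 j h]; exact (ht j).2
    · rw [(hmem j).1 h]; exact (hs j).1
  have heq := (Finset.sum_eq_sum_iff_of_le hle).1 (le_antisymm (Finset.sum_le_sum hle) h) i
    (Finset.mem_univ i)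
  rw [mul_right_cancel₀ (hπ i).ne' heq]
  rcases hi.lt_or_eq with h | h
  · exact h2 i h
  · exact h0 i h

lemma coeff_eq_zero_of_min (hπ : ∀ i, 0 < π (v i)) {t : ι → ℝ} (ht : IsUnit01 t) {ψ : Dual ℝ V}
    (hmem : p + ∑ i, t i • v i ∈ minFace (zonotope p v) ψ)
    (hmin : ∀ y ∈ minFace (zonotope p v) ψ, π (p + ∑ i, t i • v i) ≤ π y) (i : ι)
    (hi : 0 ≤ ψ (v i)) : t i = 0 := by
  obtain ⟨s, hs, h0, h1, h2, hs'⟩ := exists_coeff (p := p) (v := v) ψ (fun _ => 0) fun _ => by simp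
  have h := hmin _ hs'
  rw [mem_minFace_iff ht] at hmem
  simp only [map_add, map_sum, map_smul, smul_eq_mul, add_le_add_iff_left] at h
  have hle : ∀ j ∈ Finset.univ, s j * π (v j) ≤ t j * π (v j) := fun j _ => by
    refine mul_le_mul_of_nonneg_right ?_ (hπ j).le
    rcases lt_trichotomy (ψ (v j)) 0 with h | h | h
    · rw [(hmem j).2 h]; exact (hs j).2
    · rw [h0 j h]; exact (ht j).1
    · rw [h1 j h]; exact (ht j).1
  have heq := (Finset.sum_eq_sum_iff_of_le hle).1 (le_antisymm (Finset.sum_le_sum hle) h) i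
    (Finset.mem_univ i)
  rw [← mul_right_cancel₀ (hπ i).ne' heq]
  rcases hi.lt_or_eq with h | h
  · exact h1 i h
  · exact h0 i h.symm

/-- The combinatorial type of a cellular string: each generator is assigned to the face parallel
to it. -/
lemma IsCellularString.exists_index (hπ : ∀ i, 0 < π (v i)) {l : ℕ} {F : Fin (l + 1) → Set V}
    (hF : IsCellularString (zonotope p v) π F) :
    ∃ (f : Fin (l + 1) → Dual ℝ V) (b : ι → Fin (l + 1)),
      (∀ k, F k = minFace (zonotope p v) (f k)) ∧
      ∀ i k, (k < b i → 0 < f k (v i)) ∧ (k = b i → f k (v i) = 0) ∧ (b i < k → f k (v i) < 0) := by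
  classical
  choose hne f hf using hF.isFace
  have hbot : ∀ i, 0 ≤ f 0 (v i) := by
    intro i
    obtain ⟨x, hx, hmin⟩ := hF.bottom
    rw [hf 0] at hx
    obtain ⟨t, ht, rfl⟩ := hx.1
    have h1 := (mem_minFace_iff ht π).1 ⟨hx.1, hmin⟩
    rw [mem_minFace_iff ht] at hx
    by_contra hneg
    have h2 := (hx i).2 (not_le.1 hneg)
    rw [(h1 i).1 (hπ i)] at h2
    exact zero_ne_one h2
  have htop : ∀ i, f (Fin.last l) (v i) ≤ 0 := by
    intro i
    obtain ⟨x, hx, hmax⟩ := hF.top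
    rw [hf (Fin.last l)] at hx
    obtain ⟨t, ht, rfl⟩ := hx.1
    have h1 := (mem_minFace_iff ht (-π)).1 ⟨hx.1, fun y hy => by simpa using hmax y hy⟩
    rw [mem_minFace_iff ht] at hx
    by_contra hneg
    have h2 := (hx i).1 (not_le.1 hneg)
    rw [(h1 i).2 (by simpa using hπ i)] at h2
    exact one_ne_zero h2
  -- The common vertex is the top of one cell and the bottom of the next. Computing its coefficients
  -- in both ways shows that a generator no longer positive on the first functional is already
  -- negative on the second.
  have hmeet : ∀ (k : Fin l) (i : ι), f k.castSucc (v i) ≤ 0 ↔ f k.succ (v i) < 0 := by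
    intro k i
    obtain ⟨w, -, hw, hmax, hmin⟩ := hF.meet k
    have hwmem : w ∈ F k.castSucc ∩ F k.succ := by rw [hw]; rfl
    rw [hf] at hmax hmin
    rw [hf, hf k.succ] at hwmem
    obtain ⟨t, ht, rfl⟩ := hwmem.1.1
    constructor
    · intro h
      by_contra h'
      have := coeff_eq_one_of_max hπ ht hwmem.1 hmax i h
      rw [coeff_eq_zero_of_min hπ ht hwmem.2 hmin i (not_lt.1 h')] at this
      exact zero_ne_one this
    · intro h
      by_contra h'
      have h1 := ((mem_minFace_iff ht _).1 hwmem.2 i).2 h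
      rw [((mem_minFace_iff ht _).1 hwmem.1 i).1 (not_le.1 h')] at h1
      exact zero_ne_one h1
  have hmono : ∀ (i : ι) (k k' : Fin (l + 1)), k < k' → f k (v i) ≤ 0 → f k' (v i) < 0 := by
    intro i k k'
    induction k' using Fin.induction with
    | zero => intro h; exact absurd h (Fin.not_lt_zero k)
    | succ j ih =>
      intro h hk
      refine (hmeet j i).1 ?_
      rcases (Fin.le_castSucc_iff.2 h).lt_or_eq with h' | h'
      · exact (ih h' hk).le
      · rwa [← h']
  have hex : ∀ i, ∃ k, f k (v i) = 0 := by
    intro i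
    by_contra! hcon
    have : ∀ k, 0 < f k (v i) := by
      intro k
      induction k using Fin.induction with
      | zero => exact lt_of_le_of_ne (hbot i) (hcon 0).symm
      | succ j ih =>
        refine lt_of_le_of_ne (not_lt.1 fun h => ?_) (hcon _).symm
        exact absurd ((hmeet j i).2 h) (not_le.2 ih)
    exact absurd (htop i) (not_le.2 (this _))
  choose b hb using hex
  refine ⟨f, b, hf, fun i k => ⟨fun h => ?_, fun h => h ▸ hb i, fun h => hmono i _ _ h (hb i).le⟩⟩
  by_contra h'
  have := hmono i _ _ h (not_lt.1 h')
  rw [hb i] at this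
  exact lt_irrefl _ this

/-- A string order on the generators gives rise to a cellular string. -/
lemma exists_cellularString (hπ : ∀ i, 0 < π (v i)) [Nonempty ι] {b : ι → ℝ}
    (hb : ∀ j, ∃ f : Dual ℝ V, ∀ i, SignType.sign (f (v i)) = SignType.sign (b i - b j)) :
    ∃ (l : ℕ) (c : Fin (l + 1) → ℝ) (f : Fin (l + 1) → Dual ℝ V),
      StrictMono c ∧ Set.range c = Set.range b ∧
      (∀ k i, SignType.sign (f k (v i)) = SignType.sign (b i - c k)) ∧
      IsCellularString (zonotope p v) π fun k => minFace (zonotope p v) (f k) := by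
  classical
  set s := Finset.univ.image b with hs
  obtain ⟨l, hl⟩ : ∃ l, s.card = l + 1 :=
    ⟨s.card - 1, by have := Finset.card_pos.2 (hs ▸ Finset.univ_nonempty.image b); omega⟩
  set c := s.orderEmbOfFin hl with hc
  have hrange : Set.range c = Set.range b := by
    rw [hc, Finset.range_orderEmbOfFin, hs, Finset.coe_image, Finset.coe_univ, Set.image_univ]
  have hcb : ∀ k, ∃ i, b i = c k := fun k => by
    have : c k ∈ Set.range b := hrange ▸ ⟨k, rfl⟩
    exact this
  have hbc : ∀ i, ∃ k, c k = b i := fun i => by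
    have : b i ∈ Set.range c := hrange ▸ ⟨i, rfl⟩
    exact this
  have hf : ∀ k, ∃ f : Dual ℝ V, ∀ i, SignType.sign (f (v i)) = SignType.sign (b i - c k) := by
    intro k
    obtain ⟨j, hj⟩ := hcb k
    rw [← hj]
    exact hb j
  choose f hf using hf
  have hpos : ∀ k i, (0 < f k (v i) ↔ c k < b i) ∧ (f k (v i) < 0 ↔ b i < c k) ∧
      (f k (v i) = 0 ↔ b i = c k) := fun k i => by
    rw [← sign_eq_one_iff, ← sign_eq_neg_one_iff, ← sign_eq_zero_iff, hf, sign_eq_one_iff,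
      sign_eq_neg_one_iff, sign_eq_zero_iff, sub_pos, sub_neg, sub_eq_zero]
    exact ⟨Iff.rfl, Iff.rfl, Iff.rfl⟩
  have hcmono : StrictMono c := c.strictMono
  have hzero : IsUnit01 (fun _ : ι => (0 : ℝ)) := fun _ => by simp
  have hone : IsUnit01 (fun _ : ι => (1 : ℝ)) := fun _ => by simp
  refine ⟨l, c, f, hcmono, hrange, hf, ?_, ?_, ?_, ?_, ?_⟩
  · intro k
    obtain ⟨t, -, -, -, -, ht⟩ := exists_coeff (p := p) (v := v) (f k) _ hzero
    exact ⟨⟨_, ht⟩, f k, rfl⟩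
  · right
    intro k
    obtain ⟨j, hj⟩ := hcb k
    obtain ⟨t, ht, h0, h1, h2, hmem⟩ := exists_coeff (p := p) (v := v) (f k) _ hzero
    obtain ⟨t', ht', h0', h1', h2', hmem'⟩ := exists_coeff (p := p) (v := v) (f k) _ hone
    refine ⟨_, hmem, _, hmem', fun heq => ?_⟩
    have hπeq := congrArg π heq
    simp only [map_add, map_sum, map_smul, smul_eq_mul, add_right_inj] at hπeq
    have hle : ∀ i ∈ Finset.univ, t i * π (v i) ≤ t' i * π (v i) := fun i _ => by
      refine mul_le_mul_of_nonneg_right ?_ (hπ i).le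
      rcases lt_trichotomy (f k (v i)) 0 with h | h | h
      · rw [h2 i h, h2' i h]
      · rw [h0 i h, h0' i h]; exact zero_le_one
      · rw [h1 i h, h1' i h]
    have := mul_right_cancel₀ (hπ j).ne'
      ((Finset.sum_eq_sum_iff_of_le hle).1 hπeq j (Finset.mem_univ j))
    have hfj := (hpos k j).2.2.2 hj
    rw [h0 j hfj, h0' j hfj] at this
    exact zero_ne_one this
  · refine ⟨p + ∑ i, (0 : ℝ) • v i, ?_, ?_⟩
    · rw [mem_minFace_iff hzero]
      refine fun i => ⟨fun _ => rfl, fun h => ?_⟩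
      obtain ⟨k, hk⟩ := hbc i
      have := (hpos 0 i).2.1.1 h
      rw [← hk] at this
      exact absurd (hcmono.lt_iff_lt.1 this) (Fin.not_lt_zero k)
    · exact ((mem_minFace_iff hzero π).2 fun i =>
        ⟨fun _ => rfl, fun h => absurd (hπ i) h.not_gt⟩).2
  · refine ⟨p + ∑ i, (1 : ℝ) • v i, ?_, ?_⟩
    · rw [mem_minFace_iff hone]
      refine fun i => ⟨fun h => ?_, fun _ => rfl⟩
      obtain ⟨k, hk⟩ := hbc i
      have := (hpos (Fin.last l) i).1.1 h
      rw [← hk] at this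
      exact absurd (hcmono.lt_iff_lt.1 this) (Fin.le_last k).not_gt
    · intro z hz
      have := ((mem_minFace_iff hone (-π)).2 fun i =>
        ⟨fun h => absurd (by simpa using h : π (v i) < 0) (hπ i).not_gt, fun _ => rfl⟩).2 z hz
      simpa using this
  · intro k
    obtain ⟨t, ht, h0, h1, h2, hmem⟩ := exists_coeff (p := p) (v := v) (f k.castSucc) _ hone
    have hck : c k.castSucc < c k.succ := hcmono (Fin.castSucc_lt_succ)
    -- The levels are enumerated increasingly, so none lies strictly between consecutive ones.
    have hgap : ∀ i, b i ≤ c k.castSucc ∨ c k.succ ≤ b i := by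
      intro i
      obtain ⟨k', hk'⟩ := hbc i
      rw [← hk', hcmono.le_iff_le, hcmono.le_iff_le]
      rcases le_or_gt k' k.castSucc with h | h
      · exact Or.inl h
      · exact Or.inr (Fin.castSucc_lt_iff_succ_le.1 h)
    have ht1 : ∀ i, b i ≤ c k.castSucc → t i = 1 := fun i h => by
      rcases h.lt_or_eq with h | h
      · exact h2 i ((hpos _ i).2.1.2 h)
      · exact h0 i ((hpos _ i).2.2.2 h)
    have ht0 : ∀ i, c k.succ ≤ b i → t i = 0 := fun i h => h1 i ((hpos _ i).1.2 (hck.trans_le h))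
    have hmem' : p + ∑ i, t i • v i ∈ minFace (zonotope p v) (f k.succ) := by
      rw [mem_minFace_iff ht]
      refine fun i => ⟨fun h => ht0 i ((hpos _ i).1.1 h).le, fun h => ht1 i ?_⟩
      exact (hgap i).resolve_right (not_le.2 ((hpos _ i).2.1.1 h))
    have hsum : ∀ i, (b i ≤ c k.castSucc → (f k.castSucc + f k.succ) (v i) < 0) ∧
        (c k.succ ≤ b i → 0 < (f k.castSucc + f k.succ) (v i)) := fun i => by
      constructor
      · intro h
        have h1 : f k.castSucc (v i) ≤ 0 :=
          not_lt.1 fun h' => absurd ((hpos _ i).1.1 h') (not_lt.2 h)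
        have h2 := (hpos k.succ i).2.1.2 (h.trans_lt hck)
        simp only [LinearMap.add_apply]; linarith
      · intro h
        have h1 : 0 ≤ f k.succ (v i) :=
          not_lt.1 fun h' => absurd ((hpos _ i).2.1.1 h') (not_lt.2 h)
        have h2 := (hpos k.castSucc i).1.2 (hck.trans_le h)
        simp only [LinearMap.add_apply]; linarith
    -- The sum of consecutive functionals vanishes on no generator, so it selects the single vertex
    -- with coefficient one on the levels up to `k` and zero on those after.
    have hface : minFace (zonotope p v) (f k.castSucc + f k.succ) = {p + ∑ i, t i • v i} := by
      ext x
      constructor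
      · intro hx
        obtain ⟨s, hs, rfl⟩ := hx.1
        rw [mem_minFace_iff hs] at hx
        have : s = t := by
          funext i
          rcases hgap i with h | h
          · rw [ht1 i h, (hx i).2 ((hsum i).1 h)]
          · rw [ht0 i h, (hx i).1 ((hsum i).2 h)]
        rw [this]; rfl
      · rintro rfl
        rw [mem_minFace_iff ht]
        refine fun i => ⟨fun h => ?_, fun h => ?_⟩
        · rcases hgap i with h' | h'
          · exact absurd ((hsum i).1 h') h.not_gt
          · exact ht0 i h'
        · rcases hgap i with h' | h'
          · exact ht1 i h'
          · exact absurd ((hsum i).2 h') h.not_gt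
    refine ⟨p + ∑ i, t i • v i, ⟨⟨_, rfl⟩, _, hface.symm⟩, ?_, ?_, ?_⟩
    · refine Set.Subset.antisymm ?_ ?_
      · rintro x ⟨hx1, hx2⟩
        rw [← hface]
        refine ⟨hx1.1, fun y hy => ?_⟩
        simp only [LinearMap.add_apply]
        exact add_le_add (hx1.2 y hy) (hx2.2 y hy)
      · rintro x rfl
        exact ⟨hmem, hmem'⟩
    · intro x hx
      obtain ⟨s, hs, rfl⟩ := hx.1
      rw [mem_minFace_iff hs] at hx
      simp only [map_add, map_sum, map_smul, smul_eq_mul, add_le_add_iff_left]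
      refine Finset.sum_le_sum fun i _ => mul_le_mul_of_nonneg_right ?_ (hπ i).le
      rcases hgap i with h | h
      · rw [ht1 i h]; exact (hs i).2
      · rw [ht0 i h, (hx i).1 ((hpos _ i).1.2 (hck.trans_le h))]
    · intro x hx
      obtain ⟨s, hs, rfl⟩ := hx.1
      rw [mem_minFace_iff hs] at hx
      simp only [map_add, map_sum, map_smul, smul_eq_mul, add_le_add_iff_left]
      refine Finset.sum_le_sum fun i _ => mul_le_mul_of_nonneg_right ?_ (hπ i).le
      rcases hgap i with h | h
      · rw [ht1 i h, (hx i).2 ((hpos _ i).2.1.2 (h.trans_lt hck))]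
      · rw [ht0 i h]; exact (hs i).1

end Faces

/-! ### From cellular strings to string orders on the point configuration -/

section Translation

variable {V : Type*} [AddCommGroup V] [Module ℝ V] {ι : Type*} {p : V} {v : ι → V}
  {π : Dual ℝ V}

/-- The generators scaled to the hyperplane `π = 1`. -/
noncomputable def scaled (v : ι → V) (π : Dual ℝ V) (i : ι) : V := (π (v i))⁻¹ • v i

lemma smul_scaled (hπ : ∀ i, 0 < π (v i)) (i : ι) : π (v i) • scaled v π i = v i :=
  smul_inv_smul₀ (hπ i).ne' _

lemma apply_scaled (hπ : ∀ i, 0 < π (v i)) (i : ι) : π (scaled v π i) = 1 := by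
  rw [scaled, map_smul, smul_eq_mul, inv_mul_cancel₀ (hπ i).ne']

lemma apply_eq_mul_scaled (hπ : ∀ i, 0 < π (v i)) (f : Dual ℝ V) (i : ι) :
    f (v i) = π (v i) * f (scaled v π i) := by
  conv_lhs => rw [← smul_scaled hπ i]
  rw [map_smul, smul_eq_mul]

lemma sign_apply_scaled (hπ : ∀ i, 0 < π (v i)) (f : Dual ℝ V) (i : ι) :
    SignType.sign (f (v i)) = SignType.sign (f (scaled v π i)) := by
  rw [apply_eq_mul_scaled hπ, sign_mul, sign_pos (hπ i), one_mul]

lemma pointConfig_eq_range (hπ : ∀ i, 0 < π (v i)) :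
    pointConfig v π = Set.range (scaled v π) := by
  ext x
  simp only [pointConfig, Set.mem_iUnion]
  constructor
  · rintro ⟨i, ⟨t, rfl⟩, h⟩
    refine ⟨i, ?_⟩
    rw [map_smul, smul_eq_mul] at h
    rw [scaled, eq_inv_of_mul_eq_one_left h]
  · rintro ⟨i, rfl⟩
    exact ⟨i, ⟨_, rfl⟩, apply_scaled hπ i⟩

lemma apply_of_mem_pointConfig {x : V} (hx : x ∈ pointConfig v π) : π x = 1 := by
  simp only [pointConfig, Set.mem_iUnion] at hx
  obtain ⟨i, -, h⟩ := hx
  exact h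

lemma span_level (hπ : ∀ i, 0 < π (v i)) (P : V → Prop) :
    Submodule.span ℝ {x ∈ pointConfig v π | P x} =
      Submodule.span ℝ {x | ∃ i, P (scaled v π i) ∧ v i = x} := by
  apply le_antisymm <;> rw [Submodule.span_le]
  · rintro x ⟨hx, hP⟩
    rw [pointConfig_eq_range hπ] at hx
    obtain ⟨i, rfl⟩ := hx
    exact Submodule.smul_mem _ _ (Submodule.subset_span ⟨i, hP, rfl⟩)
  · rintro _ ⟨i, hi, rfl⟩
    rw [← smul_scaled hπ i]
    refine Submodule.smul_mem _ _ (Submodule.subset_span ⟨?_, hi⟩)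
    rw [pointConfig_eq_range hπ]
    exact ⟨i, rfl⟩

/-- Generators with the same scaled point are killed by the same `f k`, so the index descends to the
point configuration. -/
lemma exists_stringOrder_of_index (hπ : ∀ i, 0 < π (v i)) {l : ℕ} {f : Fin (l + 1) → Dual ℝ V}
    {b : ι → Fin (l + 1)} (hf : ∀ i k, (k < b i → 0 < f k (v i)) ∧ (k = b i → f k (v i) = 0) ∧
      (b i < k → f k (v i) < 0)) :
    ∃ β : V → ℝ, (∀ i, β (scaled v π i) = (b i : ℕ)) ∧ IsStringOrder (pointConfig v π) β := by
  have hfac : (fun i => ((b i : ℕ) : ℝ)).FactorsThrough (scaled v π) := by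
    intro i j hij
    have h1 := (hf i (b i)).2.1 rfl
    rw [apply_eq_mul_scaled hπ, hij] at h1
    have h2 : f (b i) (v j) = 0 := by
      rw [apply_eq_mul_scaled hπ, (mul_eq_zero.1 h1).resolve_left (hπ i).ne', mul_zero]
    have : b i = b j := by
      rcases lt_trichotomy (b i) (b j) with h | h | h
      · exact absurd h2 ((hf j _).1 h).ne'
      · exact h
      · exact absurd h2 ((hf j _).2.2 h).ne
    simp only [this]
  have hβ : ∀ i, Function.extend (scaled v π) (fun i => ((b i : ℕ) : ℝ)) 0 (scaled v π i) =
      (b i : ℕ) := fun i => hfac.extend_apply _ i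
  refine ⟨_, hβ, fun y hy => ?_⟩
  rw [pointConfig_eq_range hπ] at hy
  obtain ⟨j, rfl⟩ := hy
  refine ⟨f (b j), fun x hx => ?_⟩
  rw [pointConfig_eq_range hπ] at hx
  obtain ⟨i, rfl⟩ := hx
  rw [hβ, hβ, ← sign_apply_scaled hπ]
  rcases lt_trichotomy (b j) (b i) with h | h | h
  · rw [sign_pos ((hf i _).1 h), sign_pos (sub_pos.2 (by exact_mod_cast h))]
  · rw [(hf i _).2.1 h, h, sub_self]
  · rw [sign_neg ((hf i _).2.2 h), sign_neg (sub_neg.2 (by exact_mod_cast h))]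

/-- On a fiber of `π` the two functionals differ by a constant. As the face meets this fiber,
minimizing on the fiber reaches the global minimum of `f`. -/
lemma minFace_inter_fiber {Z : Set V} {f g : Dual ℝ V} {t : ℝ} (hfg : f = g - t • π) {q : ℝ}
    (hq : q ∈ π '' minFace Z f) :
    minFace (Z ∩ π ⁻¹' {q}) g = minFace Z f ∩ π ⁻¹' {q} := by
  obtain ⟨y, hy, hyq⟩ := hq
  have hval : ∀ x, π x = q → g x = f x + t * q := fun x hx => by simp [hfg, hx]
  ext x
  constructor
  · rintro ⟨⟨hxZ, hxq⟩, hx⟩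
    refine ⟨⟨hxZ, fun z hz => ?_⟩, hxq⟩
    have h1 := hx y ⟨hy.1, hyq⟩
    rw [hval x hxq, hval y hyq] at h1
    linarith [hy.2 z hz]
  · rintro ⟨hx, hxq⟩
    refine ⟨⟨hx.1, hxq⟩, fun z hz => ?_⟩
    rw [hval x hxq, hval z hz.2]
    linarith [hx.2 z hz.1]

variable [Fintype ι]

/-- A cell to which no generator is parallel has all coefficients fixed, so it would be a point. -/
lemma surjective_of_nontrivial {l : ℕ} {F : Fin (l + 1) → Set V} (hnt : ∀ k, (F k).Nontrivial)
    {f : Fin (l + 1) → Dual ℝ V} (hFf : ∀ k, F k = minFace (zonotope p v) (f k))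
    {b : ι → Fin (l + 1)} (hf : ∀ i k, (k < b i → 0 < f k (v i)) ∧ (k = b i → f k (v i) = 0) ∧
      (b i < k → f k (v i) < 0)) : Function.Surjective b := by
  intro k
  by_contra! hcon
  obtain ⟨x, hx, y, hy, hxy⟩ := hnt k
  rw [hFf k] at hx hy
  obtain ⟨t, ht, rfl⟩ := hx.1
  obtain ⟨s, hs, rfl⟩ := hy.1
  rw [mem_minFace_iff ht] at hx
  rw [mem_minFace_iff hs] at hy
  have : t = s := by
    funext i
    rcases lt_or_gt_of_ne (hcon i) with h | h
    · have := (hf i k).2.2 h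
      rw [(hx i).2 this, (hy i).2 this]
    · have := (hf i k).1 h
      rw [(hx i).1 this, (hy i).1 this]
  exact hxy (by rw [this])

/-- If `g` induces the order, then `g` minus its value at a level times `π` has the signs of that
level's functional, so it cuts out the same cell. On fibers of `π` this is minimization of `g`. -/
theorem allCoherent_of_forall_inducesOrder (hπ : ∀ i, 0 < π (v i))
    (hall : ∀ b, IsStringOrder (pointConfig v π) b → ∃ g, InducesOrder (pointConfig v π) b g) :
    AllCoherent (zonotope p v) π := by
  intro l F hF
  rcases hF.nontrivial with ⟨-, htriv⟩ | hnt
  · refine ⟨0, fun i q _ => ?_⟩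
    rw [htriv i]
    exact Set.Subset.antisymm (fun x hx => hx.1) fun x hx => ⟨hx, fun y _ => by simp⟩
  obtain ⟨f, b, hFf, hf⟩ := hF.exists_index hπ
  obtain ⟨β, hβ, hstr⟩ := exists_stringOrder_of_index hπ hf
  obtain ⟨g, hg⟩ := hall β hstr
  have hmem : ∀ i, scaled v π i ∈ pointConfig v π := fun i => by
    rw [pointConfig_eq_range hπ]; exact ⟨i, rfl⟩
  have hsurj := surjective_of_nontrivial hnt hFf hf
  refine ⟨g, fun k q hq => ?_⟩
  obtain ⟨j, hj⟩ := hsurj k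
  have hface : F k = minFace (zonotope p v) (g - g (scaled v π j) • π) := by
    rw [hFf k]
    refine minFace_congr fun i => ?_
    rw [sign_apply_scaled hπ (g - _)]
    simp only [LinearMap.sub_apply, LinearMap.smul_apply, smul_eq_mul, apply_scaled hπ i, mul_one]
    have h1 := hg _ (hmem i) _ (hmem j)
    have h2 := hg _ (hmem j) _ (hmem i)
    rw [hβ, hβ] at h1 h2
    subst hj
    rcases lt_trichotomy (b j) (b i) with h | h | h
    · rw [sign_pos ((hf i _).1 h), sign_pos (sub_pos.2 (h2.1 (by exact_mod_cast h)))]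
    · rw [(hf i _).2.1 h, h1.2 (by rw [h]), sub_self]
    · rw [sign_neg ((hf i _).2.2 h), sign_neg (sub_neg.2 (h1.1 (by exact_mod_cast h)))]
  rw [hface] at hq ⊢
  exact minFace_inter_fiber rfl hq

/-- The functional `ψ` witnessing coherence already induces the order. If generator `i` is not later
than `j`, the cell of `i` has a point with full coefficient at `i` and zero at `j`; shifting weight
from `i` to `j` within the fiber cannot decrease `ψ`. -/
theorem AllCoherent.exists_inducesOrder (hπ : ∀ i, 0 < π (v i))
    (h : AllCoherent (zonotope p v) π) {b : V → ℝ} (hb : IsStringOrder (pointConfig v π) b) :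
    ∃ g, InducesOrder (pointConfig v π) b g := by
  classical
  have hmem : ∀ i, scaled v π i ∈ pointConfig v π := fun i => by
    rw [pointConfig_eq_range hπ]; exact ⟨i, rfl⟩
  rcases isEmpty_or_nonempty ι with hι | hι
  · refine ⟨0, fun x hx => ?_⟩
    rw [pointConfig_eq_range hπ] at hx
    obtain ⟨i, -⟩ := hx
    exact hι.elim i
  obtain ⟨l, c, f, hc, hrange, hf, hF⟩ := exists_cellularString (p := p) hπ
    (b := fun i => b (scaled v π i)) fun j => by
      obtain ⟨f, hf⟩ := hb _ (hmem j)
      exact ⟨f, fun i => by rw [sign_apply_scaled hπ, hf _ (hmem i)]⟩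
  obtain ⟨ψ, hψ⟩ := h l _ hF
  have hpos : ∀ k i, (0 < f k (v i) ↔ c k < b (scaled v π i)) ∧
      (f k (v i) < 0 ↔ b (scaled v π i) < c k) ∧
      (f k (v i) = 0 ↔ b (scaled v π i) = c k) := fun k i => by
    rw [← sign_eq_one_iff, ← sign_eq_neg_one_iff, ← sign_eq_zero_iff, hf, sign_eq_one_iff,
      sign_eq_neg_one_iff, sign_eq_zero_iff, sub_pos, sub_neg, sub_eq_zero]
    exact ⟨Iff.rfl, Iff.rfl, Iff.rfl⟩
  -- exchanging small multiples of two generators stays in the fiber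
  have main : ∀ i j, b (scaled v π i) ≤ b (scaled v π j) →
      ψ (scaled v π i) ≤ ψ (scaled v π j) ∧ (b (scaled v π i) < b (scaled v π j) →
        ψ (scaled v π i) < ψ (scaled v π j)) := by
    intro i j hij
    by_cases hne : i = j
    · subst hne
      exact ⟨le_rfl, fun h => absurd h (lt_irrefl _)⟩
    obtain ⟨k, hk⟩ : b (scaled v π i) ∈ Set.range c := hrange ▸ ⟨i, rfl⟩
    have hfi := (hpos k i).2.2.2 hk.symm
    have hfj : 0 ≤ f k (v j) := not_lt.1 fun h' => by
      have := (hpos k j).2.1.1 h'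
      rw [hk] at this
      exact absurd this (not_lt.2 hij)
    obtain ⟨t, ht, h0, h1, h2, hmemt⟩ := exists_coeff (p := p) (v := v) (f k)
      (fun n => if n = i then 1 else 0) fun n => by dsimp only; split_ifs <;> simp
    have hti : t i = 1 := by rw [h0 i hfi, if_pos rfl]
    have htj : t j = 0 := by
      rcases hfj.lt_or_eq with h | h
      · exact h1 j h
      · rw [h0 j h.symm, if_neg (Ne.symm hne)]
    -- The amount of `π`-height to be exchanged, small enough to keep both coefficients in the unit
    -- interval.
    set m := min (π (v i)) (π (v j)) with hm
    have hm0 : 0 < m := lt_min (hπ i) (hπ j)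
    let s : ι → ℝ := fun n => t n - (if n = i then m / π (v i) else 0) +
      (if n = j then m / π (v j) else 0)
    have hsi : s i = 1 - m / π (v i) := by simp [s, hti, hne]
    have hsj : s j = m / π (v j) := by simp [s, htj, Ne.symm hne]
    have hsn : ∀ n, n ≠ i → n ≠ j → s n = t n := fun n h h' => by simp [s, h, h']
    have hs : IsUnit01 s := by
      intro n
      by_cases hni : n = i
      · subst hni
        rw [hsi]
        have h1 : m / π (v n) ≤ 1 := (div_le_one (hπ n)).2 (min_le_left _ _)
        have h2 : 0 < m / π (v n) := div_pos hm0 (hπ n)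
        constructor <;> linarith
      by_cases hnj : n = j
      · subst hnj
        rw [hsj]
        exact ⟨(div_pos hm0 (hπ n)).le, (div_le_one (hπ n)).2 (min_le_right _ _)⟩
      rw [hsn n hni hnj]
      exact ht n
    have hval : ∀ φ : Dual ℝ V, φ (p + ∑ n, s n • v n) = φ (p + ∑ n, t n • v n) +
        m * (φ (scaled v π j) - φ (scaled v π i)) := by
      intro φ
      simp only [map_add, map_sum, map_smul, smul_eq_mul, s, add_mul, sub_mul,
        Finset.sum_add_distrib, Finset.sum_sub_distrib, ite_mul, zero_mul, Finset.sum_ite_eq',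
        Finset.mem_univ, if_true]
      rw [apply_eq_mul_scaled hπ φ i, apply_eq_mul_scaled hπ φ j]
      have := (hπ i).ne'
      have := (hπ j).ne'
      field_simp
      ring
    have hq := hψ k _ ⟨_, hmemt, rfl⟩
    have hymem : p + ∑ n, t n • v n ∈ minFace (zonotope p v ∩ π ⁻¹' {π (p + ∑ n, t n • v n)}) ψ := by
      rw [hq]; exact ⟨hmemt, rfl⟩
    have hsfib : p + ∑ n, s n • v n ∈ zonotope p v ∩ π ⁻¹' {π (p + ∑ n, t n • v n)} := by
      refine ⟨mem_zonotope hs, ?_⟩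
      rw [Set.mem_preimage, Set.mem_singleton_iff, hval, apply_scaled hπ, apply_scaled hπ, sub_self,
        mul_zero, add_zero]
    have hle := hymem.2 _ hsfib
    rw [hval] at hle
    have hle' : ψ (scaled v π i) ≤ ψ (scaled v π j) := by
      by_contra hcon
      have := mul_neg_of_pos_of_neg hm0 (sub_neg.2 (not_le.1 hcon))
      linarith
    refine ⟨hle', fun hlt => lt_of_le_of_ne hle' fun heq => ?_⟩
    -- If the two values of `ψ` were equal, the shifted point would also be a minimizer and hence
    -- lie in the cell. But the cell has coefficient zero at the later generator `j`.
    have hsmem : p + ∑ n, s n • v n ∈ minFace (zonotope p v) (f k) := by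
      have : p + ∑ n, s n • v n ∈
          minFace (zonotope p v ∩ π ⁻¹' {π (p + ∑ n, t n • v n)}) ψ := by
        refine ⟨hsfib, fun z hz => ?_⟩
        rw [hval, heq, sub_self, mul_zero, add_zero]
        exact hymem.2 z hz
      rw [hq] at this
      exact this.1
    rw [mem_minFace_iff hs] at hsmem
    have := (hsmem j).1 ((hpos k j).1.2 (by rw [hk]; exact hlt))
    rw [hsj] at this
    exact (div_pos hm0 (hπ j)).ne' this
  refine ⟨ψ, fun x hx y hy => ?_⟩
  rw [pointConfig_eq_range hπ] at hx hy
  obtain ⟨i, rfl⟩ := hx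
  obtain ⟨j, rfl⟩ := hy
  exact ⟨fun h => (main i j h.le).2 h, fun h => le_antisymm (main i j h.le).1 (main j i h.ge).1⟩

lemma finite_pointConfig (hπ : ∀ i, 0 < π (v i)) : (pointConfig v π).Finite := by
  rw [pointConfig_eq_range hπ]; exact Set.finite_range _

lemma dim_zonotope (hπ : ∀ i, 0 < π (v i)) :
    dim (zonotope p v) = finrank ℝ (Submodule.span ℝ (pointConfig v π)) := by
  have h1 := dim_minFace (p := p) (v := v) 0
  rw [minFace_eq_self fun _ => rfl] at h1
  have h2 : {x ∈ pointConfig v π | True} = pointConfig v π := by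
    ext x; simp
  have h3 : {x | ∃ i, (0 : Dual ℝ V) (v i) = 0 ∧ v i = x} = {x | ∃ i, True ∧ v i = x} := by
    ext x; simp
  rw [h1, h3, ← span_level hπ fun _ => True, h2]

variable [FiniteDimensional ℝ V]

/-- Cells correspond to levels, with cell dimension equal to the rank of the level, and properness
to the presence of at least two levels. -/
theorem isLean_pointConfig_iff (hπ : ∀ i, 0 < π (v i)) :
    IsLean (pointConfig v π) ↔ ¬ ∃ (l : ℕ) (F : Fin (l + 1) → Set V),
      IsCellularString (zonotope p v) π F ∧ IsProper (zonotope p v) F ∧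
      ∑ i, ((dim (F i) : ℤ) - 1) ≥ (dim (zonotope p v) : ℤ) - 1 := by
  classical
  have hmem : ∀ i, scaled v π i ∈ pointConfig v π := fun i => by
    rw [pointConfig_eq_range hπ]; exact ⟨i, rfl⟩
  rw [dim_zonotope hπ]
  constructor
  · rintro hL ⟨l, F, hF, hproper, hsum⟩
    obtain ⟨f, b, hFf, hf⟩ := hF.exists_index hπ
    obtain ⟨β, hβ, hstr⟩ := exists_stringOrder_of_index hπ hf
    have hnt : ∀ i, (F i).Nontrivial := hF.nontrivial.resolve_left hproper
    have hl : l ≠ 0 := by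
      rintro rfl
      refine hproper ⟨rfl, fun k => ?_⟩
      rw [hFf k]
      exact minFace_eq_self fun i => (hf i k).2.1 (Subsingleton.elim (α := Fin 1) _ _)
    have hsurj := surjective_of_nontrivial hnt hFf hf
    let cast : Fin (l + 1) ↪ ℝ := ⟨fun k => ((k : ℕ) : ℝ), fun k k' h => by
      simpa [Fin.ext_iff] using h⟩
    have := hL β hstr (Finset.univ.map cast) (by simp; omega) (by
      intro t ht
      simp only [Finset.mem_map, Finset.mem_univ, true_and] at ht
      obtain ⟨k, rfl⟩ := ht
      obtain ⟨i, rfl⟩ := hsurj k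
      exact ⟨_, hmem i, hβ i⟩)
    rw [Finset.sum_map] at this
    refine absurd hsum (not_le.2 (lt_of_eq_of_lt ?_ this))
    refine Finset.sum_congr rfl fun k _ => ?_
    rw [span_level hπ fun x => β x = cast k, hFf k, dim_minFace]
    have : {x | ∃ i, f k (v i) = 0 ∧ v i = x} =
        {x | ∃ i, β (scaled v π i) = cast k ∧ v i = x} := by
      ext x
      refine exists_congr fun i => and_congr_left fun _ => ?_
      rw [hβ, show ((b i : ℕ) : ℝ) = cast (b i) from rfl, cast.injective.eq_iff]
      refine ⟨fun h => ?_, fun h => (hf i k).2.1 h.symm⟩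
      rcases lt_trichotomy (b i) k with h' | h' | h'
      · exact absurd h ((hf i k).2.2 h').ne
      · exact h'
      · exact absurd h ((hf i k).1 h').ne'
    rw [this]
  · intro hcon b hb C hC2 hC
    by_contra! hge
    refine hcon ?_
    obtain ⟨t₀, ht₀⟩ := Finset.card_pos.1 (by omega : 0 < C.card)
    obtain ⟨x₀, hx₀, -⟩ := hC t₀ ht₀
    rw [pointConfig_eq_range hπ] at hx₀
    obtain ⟨i₀, -⟩ := hx₀
    have : Nonempty ι := ⟨i₀⟩
    obtain ⟨l, c, f, hc, hrange, hf, hF⟩ := exists_cellularString (p := p) hπ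
      (b := fun i => b (scaled v π i)) fun j => by
        obtain ⟨f, hf⟩ := hb _ (hmem j)
        exact ⟨f, fun i => by rw [sign_apply_scaled hπ, hf _ (hmem i)]⟩
    let ce : Fin (l + 1) ↪ ℝ := ⟨c, hc.injective⟩
    have hCsub : C ⊆ Finset.univ.map ce := by
      intro t ht
      obtain ⟨x, hx, rfl⟩ := hC t ht
      rw [pointConfig_eq_range hπ] at hx
      obtain ⟨i, rfl⟩ := hx
      obtain ⟨k, hk⟩ : b (scaled v π i) ∈ Set.range c := hrange ▸ ⟨i, rfl⟩
      exact Finset.mem_map.2 ⟨k, Finset.mem_univ _, hk⟩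
    have hlcard := Finset.card_le_card hCsub
    rw [Finset.card_map, Finset.card_univ, Fintype.card_fin] at hlcard
    refine ⟨l, _, hF, fun h => by omega, ?_⟩
    have hdim : ∀ k, dim (minFace (zonotope p v) (f k)) =
        finrank ℝ (Submodule.span ℝ {x ∈ pointConfig v π | b x = c k}) := by
      intro k
      rw [dim_minFace, span_level hπ fun x => b x = c k]
      have : {x | ∃ i, f k (v i) = 0 ∧ v i = x} =
          {x | ∃ i, b (scaled v π i) = c k ∧ v i = x} := by
        ext x
        refine exists_congr fun i => and_congr_left fun _ => ?_
        rw [← sign_eq_zero_iff, hf, sign_eq_zero_iff, sub_eq_zero]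
      rw [this]
    refine ge_iff_le.2 (hge.trans ?_)
    have hsum : ∑ k, ((dim (minFace (zonotope p v) (f k)) : ℤ) - 1) = ∑ k,
        ((finrank ℝ (Submodule.span ℝ {x ∈ pointConfig v π | b x = ce k}) : ℤ) - 1) :=
      Finset.sum_congr rfl fun k _ => by rw [hdim k]; rfl
    rw [hsum]
    have hmap := Finset.sum_map Finset.univ ce fun t =>
      ((finrank ℝ (Submodule.span ℝ {x ∈ pointConfig v π | b x = t}) : ℤ) - 1)
    -- The set `C` may omit levels. Each omitted level is nonempty, has rank at least one, and
    -- contributes a nonnegative term.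
    refine (Finset.sum_le_sum_of_subset_of_nonneg hCsub fun t ht _ => ?_).trans hmap.le
    obtain ⟨k, -, rfl⟩ := Finset.mem_map.1 ht
    obtain ⟨i, hi⟩ : c k ∈ Set.range fun i => b (scaled v π i) := hrange ▸ ⟨k, rfl⟩
    have h1 := one_le_finrank_span (S := {x ∈ pointConfig v π | b x = ce k})
      (x := scaled v π i) ⟨hmem i, hi⟩ fun h => by
        have := apply_scaled hπ i
        rw [h, map_zero] at this
        exact zero_ne_one this
    have : (1 : ℤ) ≤ finrank ℝ (Submodule.span ℝ {x ∈ pointConfig v π | b x = ce k}) := by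
      exact_mod_cast h1
    linarith

end Translation

/-! ### Reduction to generators on which the functional is positive -/

section Reduction

variable {V : Type*} [AddCommGroup V] [Module ℝ V] {ι : Type*} [Fintype ι]

lemma zonotope_restrict (p : V) (v : ι → V) [Fintype {i // v i ≠ 0}] :
    zonotope p v = zonotope p fun i : {i // v i ≠ 0} => v i := by
  classical
  have hsum : ∀ t : ι → ℝ, ∑ i, t i • v i = ∑ i : {i // v i ≠ 0}, t i • v i := fun t => by
    rw [← Finset.sum_filter_of_ne (p := fun i => v i ≠ 0)
      fun i _ h h0 => h (by rw [h0, smul_zero])]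
    exact (Finset.sum_subtype _ (by simp) fun i => t i • v i)
  ext x
  constructor
  · rintro ⟨t, ht, rfl⟩
    exact ⟨fun i => t i, fun i => ht i, by rw [hsum]⟩
  · rintro ⟨t, ht, rfl⟩
    refine ⟨fun i => if h : v i ≠ 0 then t ⟨i, h⟩ else 0, fun i => ?_, ?_⟩
    · dsimp only
      split_ifs with h
      · exact ht _
      · exact ⟨le_rfl, zero_le_one⟩
    · rw [hsum]
      congr 1
      exact Finset.sum_congr rfl fun i _ => by rw [dif_pos i.2]

/-- Reversing a generator replaces its coefficient `t` by `1 - t` and shifts the base point. -/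
lemma zonotope_flip (p : V) (v : ι → V) (P : ι → Prop) [DecidablePred P] :
    zonotope p v =
      zonotope (p + ∑ i, if P i then v i else 0) fun i => if P i then -v i else v i := by
  have hsum : ∀ t : ι → ℝ, ∑ i, t i • v i = (∑ i, if P i then v i else 0) +
      ∑ i, (if P i then 1 - t i else t i) • (if P i then -v i else v i) := fun t => by
    rw [← Finset.sum_add_distrib]
    refine Finset.sum_congr rfl fun i _ => ?_
    split_ifs
    · module
    · rw [zero_add]
  have hmem : ∀ t : ι → ℝ, (∀ i, 0 ≤ t i ∧ t i ≤ 1) → ∀ i,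
      0 ≤ (if P i then 1 - t i else t i) ∧ (if P i then 1 - t i else t i) ≤ 1 := fun t ht i => by
    have := ht i
    split_ifs <;> constructor <;> linarith
  ext x
  constructor
  · rintro ⟨t, ht, rfl⟩
    exact ⟨_, hmem t ht, by rw [hsum, add_assoc]⟩
  · rintro ⟨t, ht, rfl⟩
    refine ⟨_, hmem t ht, ?_⟩
    rw [hsum, add_assoc]
    congr 2
    refine Finset.sum_congr rfl fun i _ => ?_
    by_cases h : P i <;> simp [h]

/-- Discarding zero generators and reversing some of the others makes `π` positive on all of
them, without changing the zonotope or its point configuration. -/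
theorem IsGeneric.exists_pos {v : ι → V} {π : Dual ℝ V} (hπ : IsGeneric v π) (p : V) :
    ∃ (s : Finset ι) (p' : V) (v' : s → V), (∀ i, 0 < π (v' i)) ∧
      zonotope p v = zonotope p' v' ∧ pointConfig v π = pointConfig v' π := by
  classical
  let s : Finset ι := Finset.univ.filter fun i => v i ≠ 0
  have hs : ∀ i, i ∈ s ↔ v i ≠ 0 := by simp [s]
  let ε : {i // v i ≠ 0} ≃ s := Equiv.subtypeEquivRight fun i => (hs i).symm
  let P : s → Prop := fun i => π (v i) < 0
  refine ⟨s, p + ∑ i : s, if P i then v i else 0, fun i => if P i then -v i else v i,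
    fun i => ?_, ?_, ?_⟩
  · dsimp only
    split_ifs with h
    · rw [map_neg]; exact neg_pos.2 h
    · exact lt_of_le_of_ne (not_lt.1 h) (hπ i ((hs i).1 i.2)).symm
  · rw [← zonotope_flip p (fun i : s => v i), zonotope_restrict]
    ext x
    constructor
    · rintro ⟨t, ht, rfl⟩
      exact ⟨t ∘ ε.symm, fun i => ht _, by
        rw [← ε.sum_comp]; simp only [Function.comp_apply, ε.symm_apply_apply]; rfl⟩
    · rintro ⟨t, ht, rfl⟩
      exact ⟨t ∘ ε, fun i => ht _, by rw [← ε.sum_comp]; rfl⟩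
  · ext x
    simp only [pointConfig, Set.mem_iUnion, Set.mem_ofPred_eq]
    constructor
    · rintro ⟨i, ⟨t, rfl⟩, h⟩
      have hi : v i ≠ 0 := fun h0 => by simp [h0] at h
      refine ⟨⟨i, (hs i).2 hi⟩, ?_, h⟩
      split_ifs
      · exact ⟨-t, by simp⟩
      · exact ⟨t, rfl⟩
    · rintro ⟨i, ⟨t, rfl⟩, h⟩
      refine ⟨i, ?_, h⟩
      split_ifs
      · exact ⟨-t, by simp⟩
      · exact ⟨t, rfl⟩

end Reduction

/-! ### Assembling the equivalences -/

section Equivalence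

variable {V : Type*} [AddCommGroup V] [Module ℝ V] {X : Set V}
  {π : Dual ℝ V}

lemma IsAligned.exists_finset {T : Set V} (h : IsAligned X T) (hX : X.Finite) :
    ∃ T : Finset V, IsAligned X T :=
  ⟨(hX.subset h.subset).toFinset, by rwa [Set.Finite.coe_toFinset]⟩

variable [FiniteDimensional ℝ V]

/-- A basis of `V` transports `X` to some `ℝ^d`, where it is its own model. Conversely, alignment of
the listed model passes back to `X`. -/
theorem exists_isAligned_iff_exists_isListed (hX : X.Finite) :
    (∃ T, IsAligned X T) ↔
      ∃ (d : ℕ) (Y : Set (Fin d → ℝ)), SameOrientedMatroid X Y ∧ IsListed Y := by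
  constructor
  · intro h
    have hY := sameOrientedMatroid_image (finBasis ℝ V).equivFun X
    obtain ⟨T, hT⟩ := hY.exists_isAligned_iff.1 h
    obtain ⟨T', hT'⟩ := hT.exists_finset (hX.image _)
    exact ⟨_, _, hY, hT'.isListed (hX.image _)⟩
  · rintro ⟨d, Y, hXY, hY⟩
    refine hXY.exists_isAligned_iff.2 (hY.isAligned ?_)
    obtain ⟨e, -⟩ := hXY
    have := hX.to_subtype
    exact (Finite.of_equiv _ e : Finite Y)

theorem isLean_tfae (hX : X.Finite) (hπ : ∀ x ∈ X, π x = 1) :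
    List.TFAE [∀ b, IsStringOrder X b → ∃ g, InducesOrder X b g, IsLean X,
      ∃ T, IsAligned X T] := by
  tfae_have 1 → 2 := isLean_of_forall_inducesOrder hX hπ
  tfae_have 2 → 3 := fun h => ⟨_, h.isAligned hX hπ⟩
  tfae_have 3 → 1 := fun ⟨_, h⟩ _ hb => by
    obtain ⟨T, hT⟩ := h.exists_finset hX
    exact hT.exists_inducesOrder hX hπ hb
  tfae_finish

end Equivalence

end Zono

theorem mainTheorem2 {V : Type*} [AddCommGroup V] [Module ℝ V] [FiniteDimensional ℝ V]
    {ι : Type*} [Fintype ι] (p : V) (v : ι → V) (π : Module.Dual ℝ V)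
    (hπ : Zono.IsGeneric v π) (r : ℕ) (hr : Zono.dim (Zono.zonotope p v) = r) :
    List.TFAE [
      Zono.AllCoherent (Zono.zonotope p v) π,
      ¬ ∃ (l : ℕ) (F : Fin (l + 1) → Set V),
        Zono.IsCellularString (Zono.zonotope p v) π F ∧ Zono.IsProper (Zono.zonotope p v) F ∧
        ∑ i, ((Zono.dim (F i) : ℤ) - 1) ≥ (r : ℤ) - 1,
      ∃ (d : ℕ) (X : Set (Fin d → ℝ)), Zono.IsAffineModel v π X ∧ Zono.IsListed X] := by
  subst hr
  obtain ⟨s, p', v', hpos, hZ, hX⟩ := hπ.exists_pos p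
  have htfae := Zono.isLean_tfae (Zono.finite_pointConfig hpos)
    fun x hx => Zono.apply_of_mem_pointConfig hx
  have h1 : Zono.AllCoherent (Zono.zonotope p' v') π ↔ _ :=
    ⟨fun h b hb => h.exists_inducesOrder hpos hb, Zono.allCoherent_of_forall_inducesOrder hpos⟩
  rw [← h1, Zono.isLean_pointConfig_iff (p := p') hpos,
    Zono.exists_isAligned_iff_exists_isListed (Zono.finite_pointConfig hpos)] at htfae
  simpa only [Zono.IsAffineModel, hZ, hX] using htfae
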